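/- **Setting.** Let $K$ sources and one target have features in a bounded measurable set $\mathcal X\subset\mathbb R^d$ and outputs in a bounded measurable set $\mathcal Y\subset\mathbb R$, with joint Lebesgue densities $p_1,\dots,p_K$ and $p_T$ on $\mathcal X\times\mathcal Y$. Assume that for every $j$, almost everywhere, $p_T(x)>0\Rightarrow p_j(x)>0$, and $p_T(y\mid x)=p_j(y\mid x)$ wherever $p_T(x)>0$; let $r_j(x)=p_T(x)/p_j(x)$. Let $L:\mathcal Y\times\mathcal Y\to[0,\infty)$ be Lipschitz, let $\Omega$ be a compact metric parameter space, fix a hyperparameter $\theta$, and let $h(x;\omega,\theta)\in\mathcal Y$ be measurable in $x$ and continuous in $\omega$. Assume that for each $j$ the source risk $\omega\mapsto\mathbb E_{p_j}L(h(X;\omega,\theta),Y)$ has a unique minimizer $\omega_j(\theta)$, and that the target risk $\mathbb E_{p_T}L(h(X;\omega_j(\theta),\theta),Y)$ has the same value for all $j$, denoted $f_T(\theta)=\mathbb E_{p_T}L(h(X;\omega,\theta),Y)$ with a suitable $\omega\in\Omega$ (as is the case if all ideal parameters coincide). **Data and estimates.** All samples are independent: source $j$ supplies i.i.d. data of law $p_j$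 split into parts of sizes $n_j^{de},n_j^{tr},n_j^{val}$, and the target supplies $n_T$ i.i.d. features of density $p_T(x)$; put $n^{val}=\sum_jn_j^{val}$. The estimate $\hat\omega_j(\theta)$ is a (measurable) minimizer over $\Omega$ of the empirical risk on the $tr$ part. The estimate $\hat r_j$ is the kernel uLSIF estimate, the minimizer over $u$ in a separable real reproducing kernel Hilbert space $\mathcal H$ of measurable functions on $\mathcal X$ with bounded kernel of $$\frac1{2n_j^{de}}\sum_{i=1}^{n_j^{de}}u(x_{j,i}^{de})^2-\frac1{n_T}\sum_{i=1}^{n_T}u(x_{T,i})+\frac{\lambda_j}{2}\|u\|_{\mathcal H}^2 ,$$ where every $r_j$ agrees $p_j$-almost everywhere with an element of $\mathcal H$, and the regularization $\lambda_j=\lambda_j(n_j^{de},n_T)>0$ satisfies $\lambda_j\to0$ and $\lambda_j^2\min(n_j^{de},n_T)\to\infty$ as $n_j^{de},n_T\to\infty$. With $\hat r_{j,i}=\hat r_j(x_{j,i}^{val})$ and $\hat a_{j,i}=\hat r_{j,i}L(h(x_{j,i}^{val};\hat\omega_j(\theta),\theta),y_{j,i}^{val})$, let $$\hat\eta_j=-\frac{\widehat{\mathrm{Cov}}(\hat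 a_j,\hat r_j)}{\widehat{\mathrm{Var}}(\hat r_j)},\quad \hat c_{j,i}=\hat a_{j,i}+\hat\eta_j(\hat r_{j,i}-1),\quad \widehat{\mathrm{Div}}_j=\frac1{n_j^{val}}\sum_i\hat c_{j,i}^2-\Big(\frac1{n_j^{val}}\sum_i\hat c_{j,i}\Big)^2,\quad \hat\lambda_j=\Big(\widehat{\mathrm{Div}}_j\sum_k\frac{n_k^{val}}{\widehat{\mathrm{Div}}_k}\Big)^{-1},$$ $$\hat f_{FedDA}=\sum_{j=1}^K\hat\lambda_j\,n_j^{val}\Big(\frac1{n_j^{val}}\sum_i\hat c_{j,i}\Big),\qquad \hat f_{FedIW}=\frac1{n^{val}}\sum_{j=1}^Kn_j^{val}\Big(\frac1{n_j^{val}}\sum_i\hat a_{j,i}\Big)$$ (a quotient with denominator $0$ is read as $0$). **Nondegeneracy.** Assume for every $j$ that $\mathrm{Var}_{p_j}[r_j(X)]\ne0$ and that $$\mathrm{Div}_j(\theta)=\mathbb E_{p_j}\big[r_j(X)L(h(X;\omega_j(\theta),\theta),Y)+\eta_j(\theta)(r_j(X)-1)\big]^2-f_T(\theta)^2\ne0,$$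 where $\eta_j(\theta)=-\mathrm{Cov}_{p_j}[r_j(X)L(h(X;\omega_j(\theta),\theta),Y),r_j(X)]/\mathrm{Var}_{p_j}[r_j(X)]$. Assume also that the coefficients $\hat\eta_j$ are uniformly bounded in fourth mean: there is $B$ with $(\mathbb E|\hat\eta_j|^4)^{1/4}\le B$ for all $j$ and all sufficiently large sample sizes (in particular, this holds if the $\hat\eta_j$ are uniformly bounded). **Claim.** The asymptotic variance of FedDAE is at most that of FedIWE: 1. both estimates have finite variance as soon as all sample sizes are large enough; 2. the limits below exist and satisfy $$\lim_{\forall j,\ n_j^{de},n_j^{tr},n_j^{val},n_T\to\infty}\mathbb V[\hat f_{FedDA}]\ \le\ \lim_{\forall j,\ n_j^{de},n_j^{tr},n_j^{val},n_T\to\infty}\mathbb V[\hat f_{FedIW}];$$ 3. the inequality also holds to leading order, with the limit in the training sizes taken first and the validation sizes growing proportionally: for all $c,\varepsilon>0$, whenever the $n_j^{val}$ are large enough and $n_j^{val}\ge c\,n^{val}$ for all $j$, then for all sufficiently large $n_j^{de},n_j^{tr},n_T$ $$\mathbb V[\hat f_{FedDA}]\le(1+\varepsilon)\,\mathbb V[\hat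 f_{FedIW}].$$ -/

import Mathlib

open MeasureTheory ProbabilityTheory Filter Topology
open scoped ENNReal NNReal

attribute [local instance] MeasureTheory.Measure.Subtype.measureSpace

namespace FedCS

/-! ### Densities, density ratio, risks -/

section Population

variable {X Y Om Th : Type*} [MeasureSpace X] [MeasureSpace Y]

/-- The law on `X × Y` with joint density `p` with respect to Lebesgue measure. -/
noncomputable def law (p : X × Y → ℝ≥0∞) : Measure (X × Y) := volume.withDensity p

/-- The feature density `p(x) = ∫ p(x, y) dy`. -/
noncomputable def featDensity (p : X × Y → ℝ≥0∞) (x : X) : ℝ≥0∞ := ∫⁻ y, p (x, y)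

/-- The conditional output density `p(y | x) = p(x, y) / p(x)`. -/
noncomputable def condDensity (p : X × Y → ℝ≥0∞) (x : X) (y : Y) : ℝ≥0∞ :=
  p (x, y) / featDensity p x

/-- The density ratio `r(x) = p_T(x) / p_j(x)` between the target and a source. -/
noncomputable def ratio (pT pj : X × Y → ℝ≥0∞) (x : X) : ℝ :=
  (featDensity pT x / featDensity pj x).toReal

/-- The risk of the model with parameter `ω` and hyperparameter `θ` for the joint density `p`. -/
noncomputable def risk (L : Y → Y → ℝ) (h : X → Om → Th → Y) (θ : Th)
    (p : X × Y → ℝ≥0∞) (ω : Om) : ℝ :=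
  ∫ z, L (h z.1 ω θ) z.2 ∂(law p)

/-- The importance weighted loss `(x, y) ↦ r_j(x) L(h(x; ω, θ), y)`. -/
noncomputable def wLoss (L : Y → Y → ℝ) (h : X → Om → Th → Y) (θ : Th)
    (pT pj : X × Y → ℝ≥0∞) (ω : Om) (z : X × Y) : ℝ :=
  ratio pT pj z.1 * L (h z.1 ω θ) z.2

/-- The control variate coefficient
`η_j(θ) = - Cov[r_j L(h(X; ω, θ), Y), r_j] / Var[r_j]`, under `p_j`. -/
noncomputable def eta (L : Y → Y → ℝ) (h : X → Om → Th → Y) (θ : Th)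
    (pT pj : X × Y → ℝ≥0∞) (ω : Om) : ℝ :=
  -(cov[wLoss L h θ pT pj ω, fun z => ratio pT pj z.1; law pj] /
    Var[fun z => ratio pT pj z.1; law pj])

/-- The divergence measure
`Div_j(θ) = E_{p_j} [r_j L(h(X; ω, θ), Y) + η_j(θ) (r_j - 1)]² - f_T(θ)²`,
where `fT` is the target risk. -/
noncomputable def diverg (L : Y → Y → ℝ) (h : X → Om → Th → Y) (θ : Th)
    (pT pj : X × Y → ℝ≥0∞) (ω : Om) (fT : ℝ) : ℝ :=
  (∫ z, (wLoss L h θ pT pj ω z + eta L h θ pT pj ω * (ratio pT pj z.1 - 1)) ^ 2 ∂(law pj))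
    - fT ^ 2

end Population

/-! ### Training: empirical risk minimization and uLSIF -/

section Training

variable {X Y Om Th H : Type*}

/-- The empirical risk on a data set of size `n`. -/
noncomputable def empRisk (L : Y → Y → ℝ) (h : X → Om → Th → Y) (θ : Th) {n : ℕ}
    (D : Fin n → X × Y) (ω : Om) : ℝ :=
  (∑ i, L (h (D i).1 ω θ) (D i).2) / n

/-- The objective function of (kernel) unconstrained least-squares importance fitting with
regularization parameter `lam`, on the source features `xs` and the target features `xt`:
`(1 / 2n) ∑ u(xs i)² - (1 / m) ∑ u(xt i) + (lam / 2) ‖u‖²`. -/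
noncomputable def ulsifObj [NormedAddCommGroup H] [InnerProductSpace ℝ H] [RKHS ℝ H X ℝ]
    (lam : ℝ) {n m : ℕ} (xs : Fin n → X) (xt : Fin m → X) (u : H) : ℝ :=
  (∑ i, (u (xs i)) ^ 2) / (2 * n) - (∑ i, u (xt i)) / m + lam / 2 * ‖u‖ ^ 2

end Training

/-! ### The estimates of the target risk as functions of the validation values

For one source, `r i` stands for `r̂(x_i)` and `a i` for `r̂(x_i) L(h(x_i; ω̂, θ), y_i)` at the
`i`th validation point. -/

section Estimates

variable {n K : ℕ}

/-- Sample mean. -/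
noncomputable def smean (v : Fin n → ℝ) : ℝ := (∑ i, v i) / n

/-- Sample covariance (`scov v v` is the sample variance). -/
noncomputable def scov (u v : Fin n → ℝ) : ℝ :=
  smean fun i => (u i - smean u) * (v i - smean v)

/-- The estimated coefficient `η̂_j(θ)`. -/
noncomputable def etaHat (a r : Fin n → ℝ) : ℝ := -(scov a r / scov r r)

/-- The summands of the control variate estimate. -/
noncomputable def cvTerm (a r : Fin n → ℝ) (i : Fin n) : ℝ := a i + etaHat a r * (r i - 1)

/-- The control variate estimate `f̂_CV(θ; D_j)`. -/
noncomputable def fCV (a r : Fin n → ℝ) : ℝ := smean (cvTerm a r)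

/-- The estimated divergence measure. -/
noncomputable def divHat (a r : Fin n → ℝ) : ℝ :=
  smean (fun i => (cvTerm a r i) ^ 2) - (smean (cvTerm a r)) ^ 2

/-- The estimated weight `λ̂_j(θ)` of the `j`th source. -/
noncomputable def lamHat (m : Fin K → ℕ) (a r : (j : Fin K) → Fin (m j) → ℝ) (j : Fin K) : ℝ :=
  (divHat (a j) (r j) * ∑ k, (m k : ℝ) / divHat (a k) (r k))⁻¹

/-- The federated domain adaptation estimate (FedDAE). -/
noncomputable def fedDA (m : Fin K → ℕ) (a r : (j : Fin K) → Fin (m j) → ℝ) : ℝ :=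
  ∑ j, lamHat m a r j * m j * fCV (a j) (r j)

/-- The federated importance weighting estimate (FedIWE); `smean (a j)` is `f̂_IW(θ; D_j)`. -/
noncomputable def fedIW (m : Fin K → ℕ) (a : (j : Fin K) → Fin (m j) → ℝ) : ℝ :=
  (1 / ∑ j, (m j : ℝ)) * ∑ j, m j * smean (a j)

end Estimates

/-! ### The estimates as random variables -/

/-- Each source data set is split into a density ratio, a training and a validation part. -/
inductive Part
  | de
  | tr
  | val

/-- The sizes `(n_j^de)_j`, `(n_j^tr)_j` and `n_T`. -/
abbrev TrainSizes (K : ℕ) := (Fin K → ℕ) × (Fin K → ℕ) × ℕ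

section Random

variable {X Y Om Th H W : Type*} {K : ℕ} [NormedAddCommGroup H] [InnerProductSpace ℝ H]
  [RKHS ℝ H X ℝ]

/-- The values `r̂_j(x_{j,i}^val)`: the ratio is fitted on the first `n_j^de` features of the `de`
part of source `j` and on the first `n_T` target features. -/
noncomputable def ratioVal (rhat : Fin K → (n m : ℕ) → (Fin n → X) → (Fin m → X) → H)
    (Z : Fin K → Part → ℕ → W → X × Y) (XT : ℕ → W → X)
    (m : Fin K → ℕ) (t : TrainSizes K) (w : W) (j : Fin K) (i : Fin (m j)) : ℝ :=
  (rhat j (t.1 j) t.2.2 (fun k => (Z j .de k w).1) (fun k => XT k w)) (Z j .val i w).1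

/-- The values `r̂_j(x_{j,i}^val) L(h(x_{j,i}^val; ω̂_j(θ), θ), y_{j,i}^val)`, where `ω̂_j(θ)` is
fitted on the first `n_j^tr` points of the `tr` part of source `j`. -/
noncomputable def lossVal (L : Y → Y → ℝ) (h : X → Om → Th → Y) (θ : Th)
    (rhat : Fin K → (n m : ℕ) → (Fin n → X) → (Fin m → X) → H)
    (what : Fin K → (n : ℕ) → (Fin n → X × Y) → Om)
    (Z : Fin K → Part → ℕ → W → X × Y) (XT : ℕ → W → X)
    (m : Fin K → ℕ) (t : TrainSizes K) (w : W) (j : Fin K) (i : Fin (m j)) : ℝ :=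
  ratioVal rhat Z XT m t w j i *
    L (h (Z j .val i w).1 (what j (t.2.1 j) fun k => Z j .tr k w) θ) (Z j .val i w).2

/-- FedDAE for validation sizes `m` and training sizes `t`. -/
noncomputable def FedDAE (L : Y → Y → ℝ) (h : X → Om → Th → Y) (θ : Th)
    (rhat : Fin K → (n m : ℕ) → (Fin n → X) → (Fin m → X) → H)
    (what : Fin K → (n : ℕ) → (Fin n → X × Y) → Om)
    (Z : Fin K → Part → ℕ → W → X × Y) (XT : ℕ → W → X)
    (m : Fin K → ℕ) (t : TrainSizes K) (w : W) : ℝ :=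
  fedDA m (lossVal L h θ rhat what Z XT m t w) (ratioVal rhat Z XT m t w)

/-- FedIWE for validation sizes `m` and training sizes `t`. -/
noncomputable def FedIWE (L : Y → Y → ℝ) (h : X → Om → Th → Y) (θ : Th)
    (rhat : Fin K → (n m : ℕ) → (Fin n → X) → (Fin m → X) → H)
    (what : Fin K → (n : ℕ) → (Fin n → X × Y) → Om)
    (Z : Fin K → Part → ℕ → W → X × Y) (XT : ℕ → W → X)
    (m : Fin K → ℕ) (t : TrainSizes K) (w : W) : ℝ :=
  fedIW m (lossVal L h θ rhat what Z XT m t w)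

end Random

end FedCS

namespace FedCS

/-! ### Sample means, weights and moments -/

section Deterministic

variable {n K : ℕ}

/-! The comparison is first made for ideal estimates, in which the density ratios, model parameters,
coefficients and divergences are the true ones, and then transferred to the fitted estimates.

Ideal estimates. Write `a` for the weighted loss and `r` for the ratio of a source. Under the source
law `r - 1` has mean zero, so the divergence `D j` is the variance of the control variate summand.
The optimal coefficient gives `D j = Var a - Cov² / Var r ≤ Var a` (`cvDiv_le_variance`). With
weights proportional to `m j / D j`, the combined estimate has variance exactly `1 / ∑ m k / D k`
(`sum_wt_sq_mul_div`). The importance weighted estimate has variance at least `∑ m k D k / (∑ m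
k)²`, which is no smaller by Cauchy-Schwarz (`ValModel.inv_sum_le_variance_fedIW`).

Transfer. All empirical quantities are functions of five sample moments per source. On the event
that these are close to the population moments, the coefficients, divergences and weights are close
to the ideal ones. The weights are nonnegative with sum at most one on any event, so elsewhere the
error is controlled by the fitted means and `η̂`. The fourth moment bound on `η̂` and Hölder's
inequality bound this part by the fourth root of the probability of the bad event. That probability
is at most a fitting error (Markov) plus an exponentially small term (Hoeffding); see
`ValModel.eLpNorm_fedDA_sub_le` and `ValModel.exists_measure_compl_goodEvent_le`. If the validation
sizes grow proportionally, the exponential term is negligible against the standard deviation, which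
is of order `n^(-1/2)`. The fitting error vanishes in the training limit with the validation sizes
fixed. In the joint limit both variances tend to zero, so the inequality of the limits is `0 ≤ 0`;
the leading order statement carries the actual comparison. All three claims are gathered in
`ValModel.variance_comparison`.

Fitting error. The training data are independent of each validation point, so the fourth mean error
at a validation point is an integral against the source law and does not depend on the index of the
point. For the losses, the strong law in the Banach space `C(Om, ℝ)` gives uniform convergence of
the empirical risks, and compactness with uniqueness of the minimizer gives consistency
(`tendsto_erm_err`). For uLSIF, the first order condition shows that the empirical square error is
of order `lam` while the norm error in `H` stays bounded; a law of large numbers for the covariance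
operator passes to the population (`tendsto_ulsif_err`). -/

lemma smean_add (u v : Fin n → ℝ) : smean (fun i => u i + v i) = smean u + smean v := by
  simp [smean, Finset.sum_add_distrib, add_div]

lemma smean_sub (u v : Fin n → ℝ) : smean (fun i => u i - v i) = smean u - smean v := by
  simp [smean, Finset.sum_sub_distrib, sub_div]

lemma smean_const_mul (c : ℝ) (u : Fin n → ℝ) : smean (fun i => c * u i) = c * smean u := by
  simp [smean, ← Finset.mul_sum, mul_div_assoc]

lemma smean_mul_const (c : ℝ) (u : Fin n → ℝ) : smean (fun i => u i * c) = smean u * c := by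
  simp [smean, ← Finset.sum_mul, div_mul_eq_mul_div]

lemma smean_const (hn : 0 < n) (c : ℝ) : smean (fun _ : Fin n => c) = c := by
  have : (n : ℝ) ≠ 0 := by positivity
  simp [smean]; field_simp

lemma smean_mono {u v : Fin n → ℝ} (h : ∀ i, u i ≤ v i) : smean u ≤ smean v := by
  unfold smean
  gcongr with i
  exact h i

lemma abs_smean_le (u : Fin n → ℝ) : |smean u| ≤ smean fun i => |u i| := by
  unfold smean
  rw [abs_div, Nat.abs_cast]
  gcongr
  exact Finset.abs_sum_le_sum_abs _ _

lemma smean_nonneg {u : Fin n → ℝ} (h : ∀ i, 0 ≤ u i) : 0 ≤ smean u :=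
  div_nonneg (Finset.sum_nonneg fun i _ => h i) (Nat.cast_nonneg _)

lemma scov_eq (hn : 0 < n) (u v : Fin n → ℝ) :
    scov u v = smean (fun i => u i * v i) - smean u * smean v := by
  have : (fun i => (u i - smean u) * (v i - smean v)) =
      fun i => ((u i * v i - smean u * v i) - (u i * smean v - smean u * smean v)) := by
    ext i; ring
  rw [scov, this, smean_sub, smean_sub, smean_sub, smean_const_mul, smean_mul_const,
    smean_const hn]
  ring

lemma divHat_eq_scov (hn : 0 < n) (a r : Fin n → ℝ) :
    divHat a r = scov (cvTerm a r) (cvTerm a r) := by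
  rw [scov_eq hn, divHat]
  simp only [pow_two]

/-- It is a sample variance. This keeps the estimated weights in `[0, 1]` even where the moments are
far from their limits. -/
lemma divHat_nonneg (a r : Fin n → ℝ) : 0 ≤ divHat a r := by
  rcases Nat.eq_zero_or_pos n with rfl | hn
  · simp [divHat, smean]
  · rw [divHat_eq_scov hn]
    exact smean_nonneg fun i => mul_self_nonneg _

lemma fCV_eq (hn : 0 < n) (a r : Fin n → ℝ) :
    fCV a r = smean a + etaHat a r * (smean r - 1) := by
  rw [fCV]
  unfold cvTerm
  rw [smean_add, smean_const_mul, smean_sub, smean_const hn]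

/-- The monomials in `(a, r)` whose means determine the control variate coefficient and the
divergence measure. -/
def monom (k : Fin 5) (a r : ℝ) : ℝ := ![r, r ^ 2, a, a ^ 2, a * r] k

/-- The control variate coefficient as a function of the moments. -/
noncomputable def coefOf (x : Fin 5 → ℝ) : ℝ := -((x 4 - x 2 * x 0) / (x 1 - x 0 ^ 2))

/-- The divergence measure as a function of the moments. -/
noncomputable def divOf (x : Fin 5 → ℝ) : ℝ :=
  (x 3 - x 2 ^ 2) + 2 * coefOf x * (x 4 - x 2 * x 0) + coefOf x ^ 2 * (x 1 - x 0 ^ 2)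

/-- The sample moments. -/
noncomputable def smom (a r : Fin n → ℝ) (k : Fin 5) : ℝ := smean fun i => monom k (a i) (r i)

lemma etaHat_eq_coefOf (hn : 0 < n) (a r : Fin n → ℝ) : etaHat a r = coefOf (smom a r) := by
  rw [etaHat, scov_eq hn, scov_eq hn]
  simp [coefOf, smom, monom, pow_two]

/-- A sample variance ignores shifts, so the `-1` in `r - 1` drops out and what remains is a
quadratic polynomial in the coefficient. Closeness of the divergence thus reduces to continuity of
`divOf` in the moments. -/
lemma divHat_eq_divOf (hn : 0 < n) (a r : Fin n → ℝ) : divHat a r = divOf (smom a r) := by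
  have h1 : (fun i => cvTerm a r i ^ 2) = fun i =>
      ((a i ^ 2 + 2 * etaHat a r * (a i * r i)) + etaHat a r ^ 2 * r i ^ 2) +
      ((-2 * etaHat a r) * a i + ((-2 * etaHat a r ^ 2) * r i + etaHat a r ^ 2)) := by
    ext i; simp only [cvTerm]; ring
  have h2 : smean (cvTerm a r) = smean a + etaHat a r * (smean r - 1) := fCV_eq hn a r
  rw [divHat, h1, h2, smean_add, smean_add, smean_add, smean_add, smean_add, smean_const_mul,
    smean_const_mul, smean_const_mul, smean_const_mul, smean_const hn, divOf,
    ← etaHat_eq_coefOf hn]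
  simp [smom, monom]
  ring

lemma continuousAt_coefOf {x : Fin 5 → ℝ} (hx : x 1 - x 0 ^ 2 ≠ 0) : ContinuousAt coefOf x := by
  unfold coefOf
  refine ContinuousAt.neg (ContinuousAt.div ?_ ?_ hx) <;> fun_prop

lemma continuousAt_divOf {x : Fin 5 → ℝ} (hx : x 1 - x 0 ^ 2 ≠ 0) : ContinuousAt divOf x := by
  have := continuousAt_coefOf hx
  unfold divOf
  fun_prop

/-- The normalized inverse variance weights. -/
noncomputable def wt (m D : Fin K → ℝ) (j : Fin K) : ℝ := (D j * ∑ k, m k / D k)⁻¹ * m j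

/-- Valid also when some `D j` vanishes: with the inverse of zero read as zero, such a source gets
weight zero. -/
lemma wt_eq (m D : Fin K → ℝ) (j : Fin K) : wt m D j = (m j / D j) / ∑ k, m k / D k := by
  rw [wt, mul_inv, div_eq_mul_inv, div_eq_mul_inv]; ring

lemma wt_nonneg {m D : Fin K → ℝ} (hm : ∀ j, 0 ≤ m j) (hD : ∀ j, 0 ≤ D j) (j : Fin K) :
    0 ≤ wt m D j := by
  rw [wt_eq]
  exact div_nonneg (div_nonneg (hm j) (hD j))
    (Finset.sum_nonneg fun k _ => div_nonneg (hm k) (hD k))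

lemma sum_wt (m D : Fin K → ℝ) : ∑ j, wt m D j = (∑ k, m k / D k) / ∑ k, m k / D k := by
  simp_rw [wt_eq, ← Finset.sum_div]

/-- The sum is `S / S`, which is one, or zero when `S = 0`. -/
lemma sum_wt_le_one (m D : Fin K → ℝ) : ∑ j, wt m D j ≤ 1 := by
  rw [sum_wt]; exact div_self_le_one _

lemma wt_le_one {m D : Fin K → ℝ} (hm : ∀ j, 0 ≤ m j) (hD : ∀ j, 0 ≤ D j) (j : Fin K) :
    wt m D j ≤ 1 :=
  (Finset.single_le_sum (fun k _ => wt_nonneg hm hD k) (Finset.mem_univ j)).trans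
    (sum_wt_le_one m D)

lemma sum_div_pos [Nonempty (Fin K)] {m D : Fin K → ℝ} (hm : ∀ j, 0 < m j) (hD : ∀ j, 0 < D j) :
    0 < ∑ k, m k / D k :=
  Finset.sum_pos (fun k _ => div_pos (hm k) (hD k)) Finset.univ_nonempty

lemma sum_wt_eq_one [Nonempty (Fin K)] {m D : Fin K → ℝ} (hm : ∀ j, 0 < m j)
    (hD : ∀ j, 0 < D j) : ∑ j, wt m D j = 1 := by
  rw [sum_wt, div_self (sum_div_pos hm hD).ne']

/-- Each quotient `m k / D k`, and hence their sum, changes by a factor between `1 / (1 + δ)` and `1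
/ (1 - δ)`. So a weight changes by a factor between `(1 - δ) / (1 + δ)` and `(1 + δ) / (1 - δ)`,
which lie in `[1 - 4δ, 1 + 4δ]` for `δ ≤ 1 / 2`. The error is relative to the weight itself, which
keeps it comparable to the standard deviation later on. -/
lemma abs_wt_sub_le [Nonempty (Fin K)] {m D D' : Fin K → ℝ} {δ : ℝ} (hδ0 : 0 ≤ δ)
    (hδ : δ ≤ 1 / 2) (hm : ∀ j, 0 < m j) (hD : ∀ j, 0 < D j)
    (hD' : ∀ j, |D' j - D j| ≤ δ * D j) (j : Fin K) :
    |wt m D' j - wt m D j| ≤ 4 * δ * wt m D j := by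
  have hlo : ∀ k, (1 - δ) * D k ≤ D' k := fun k => by nlinarith [abs_le.1 (hD' k)]
  have hhi : ∀ k, D' k ≤ (1 + δ) * D k := fun k => by nlinarith [abs_le.1 (hD' k)]
  have h1 : 0 < 1 - δ := by linarith
  have h2 : 0 < 1 + δ := by linarith
  have hp : ∀ k, 0 < D' k := fun k => (mul_pos h1 (hD k)).trans_le (hlo k)
  have hqhi : ∀ k, m k / D' k ≤ (m k / D k) / (1 - δ) := fun k => by
    rw [div_div, mul_comm]
    exact div_le_div_of_nonneg_left (hm k).le (mul_pos h1 (hD k)) (hlo k)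
  have hqlo : ∀ k, (m k / D k) / (1 + δ) ≤ m k / D' k := fun k => by
    rw [div_div, mul_comm (D k)]
    exact div_le_div_of_nonneg_left (hm k).le (hp k) (hhi k)
  have hS := sum_div_pos hm hD
  have hS' := sum_div_pos hm hp
  have hShi : ∑ k, m k / D' k ≤ (∑ k, m k / D k) / (1 - δ) := by
    rw [Finset.sum_div]; exact Finset.sum_le_sum fun k _ => hqhi k
  have hSlo : (∑ k, m k / D k) / (1 + δ) ≤ ∑ k, m k / D' k := by
    rw [Finset.sum_div]; exact Finset.sum_le_sum fun k _ => hqlo k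
  rw [wt_eq, wt_eq]
  set S := ∑ k, m k / D k
  set S' := ∑ k, m k / D' k
  have hq : 0 < m j / D j := div_pos (hm j) (hD j)
  have hq1 := hqhi j
  have hq2 := hqlo j
  set q := m j / D j
  set q' := m j / D' j
  rw [div_le_iff₀ h2] at hSlo hq2
  rw [le_div_iff₀ h1] at hShi hq1
  have hq' : 0 < q' := by
    by_contra hc
    nlinarith
  rw [abs_le]
  constructor
  · suffices h : (q * (1 - 4 * δ)) / S ≤ q' / S' by
      rw [show (q * (1 - 4 * δ)) / S = q / S - 4 * δ * (q / S) by ring] at h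
      linarith
    rw [div_le_div_iff₀ hS hS']
    rcases le_total (1 - 4 * δ) 0 with h | h
    · nlinarith [mul_pos hq hS', mul_pos hq' hS]
    · calc q * (1 - 4 * δ) * S' ≤ (q' * (1 + δ)) * (1 - 4 * δ) * S' := by gcongr
        _ = (q' * ((1 + δ) * (1 - 4 * δ))) * S' := by ring
        _ ≤ (q' * (1 - δ)) * S' := by
          gcongr; nlinarith
        _ = q' * (S' * (1 - δ)) := by ring
        _ ≤ q' * S := by gcongr
  · rw [sub_le_iff_le_add, show 4 * δ * (q / S) + q / S = (q * (1 + 4 * δ)) / S by ring,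
      div_le_div_iff₀ hS' hS]
    calc q' * S ≤ q' * (S' * (1 + δ)) := by gcongr
      _ = (q' * (1 + δ)) * S' := by ring
      _ ≤ (q' * ((1 - δ) * (1 + 4 * δ))) * S' := by
        gcongr; nlinarith
      _ = (q' * (1 - δ)) * (1 + 4 * δ) * S' := by ring
      _ ≤ q * (1 + 4 * δ) * S' := by gcongr

lemma fedDA_eq (m : Fin K → ℕ) (a r : (j : Fin K) → Fin (m j) → ℝ) :
    fedDA m a r = ∑ j, wt (fun k => (m k : ℝ)) (fun k => divHat (a k) (r k)) j
      * fCV (a j) (r j) := rfl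

/-- A crude bound for the error of FedDAE. -/
lemma abs_fedDA_sub_le (m : Fin K → ℕ) (hm : ∀ j, 0 < m j)
    (a r : (j : Fin K) → Fin (m j) → ℝ) (f : ℝ) :
    |fedDA m a r - f| ≤ (∑ j, (|smean (a j) - f| + |etaHat (a j) (r j)| * |smean (r j) - 1|))
      + |f| := by
  have hw0 : ∀ j, 0 ≤ wt (fun k => (m k : ℝ)) (fun k => divHat (a k) (r k)) j :=
    wt_nonneg (fun k => Nat.cast_nonneg _) fun k => divHat_nonneg _ _
  have hw1 : ∀ j, wt (fun k => (m k : ℝ)) (fun k => divHat (a k) (r k)) j ≤ 1 :=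
    wt_le_one (fun k => Nat.cast_nonneg _) fun k => divHat_nonneg _ _
  have hs := sum_wt_le_one (fun k => (m k : ℝ)) (fun k => divHat (a k) (r k))
  have hs0 := Finset.sum_nonneg fun j (_ : j ∈ Finset.univ) => hw0 j
  rw [fedDA_eq]
  set w := wt (fun k => (m k : ℝ)) (fun k => divHat (a k) (r k))
  -- If all estimated divergences vanish, the weights sum to zero rather than one, whence the
  -- remainder with `f`.
  have : ∑ j, w j * fCV (a j) (r j) - f =
      (∑ j, w j * (fCV (a j) (r j) - f)) - (1 - ∑ j, w j) * f := by
    simp_rw [mul_sub, Finset.sum_sub_distrib, ← Finset.sum_mul]; ring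
  rw [this]
  refine (abs_sub _ _).trans (add_le_add ?_ ?_)
  · refine (Finset.abs_sum_le_sum_abs _ _).trans (Finset.sum_le_sum fun j _ => ?_)
    rw [abs_mul, abs_of_nonneg (hw0 j)]
    refine (mul_le_of_le_one_left (abs_nonneg _) (hw1 j)).trans ?_
    rw [fCV_eq (hm j), ← abs_mul, add_sub_right_comm]
    exact abs_add_le _ _
  · rw [abs_mul, abs_of_nonneg (by linarith)]
    exact mul_le_of_le_one_left (abs_nonneg _) (by linarith)

/-- The bound for the error of FedDAE when the estimated coefficients and divergence measures are
close to `c` and `D`. -/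
lemma abs_fedDA_sub_le_of_close [Nonempty (Fin K)] (m : Fin K → ℕ) (hm : ∀ j, 0 < m j)
    (a r : (j : Fin K) → Fin (m j) → ℝ) (f : ℝ) {c D : Fin K → ℝ} {δ : ℝ} (hδ0 : 0 ≤ δ)
    (hδ : δ ≤ 1 / 4) (hD : ∀ j, 0 < D j)
    (hDc : ∀ j, |divHat (a j) (r j) - D j| ≤ δ * D j)
    (hc : ∀ j, |etaHat (a j) (r j) - c j| ≤ δ) :
    |fedDA m a r - f| ≤
      |∑ j, wt (fun k => (m k : ℝ)) D j * (smean (a j) - f + c j * (smean (r j) - 1))|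
      + 4 * δ * ∑ j, wt (fun k => (m k : ℝ)) D j * |smean (a j) - f + c j * (smean (r j) - 1)|
      + 2 * δ * ∑ j, wt (fun k => (m k : ℝ)) D j * |smean (r j) - 1| := by
  have hm' : ∀ j, (0 : ℝ) < (fun k => (m k : ℝ)) j := fun j => by simpa using hm j
  have hw0 := wt_nonneg (m := fun k => (m k : ℝ)) (D := D) (fun k => (hm' k).le)
    fun k => (hD k).le
  have hcl := abs_wt_sub_le hδ0 (by linarith) hm' hD hDc
  -- Positivity makes the estimated weights sum to exactly one, so that `f` can be distributed over
  -- the sources.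
  have hD' : ∀ j, 0 < divHat (a j) (r j) := fun j => by
    nlinarith [abs_le.1 (hDc j), hD j]
  have hs := sum_wt_eq_one hm' hD'
  rw [fedDA_eq]
  set w' := wt (fun k => (m k : ℝ)) (fun k => divHat (a k) (r k))
  set w := wt (fun k => (m k : ℝ)) D
  -- The ideally weighted combination, the error of the weights, and the error of the coefficients.
  -- The last two are products of a small factor and a small mean.
  have e1 : ∑ j, w' j * fCV (a j) (r j) - f =
      (∑ j, w j * (smean (a j) - f + c j * (smean (r j) - 1))) +
      (∑ j, (w' j - w j) * (smean (a j) - f + c j * (smean (r j) - 1))) +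
      ∑ j, w' j * ((etaHat (a j) (r j) - c j) * (smean (r j) - 1)) := by
    have : ∑ j, w' j * fCV (a j) (r j) - f = ∑ j, w' j * (fCV (a j) (r j) - f) := by
      simp_rw [mul_sub, Finset.sum_sub_distrib, ← Finset.sum_mul, hs, one_mul]
    rw [this, ← Finset.sum_add_distrib, ← Finset.sum_add_distrib]
    refine Finset.sum_congr rfl fun j _ => ?_
    rw [fCV_eq (hm j)]; ring
  rw [e1]
  refine (abs_add_le _ _).trans (add_le_add ((abs_add_le _ _).trans (add_le_add le_rfl ?_)) ?_)
  · rw [Finset.mul_sum]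
    refine (Finset.abs_sum_le_sum_abs _ _).trans (Finset.sum_le_sum fun j _ => ?_)
    rw [abs_mul, ← mul_assoc]
    exact mul_le_mul_of_nonneg_right (hcl j) (abs_nonneg _)
  · rw [Finset.mul_sum]
    refine (Finset.abs_sum_le_sum_abs _ _).trans (Finset.sum_le_sum fun j _ => ?_)
    rw [abs_mul, abs_mul]
    have : |w' j| ≤ 2 * w j := by
      have h1 := abs_le.1 (hcl j)
      have h2 := hw0 j
      rw [abs_le]; constructor <;> nlinarith
    calc |w' j| * (|etaHat (a j) (r j) - c j| * |smean (r j) - 1|)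
        ≤ (2 * w j) * (δ * |smean (r j) - 1|) := by
          have := hw0 j
          gcongr; exact hc j
      _ = _ := by ring

end Deterministic

/-! ### Norms, variances and Hoeffding's inequality -/

section Norms

variable {W : Type*} [MeasurableSpace W] {μ : Measure W}

lemma measurable_smean {n : ℕ} {X : Fin n → W → ℝ} (hX : ∀ i, Measurable (X i)) :
    Measurable fun w => smean fun i => X i w := by
  unfold smean; fun_prop

lemma eLpNorm_smean_le {n : ℕ} {X : Fin n → W → ℝ} (hX : ∀ i, Measurable (X i)) {p c : ℝ≥0∞}
    (hp : 1 ≤ p) (h : ∀ i, eLpNorm (X i) p μ ≤ c) :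
    eLpNorm (fun w => smean fun i => X i w) p μ ≤ c := by
  rcases Nat.eq_zero_or_pos n with rfl | hn
  · simp [smean]
  have e : (fun w => smean fun i => X i w) = ((n : ℝ)⁻¹) • ∑ i, X i := by
    ext w; simp [smean, div_eq_inv_mul]
  rw [e, eLpNorm_const_smul]
  calc ‖(n : ℝ)⁻¹‖ₑ * eLpNorm (∑ i, X i) p μ
      ≤ ‖(n : ℝ)⁻¹‖ₑ * ∑ i : Fin n, c := by
        gcongr
        exact (eLpNorm_sum_le (fun i _ => (hX i).aestronglyMeasurable) hp).trans
          (Finset.sum_le_sum fun i _ => h i)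
    _ = ((n : ℝ≥0∞)⁻¹ * n) * c := by
        rw [Finset.sum_const, Finset.card_univ, Fintype.card_fin, nsmul_eq_mul, ← mul_assoc]
        congr 2
        rw [enorm_inv (by positivity)]
        simp
    _ = c := by
        rw [ENNReal.inv_mul_cancel (by simpa using hn.ne') (by simp), one_mul]

lemma eLpNorm_two_mul_le {X Y : W → ℝ} (hX : AEStronglyMeasurable X μ)
    (hY : AEStronglyMeasurable Y μ) :
    eLpNorm (fun w => X w * Y w) 2 μ ≤ eLpNorm X 4 μ * eLpNorm Y 4 μ := by
  have : ENNReal.HolderTriple 4 4 2 := ⟨by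
    have h2 : (4 : ℝ≥0∞) = 2 * 2 := by norm_num
    rw [h2, ENNReal.mul_inv (by simp) (by simp), ← two_mul, ← mul_assoc,
      ENNReal.mul_inv_cancel (by simp) (by simp), one_mul]⟩
  have h := eLpNorm_smul_le_mul_eLpNorm (p := 4) (q := 4) (r := 2) (𝕜 := ℝ) hY hX
  exact h

lemma eLpNorm_indicator_one {G : Set W} (hG : MeasurableSet G) {p : ℝ≥0∞} (hp : p ≠ 0)
    (hp' : p ≠ ∞) :
    eLpNorm (G.indicator fun _ => (1 : ℝ)) p μ = μ G ^ (1 / p.toReal) := by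
  rw [eLpNorm_indicator_const hG hp hp']; simp

lemma eLpNorm_two_eq_sqrt {X : W → ℝ} (hX : MemLp X 2 μ) :
    eLpNorm X 2 μ = ENNReal.ofReal (√(∫ w, X w ^ 2 ∂μ)) := by
  rw [hX.eLpNorm_eq_integral_rpow_norm (by simp) (by simp)]
  simp [Real.sqrt_eq_rpow]

variable [IsProbabilityMeasure μ]

/-- The variance is the least mean square deviation from a constant. Hence a biased estimate may be
centered at the target risk instead of at its unknown mean. -/
lemma variance_le_sq {X : W → ℝ} (hX : MemLp X 2 μ) (c : ℝ) {q : ℝ} (hq : 0 ≤ q)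
    (h : eLpNorm (fun w => X w - c) 2 μ ≤ ENNReal.ofReal q) : Var[X; μ] ≤ q ^ 2 := by
  have hXc : MemLp (fun w => X w - c) 2 μ := hX.sub (memLp_const c)
  rw [eLpNorm_two_eq_sqrt hXc, ENNReal.ofReal_le_ofReal_iff hq] at h
  rw [← variance_sub_const hX.1 c]
  refine (variance_le_expectation_sq hXc.1).trans ?_
  simpa using (Real.sqrt_le_left hq).1 h

lemma sqrt_variance_eq {X : W → ℝ} (hX : MemLp X 2 μ) :
    ENNReal.ofReal (√(Var[X; μ])) = eLpNorm (fun w => X w - μ[X]) 2 μ := by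
  have h : MemLp (fun w => X w - μ[X]) 2 μ := hX.sub (memLp_const _)
  rw [eLpNorm_two_eq_sqrt h, variance_eq_integral hX.1.aemeasurable]

/-- The triangle inequality in `L²`, after centering both variables at the mean of `X`. -/
lemma sqrt_variance_le {X Y : W → ℝ} (hX : MemLp X 2 μ) (hY : MemLp Y 2 μ) {s : ℝ} (hs : 0 ≤ s)
    (h : eLpNorm (fun w => X w - Y w) 2 μ ≤ ENNReal.ofReal s) :
    √(Var[Y; μ]) ≤ √(Var[X; μ]) + s := by
  rw [Real.sqrt_le_left (by positivity)]
  refine variance_le_sq hY (μ[X]) (by positivity) ?_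
  have e : (fun w => Y w - μ[X]) = (fun w => X w - μ[X]) - (fun w => X w - Y w) := by
    ext w; simp
  rw [e, ENNReal.ofReal_add (by positivity) hs, sqrt_variance_eq hX]
  refine (eLpNorm_sub_le ?_ ?_ (by norm_num)).trans (by gcongr)
  · exact (hX.sub (memLp_const _)).1
  · exact (hX.sub hY).1

end Norms

section Sampling

variable {W E : Type*} [MeasurableSpace W] [MeasurableSpace E] {μ : Measure W}
  [IsProbabilityMeasure μ]

/-- Hoeffding's inequality for sample means of a bounded function. -/
lemma exists_measure_smean_ge_le {ν : Measure E} {V : ℕ → W → E} (hVm : ∀ i, Measurable (V i))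
    (hV : ∀ i, μ.map (V i) = ν) (hVi : iIndepFun V μ) {g : E → ℝ} (hg : Measurable g) {B : ℝ}
    (hB : ∀ z, |g z| ≤ B) {δ : ℝ} (hδ : 0 < δ) :
    ∃ κ > 0, ∀ n : ℕ,
      μ {w | δ ≤ |smean (fun i : Fin n => g (V i w)) - ∫ z, g z ∂ν|} ≤
        ENNReal.ofReal (2 * Real.exp (-κ * n)) := by
  have hind : ∀ s : ℝ, iIndepFun (fun i w => s * (g (V i w) - ∫ z, g z ∂ν)) μ := fun s =>
    hVi.comp (fun _ z => s * (g z - ∫ z, g z ∂ν)) fun _ => by fun_prop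
  set c : ℝ≥0 := (‖B - -B‖₊ / 2) ^ 2
  have hsub : ∀ i, HasSubgaussianMGF (fun w => g (V i w) - ∫ z, g z ∂ν) c μ := by
    intro i
    have := hasSubgaussianMGF_of_mem_Icc (μ := μ) (X := fun w => g (V i w)) (a := -B) (b := B)
      (by fun_prop) (ae_of_all _ fun w => abs_le.1 (hB _))
    have e : μ[fun w => g (V i w)] = ∫ z, g z ∂ν := by
      rw [← hV i, integral_map (hVm i).aemeasurable hg.aestronglyMeasurable]
    simpa only [e] using this
  -- The proxy is enlarged from `c` to `c + 1` to be positive also for `B = 0`; the signs `s = ±1`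
  -- give the two tails.
  have hsub' : ∀ s : ℝ, |s| = 1 → ∀ i,
      HasSubgaussianMGF (fun w => s * (g (V i w) - ∫ z, g z ∂ν)) (c + 1) μ := by
    intro s hs i
    have h1 : HasSubgaussianMGF (fun w => s * (g (V i w) - ∫ z, g z ∂ν)) c μ := by
      rcases (abs_eq zero_le_one).1 hs with rfl | rfl
      · simpa using hsub i
      · have := (hsub i).neg
        simp only [neg_mul, one_mul]
        exact this
    refine ⟨h1.integrable_exp_mul, fun t => (h1.mgf_le t).trans ?_⟩
    gcongr
    simp
  have key : ∀ s : ℝ, |s| = 1 → ∀ n : ℕ,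
      μ.real {w | δ * n ≤ ∑ i ∈ Finset.range n, s * (g (V i w) - ∫ z, g z ∂ν)} ≤
        Real.exp (-(δ ^ 2 / (2 * (c + 1))) * n) := by
    intro s hs n
    refine (HasSubgaussianMGF.measure_sum_range_ge_le_of_iIndepFun (hind s) (n := n)
      (fun i _ => hsub' s hs i) (by positivity)).trans (le_of_eq ?_)
    congr 1
    rcases Nat.eq_zero_or_pos n with rfl | hn
    · simp
    · push_cast
      have : (0 : ℝ) < c + 1 := by positivity
      field_simp
  refine ⟨δ ^ 2 / (2 * (c + 1)), by positivity, fun n => ?_⟩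
  rcases Nat.eq_zero_or_pos n with rfl | hn
  · refine prob_le_one.trans ?_
    simp
  have hn' : (0 : ℝ) < n := by exact_mod_cast hn
  rw [← ofReal_measureReal (measure_ne_top _ _)]
  apply ENNReal.ofReal_le_ofReal
  have hss : {w | δ ≤ |smean (fun i : Fin n => g (V i w)) - ∫ z, g z ∂ν|} ⊆
      {w | δ * n ≤ ∑ i ∈ Finset.range n, 1 * (g (V i w) - ∫ z, g z ∂ν)} ∪
      {w | δ * n ≤ ∑ i ∈ Finset.range n, (-1) * (g (V i w) - ∫ z, g z ∂ν)} := by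
    intro w hw
    have e : ∑ i ∈ Finset.range n, (g (V i w) - ∫ z, g z ∂ν) =
        n * (smean (fun i : Fin n => g (V i w)) - ∫ z, g z ∂ν) := by
      rw [smean, Finset.sum_sub_distrib, Finset.sum_range]
      simp; field_simp
    simp only [Set.mem_union, Set.mem_ofPred_eq, ← Finset.mul_sum, e] at hw ⊢
    rcases le_abs.1 hw with h | h
    · left; nlinarith
    · right; nlinarith
  calc _ ≤ _ := measureReal_mono hss
    _ ≤ _ := measureReal_union_le _ _
    _ ≤ _ := add_le_add (key 1 (by simp) n) (key (-1) (by simp) n)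
    _ = _ := by ring

variable {K : ℕ}

/-- The variance of a linear combination of sample means over independent samples. -/
lemma variance_sum_smean {ν : Fin K → Measure E} [∀ j, IsProbabilityMeasure (ν j)]
    {V : Fin K → ℕ → W → E} (hVm : ∀ j i, Measurable (V j i))
    (hV : ∀ j i, μ.map (V j i) = ν j)
    (hVi : iIndepFun (fun q : Fin K × ℕ => V q.1 q.2) μ) {g : Fin K → E → ℝ}
    (hg : ∀ j, Measurable (g j)) {B : ℝ} (hB : ∀ j z, |g j z| ≤ B) (m : Fin K → ℕ)
    (c : Fin K → ℝ) :
    Var[fun w => ∑ j, c j * smean (fun i : Fin (m j) => g j (V j i w)); μ] =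
      ∑ j, c j ^ 2 * Var[g j; ν j] / m j := by
  have e : (fun w => ∑ j, c j * smean (fun i : Fin (m j) => g j (V j i w))) =
      ∑ q ∈ (Finset.univ : Finset (Σ j, Fin (m j))),
        fun w => (c q.1 / m q.1) * g q.1 (V q.1 q.2 w) := by
    ext w
    rw [Finset.sum_apply, Fintype.sum_sigma]
    refine Finset.sum_congr rfl fun j _ => ?_
    rw [smean, ← Finset.mul_sum (a := c j / m j)]; ring
  have hbd : ∀ j i, MemLp (fun w => g j (V j i w)) 2 μ := fun j i =>
    MemLp.of_bound ((hg j).comp (hVm j i)).aestronglyMeasurable B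
      (ae_of_all _ fun w => by simpa using hB j _)
  rw [e, IndepFun.variance_sum]
  · rw [Fintype.sum_sigma]
    refine Finset.sum_congr rfl fun j _ => ?_
    have : ∀ i, Var[fun w => c j / m j * g j (V j i w); μ] = (c j / m j) ^ 2 * Var[g j; ν j] := by
      intro i
      rw [variance_const_mul, ← hV j i, variance_map (hg j).aemeasurable (hVm j i).aemeasurable]
      rfl
    simp only [this, Finset.sum_const, Finset.card_univ, Fintype.card_fin, nsmul_eq_mul]
    rcases Nat.eq_zero_or_pos (m j) with h | h
    · simp [h]
    · field_simp
  · intro q _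
    exact (hbd q.1 q.2).const_mul _
  · intro q _ q' _ hqq
    have hne : ((q.1, (q.2 : ℕ)) : Fin K × ℕ) ≠ (q'.1, (q'.2 : ℕ)) := by
      intro h
      apply hqq
      rcases q with ⟨j, i⟩
      rcases q' with ⟨j', i'⟩
      simp only [Prod.mk.injEq] at h
      obtain ⟨rfl, h⟩ := h
      simpa using Fin.ext h
    have := hVi.indepFun hne
    exact this.comp (φ := fun z => (c q.1 / m q.1) * g q.1 z)
      (ψ := fun z => (c q'.1 / m q'.1) * g q'.1 z) (by fun_prop) (by fun_prop)

lemma eLpNorm_sum_smean {ν : Fin K → Measure E} [∀ j, IsProbabilityMeasure (ν j)]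
    {V : Fin K → ℕ → W → E} (hVm : ∀ j i, Measurable (V j i))
    (hV : ∀ j i, μ.map (V j i) = ν j)
    (hVi : iIndepFun (fun q : Fin K × ℕ => V q.1 q.2) μ) {g : Fin K → E → ℝ}
    (hg : ∀ j, Measurable (g j)) {B : ℝ} (hB : ∀ j z, |g j z| ≤ B)
    (hg0 : ∀ j, ∫ z, g j z ∂ν j = 0) (m : Fin K → ℕ) (c : Fin K → ℝ) :
    eLpNorm (fun w => ∑ j, c j * smean (fun i : Fin (m j) => g j (V j i w))) 2 μ =
      ENNReal.ofReal (√(∑ j, c j ^ 2 * Var[g j; ν j] / m j)) := by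
  have hbd : ∀ j i, MemLp (fun w => g j (V j i w)) 2 μ := fun j i =>
    MemLp.of_bound ((hg j).comp (hVm j i)).aestronglyMeasurable B
      (ae_of_all _ fun w => by simpa using hB j _)
  have hi : ∀ j (i : Fin (m j)), Integrable (fun w => g j (V j i w)) μ := fun j i =>
    (hbd j i).integrable (by norm_num)
  have hmem : MemLp (fun w => ∑ j, c j * smean (fun i : Fin (m j) => g j (V j i w))) 2 μ := by
    refine memLp_finsetSum _ fun j _ => MemLp.const_mul ?_ _
    simp only [smean, div_eq_mul_inv]
    exact (memLp_finsetSum _ fun (i : Fin (m j)) _ => hbd j i).mul_const _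
  have hmean : μ[fun w => ∑ j, c j * smean (fun i : Fin (m j) => g j (V j i w))] = 0 := by
    have hz : ∀ j i, ∫ w, g j (V j i w) ∂μ = 0 := fun j i => by
      rw [← hg0 j, ← hV j i,
        integral_map (hVm j i).aemeasurable (hg j).aestronglyMeasurable]
    rw [integral_finsetSum _ fun j _ => ?_]
    · refine Finset.sum_eq_zero fun j _ => ?_
      rw [integral_const_mul]
      simp only [smean]
      rw [integral_div, integral_finsetSum _ fun i _ => hi j i]
      simp [hz]
    · refine Integrable.const_mul ?_ _
      simp only [smean]
      exact (integrable_finsetSum _ fun i _ => hi j i).div_const _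
  rw [← variance_sum_smean hVm hV hVi hg hB m c, sqrt_variance_eq hmem, hmean]
  simp

end Sampling

/-! ### The control variate estimate at population level -/

section Population

variable {E : Type*} [MeasurableSpace E]

/-- The optimal control variate coefficient of `a` with respect to `r`. -/
noncomputable def cvCoef (ν : Measure E) (r a : E → ℝ) : ℝ := -(cov[a, r; ν] / Var[r; ν])

/-- The divergence measure of `a` with control variate `r - 1`. -/
noncomputable def cvDiv (ν : Measure E) (r a : E → ℝ) (f : ℝ) : ℝ :=
  (∫ z, (a z + cvCoef ν r a * (r z - 1)) ^ 2 ∂ν) - f ^ 2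

/-- The centered summand of the ideal control variate estimate. -/
noncomputable def cvErr (ν : Measure E) (r a : E → ℝ) (f : ℝ) (z : E) : ℝ :=
  a z - f + cvCoef ν r a * (r z - 1)

/-- The population moments. -/
noncomputable def pmom (ν : Measure E) (r a : E → ℝ) (k : Fin 5) : ℝ :=
  ∫ z, monom k (a z) (r z) ∂ν

lemma measurable_monom (k : Fin 5) : Measurable fun p : ℝ × ℝ => monom k p.1 p.2 := by
  fin_cases k <;> simp only [monom] <;> simp <;> fun_prop

lemma abs_monom_le {a r M : ℝ} (k : Fin 5) (ha : |a| ≤ M) (hr : |r| ≤ M) :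
    |monom k a r| ≤ M + M ^ 2 := by
  have hM : 0 ≤ M := (abs_nonneg _).trans ha
  fin_cases k <;> simp [monom]
  · nlinarith
  · nlinarith [sq_abs r, abs_nonneg r]
  · nlinarith
  · nlinarith [sq_abs a, abs_nonneg a]
  · nlinarith [mul_le_mul ha hr (abs_nonneg _) hM]

/-- The monomials have degree at most two, so the increment is a linear part, with coefficients
bounded through the ideal values, plus a quadratic remainder. No bound on `a'` and `r'` is needed,
which matters because the fitted values have no uniform bound. -/
lemma abs_monom_sub_le {a r a' r' M : ℝ} (k : Fin 5) (ha : |a| ≤ M) (hr : |r| ≤ M) :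
    |monom k a' r' - monom k a r| ≤
      (1 + 2 * M) * (|a' - a| + |r' - r|) + (|a' - a| ^ 2 + |r' - r| ^ 2) := by
  have hM : 0 ≤ M := (abs_nonneg _).trans ha
  have h1 := abs_nonneg (a' - a)
  have h2 := abs_nonneg (r' - r)
  have e1 : ∀ x y : ℝ, |y| ≤ M → |x ^ 2 - y ^ 2| ≤ 2 * M * |x - y| + |x - y| ^ 2 := by
    intro x y hy
    have : x ^ 2 - y ^ 2 = 2 * y * (x - y) + (x - y) ^ 2 := by ring
    rw [this]
    refine (abs_add_le _ _).trans (add_le_add ?_ (by rw [abs_pow]))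
    rw [abs_mul, abs_mul]; simp; gcongr
  have hs1 := sq_nonneg (|a' - a|)
  have hs2 := sq_nonneg (|r' - r|)
  have p1 := mul_nonneg hM h1
  have p2 := mul_nonneg hM h2
  fin_cases k <;> simp [monom]
  · nlinarith
  · have := e1 r' r hr
    simp only [sq_abs] at this
    nlinarith
  · nlinarith
  · have := e1 a' a ha
    simp only [sq_abs] at this
    nlinarith
  · have : a' * r' - a * r = (a' - a) * (r' - r) + (a * (r' - r) + (a' - a) * r) := by ring
    rw [this]
    have t1 : |(a' - a) * (r' - r) + (a * (r' - r) + (a' - a) * r)| ≤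
        |a' - a| * |r' - r| + (|a| * |r' - r| + |a' - a| * |r|) := by
      refine (abs_add_le _ _).trans (add_le_add (abs_mul _ _).le ?_)
      exact (abs_add_le _ _).trans (add_le_add (abs_mul _ _).le (abs_mul _ _).le)
    have t2 : |a| * |r' - r| ≤ M * |r' - r| := by gcongr
    have t3 : |a' - a| * |r| ≤ |a' - a| * M := by gcongr
    have t4 := sq_nonneg (|a' - a| - |r' - r|)
    have t5 : (a' - a) ^ 2 = |a' - a| ^ 2 := (sq_abs _).symm
    have t6 : (r' - r) ^ 2 = |r' - r| ^ 2 := (sq_abs _).symm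
    rw [t5, t6]
    nlinarith

variable {ν : Measure E} [IsProbabilityMeasure ν] {r a : E → ℝ} {f M : ℝ}

lemma memLp_of_abs_le {g : E → ℝ} (hg : Measurable g) {B : ℝ} (hB : ∀ z, |g z| ≤ B)
    (p : ℝ≥0∞) : MemLp g p ν :=
  MemLp.of_bound hg.aestronglyMeasurable B (ae_of_all _ hB)

lemma integrable_of_abs_le {g : E → ℝ} (hg : Measurable g) {B : ℝ} (hB : ∀ z, |g z| ≤ B) :
    Integrable g ν :=
  memLp_one_iff_integrable.1 (memLp_of_abs_le hg hB 1)

lemma integrable_monom (hr : Measurable r) (ha : Measurable a) (hrM : ∀ z, |r z| ≤ M)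
    (haM : ∀ z, |a z| ≤ M) (k : Fin 5) : Integrable (fun z => monom k (a z) (r z)) ν :=
  integrable_of_abs_le ((measurable_monom k).comp (ha.prodMk hr))
    fun z => abs_monom_le k (haM z) (hrM z)

lemma variance_eq_pmom (hr : Measurable r) (hrM : ∀ z, |r z| ≤ M) :
    Var[r; ν] = pmom ν r a 1 - pmom ν r a 0 ^ 2 := by
  rw [variance_eq_sub (memLp_of_abs_le hr hrM 2)]
  simp [pmom, monom]

lemma covariance_eq_pmom (hr : Measurable r) (ha : Measurable a) (hrM : ∀ z, |r z| ≤ M)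
    (haM : ∀ z, |a z| ≤ M) :
    cov[a, r; ν] = pmom ν r a 4 - pmom ν r a 2 * pmom ν r a 0 := by
  rw [covariance_eq_sub (memLp_of_abs_le ha haM 2) (memLp_of_abs_le hr hrM 2)]
  simp [pmom, monom]

lemma coefOf_pmom (hr : Measurable r) (ha : Measurable a) (hrM : ∀ z, |r z| ≤ M)
    (haM : ∀ z, |a z| ≤ M) : coefOf (pmom ν r a) = cvCoef ν r a := by
  rw [coefOf, cvCoef, ← covariance_eq_pmom hr ha hrM haM, ← variance_eq_pmom hr hrM]

lemma divOf_pmom (hr : Measurable r) (ha : Measurable a) (hrM : ∀ z, |r z| ≤ M)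
    (haM : ∀ z, |a z| ≤ M) (hr1 : ∫ z, r z ∂ν = 1) (haf : ∫ z, a z ∂ν = f) :
    divOf (pmom ν r a) = cvDiv ν r a f := by
  have i0 := integrable_monom (ν := ν) hr ha hrM haM
  have j0 := i0 0
  have j1 := i0 1
  have j2 := i0 2
  have j3 := i0 3
  have j4 := i0 4
  simp only [monom, Matrix.cons_val] at j0 j1 j2 j3 j4
  obtain ⟨c, hc⟩ : ∃ c, c = cvCoef ν r a := ⟨_, rfl⟩
  have e : ∀ z, (a z + c * (r z - 1)) ^ 2 = ((a z ^ 2 + 2 * c * (a z * r z)) + c ^ 2 * r z ^ 2) +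
      ((-2 * c) * a z + ((-2 * c ^ 2) * r z + c ^ 2)) := fun z => by ring
  rw [divOf, coefOf_pmom hr ha hrM haM, cvDiv, ← hc]
  simp_rw [e]
  rw [integral_add, integral_add, integral_add, integral_add, integral_add, integral_const_mul,
    integral_const_mul, integral_const_mul, integral_const_mul]
  · simp [pmom, monom, hr1, haf]
    ring
  all_goals fun_prop

/-- The control variate `r - 1` has mean zero, so the summand keeps the mean `f` and the subtracted
`f ^ 2` is the square of its mean. -/
lemma cvDiv_eq_variance (hr : Measurable r) (ha : Measurable a) (hrM : ∀ z, |r z| ≤ M)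
    (haM : ∀ z, |a z| ≤ M) (hr1 : ∫ z, r z ∂ν = 1) (haf : ∫ z, a z ∂ν = f) :
    Var[cvErr ν r a f; ν] = cvDiv ν r a f := by
  have hX : MemLp (fun z => a z + cvCoef ν r a * (r z - 1)) 2 ν :=
    (memLp_of_abs_le ha haM 2).add
      (((memLp_of_abs_le hr hrM 2).sub (memLp_const 1)).const_mul _)
  have e : cvErr ν r a f = fun z => (a z + cvCoef ν r a * (r z - 1)) - f := by
    ext z; rw [cvErr]; ring
  have hir := integrable_of_abs_le (ν := ν) hr hrM
  have hia := integrable_of_abs_le (ν := ν) ha haM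
  rw [e, variance_sub_const hX.1, variance_eq_sub hX, cvDiv]
  congr 2
  rw [integral_add hia (by fun_prop), integral_const_mul, integral_sub hir (by fun_prop)]
  simp [hr1, haf]

lemma integral_cvErr (hr : Measurable r) (ha : Measurable a) (hrM : ∀ z, |r z| ≤ M)
    (haM : ∀ z, |a z| ≤ M) (hr1 : ∫ z, r z ∂ν = 1) (haf : ∫ z, a z ∂ν = f) :
    ∫ z, cvErr ν r a f z ∂ν = 0 := by
  have hir := integrable_of_abs_le (ν := ν) hr hrM
  have hia := integrable_of_abs_le (ν := ν) ha haM
  unfold cvErr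
  rw [integral_add (by fun_prop) (by fun_prop), integral_const_mul, integral_sub hir (by fun_prop),
    integral_sub hia (by fun_prop)]
  simp [hr1, haf]

/-- At the optimal coefficient the quadratic `Var a + 2 c Cov + c² Var r` takes the value `Var a -
Cov² / Var r`. -/
lemma cvDiv_le_variance (hr : Measurable r) (ha : Measurable a) (hrM : ∀ z, |r z| ≤ M)
    (haM : ∀ z, |a z| ≤ M) (hr1 : ∫ z, r z ∂ν = 1) (haf : ∫ z, a z ∂ν = f)
    (hv : Var[r; ν] ≠ 0) : cvDiv ν r a f ≤ Var[a; ν] := by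
  have hva : Var[a; ν] = pmom ν r a 3 - pmom ν r a 2 ^ 2 := by
    rw [variance_eq_sub (memLp_of_abs_le ha haM 2)]
    simp [pmom, monom]
  have hvp : 0 < Var[r; ν] := lt_of_le_of_ne (variance_nonneg _ _) hv.symm
  rw [← divOf_pmom hr ha hrM haM hr1 haf, divOf, coefOf_pmom hr ha hrM haM, ← hva,
    ← covariance_eq_pmom hr ha hrM haM, ← variance_eq_pmom hr hrM, cvCoef]
  have : Var[a; ν] + 2 * -(cov[a, r; ν] / Var[r; ν]) * cov[a, r; ν] +
      (-(cov[a, r; ν] / Var[r; ν])) ^ 2 * Var[r; ν] =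
      Var[a; ν] - cov[a, r; ν] ^ 2 / Var[r; ν] := by
    field_simp; ring
  rw [this]
  have : 0 ≤ cov[a, r; ν] ^ 2 / Var[r; ν] := by positivity
  linarith

end Population

/-! ### Error bounds for the federated estimates -/

section Model

variable {W E : Type*} [MeasurableSpace W] [MeasurableSpace E] {K : ℕ}

/-- The validation samples `V j i` of law `ν j`, with bounded importance weights `r j` of mean one
and bounded weighted losses `a j` of common mean `f`. -/
structure ValModel (μ : Measure W) (ν : Fin K → Measure E) (V : Fin K → ℕ → W → E)
    (r a : Fin K → E → ℝ) (f M : ℝ) : Prop where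
  measV : ∀ j i, Measurable (V j i)
  mapV : ∀ j i, μ.map (V j i) = ν j
  indepV : iIndepFun (fun q : Fin K × ℕ => V q.1 q.2) μ
  prob : ∀ j, IsProbabilityMeasure (ν j)
  meas_r : ∀ j, Measurable (r j)
  meas_a : ∀ j, Measurable (a j)
  bdd_r : ∀ j z, |r j z| ≤ M
  bdd_a : ∀ j z, |a j z| ≤ M
  int_r : ∀ j, ∫ z, r j z ∂(ν j) = 1
  int_a : ∀ j, ∫ z, a j z ∂(ν j) = f
  var_ne : ∀ j, Var[r j; ν j] ≠ 0
  div_ne : ∀ j, cvDiv (ν j) (r j) (a j) f ≠ 0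

variable {μ : Measure W} {ν : Fin K → Measure E}
  {V : Fin K → ℕ → W → E} {r a : Fin K → E → ℝ} {f M : ℝ}

lemma ValModel.cvDiv_pos (hV : ValModel μ ν V r a f M) (j : Fin K) :
    0 < cvDiv (ν j) (r j) (a j) f := by
  have := hV.prob j
  refine lt_of_le_of_ne ?_ (hV.div_ne j).symm
  rw [← cvDiv_eq_variance (hV.meas_r j) (hV.meas_a j) (hV.bdd_r j) (hV.bdd_a j) (hV.int_r j)
    (hV.int_a j)]
  exact variance_nonneg _ _

lemma ValModel.measurable_cvErr (hV : ValModel μ ν V r a f M) (j : Fin K) :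
    Measurable (cvErr (ν j) (r j) (a j) f) := by
  have := hV.meas_r j
  have := hV.meas_a j
  unfold cvErr; fun_prop

lemma ValModel.exists_cvErr_le (hV : ValModel μ ν V r a f M) :
    ∃ B, ∀ j z, |cvErr (ν j) (r j) (a j) f z| ≤ B := by
  refine ⟨∑ j, (M + |f| + |cvCoef (ν j) (r j) (a j)| * (M + 1)), fun j z => ?_⟩
  have hM : 0 ≤ M := (abs_nonneg _).trans (hV.bdd_r j z)
  refine le_trans ?_ (Finset.single_le_sum
    (f := fun j => (M + |f| + |cvCoef (ν j) (r j) (a j)| * (M + 1))) (fun j _ => by positivity)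
    (Finset.mem_univ j))
  have h1 : |r j z - 1| ≤ M + 1 := (abs_sub _ _).trans (by simpa using hV.bdd_r j z)
  have h2 : |a j z - f| ≤ M + |f| := (abs_sub _ _).trans (by simpa using hV.bdd_a j z)
  refine (abs_add_le _ _).trans (add_le_add h2 ?_)
  rw [abs_mul]
  gcongr

lemma wt_sq_mul_div {m D : Fin K → ℝ} (hm : ∀ j, 0 < m j) (hD : ∀ j, 0 < D j) (j : Fin K) :
    wt m D j ^ 2 * D j / m j = (m j / D j) / (∑ k, m k / D k) ^ 2 := by
  have := (hm j).ne'
  have := (hD j).ne'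
  rw [wt_eq]
  field_simp

/-- This is the variance of the inverse variance weighted mean: source `j` contributes variance `D j
/ m j`, and after weighting each summand is `m j / D j` over the square of the common sum. -/
lemma sum_wt_sq_mul_div [Nonempty (Fin K)] {m D : Fin K → ℝ} (hm : ∀ j, 0 < m j)
    (hD : ∀ j, 0 < D j) :
    ∑ j, wt m D j ^ 2 * D j / m j = (∑ k, m k / D k)⁻¹ := by
  simp_rw [wt_sq_mul_div hm hD, ← Finset.sum_div]
  have := (sum_div_pos hm hD).ne'
  field_simp

lemma wt_sq_mul_div_le [Nonempty (Fin K)] {m D : Fin K → ℝ} (hm : ∀ j, 0 < m j)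
    (hD : ∀ j, 0 < D j) (j : Fin K) :
    wt m D j ^ 2 * D j / m j ≤ (∑ k, m k / D k)⁻¹ := by
  rw [← sum_wt_sq_mul_div hm hD]
  exact Finset.single_le_sum (f := fun j => wt m D j ^ 2 * D j / m j)
    (fun k _ => div_nonneg (mul_nonneg (sq_nonneg _) (hD k).le) (hm k).le) (Finset.mem_univ j)

lemma eLpNorm_const_mul (c : ℝ) (X : W → ℝ) (p : ℝ≥0∞) :
    eLpNorm (fun w => c * X w) p μ = ENNReal.ofReal |c| * eLpNorm X p μ := by
  have h := eLpNorm_const_smul c X p μ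
  rw [Real.enorm_eq_ofReal_abs] at h
  exact h

variable [IsProbabilityMeasure μ]

lemma ValModel.eLpNorm_wt_mul_smean (hV : ValModel μ ν V r a f M) {g : Fin K → E → ℝ}
    (hg : ∀ j, Measurable (g j)) {B : ℝ} (hB : ∀ j z, |g j z| ≤ B)
    (hg0 : ∀ j, ∫ z, g j z ∂ν j = 0) (m : Fin K → ℕ) (c : ℝ) (j : Fin K) :
    eLpNorm (fun w => c * smean (fun i : Fin (m j) => g j (V j i w))) 2 μ =
      ENNReal.ofReal (√(c ^ 2 * Var[g j; ν j] / m j)) := by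
  have := hV.prob
  have h := eLpNorm_sum_smean hV.measV hV.mapV hV.indepV hg hB hg0 m (Pi.single j c)
  have e1 : ∀ w, ∑ k, (Pi.single j c : Fin K → ℝ) k *
      smean (fun i : Fin (m k) => g k (V k i w)) =
      c * smean (fun i : Fin (m j) => g j (V j i w)) := fun w => by
    rw [Finset.sum_eq_single j]
    · simp
    · intro k _ hk; simp [hk]
    · simp
  have e2 : ∑ k, (Pi.single j c : Fin K → ℝ) k ^ 2 * Var[g k; ν k] / m k =
      c ^ 2 * Var[g j; ν j] / m j := by
    rw [Finset.sum_eq_single j]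
    · simp
    · intro k _ hk; simp [hk]
    · simp
  simp_rw [e1, e2] at h
  exact h

end Model

/-! ### The error of FedDAE on and off a good event -/

section MainEstimate

variable {W E : Type*} [MeasurableSpace W] [MeasurableSpace E] {K : ℕ} {μ : Measure W}

lemma eLpNorm_fun_add_le {X Y : W → ℝ} (hX : Measurable X) (hY : Measurable Y) {p x y : ℝ≥0∞}
    (hp : 1 ≤ p) (hx : eLpNorm X p μ ≤ x) (hy : eLpNorm Y p μ ≤ y) :
    eLpNorm (fun w => X w + Y w) p μ ≤ x + y :=
  (eLpNorm_add_le hX.aestronglyMeasurable hY.aestronglyMeasurable hp).trans (add_le_add hx hy)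

lemma eLpNorm_fun_sum_le {ι : Type*} {s : Finset ι} {X : ι → W → ℝ} (hX : ∀ i, Measurable (X i))
    {p : ℝ≥0∞} {x : ι → ℝ≥0∞} (hp : 1 ≤ p) (hx : ∀ i, eLpNorm (X i) p μ ≤ x i) :
    eLpNorm (fun w => ∑ i ∈ s, X i w) p μ ≤ ∑ i ∈ s, x i := by
  have e : (fun w => ∑ i ∈ s, X i w) = ∑ i ∈ s, X i := by ext w; simp
  rw [e]
  exact (eLpNorm_sum_le (fun i _ => (hX i).aestronglyMeasurable) hp).trans
    (Finset.sum_le_sum fun i _ => hx i)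

lemma eLpNorm_fun_const_mul_le {X : W → ℝ} {p x : ℝ≥0∞} {c : ℝ} (hc : 0 ≤ c)
    (hx : eLpNorm X p μ ≤ x) : eLpNorm (fun w => c * X w) p μ ≤ ENNReal.ofReal c * x := by
  rw [eLpNorm_const_mul, abs_of_nonneg hc]; gcongr

lemma eLpNorm_fun_abs (X : W → ℝ) (p : ℝ≥0∞) : eLpNorm (fun w => |X w|) p μ = eLpNorm X p μ :=
  eLpNorm_norm X

lemma measurable_scov {n : ℕ} {X Y : Fin n → W → ℝ} (hX : ∀ i, Measurable (X i))
    (hY : ∀ i, Measurable (Y i)) : Measurable fun w => scov (fun i => X i w) fun i => Y i w := by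
  have h1 := measurable_smean hX
  have h2 := measurable_smean hY
  unfold scov
  exact measurable_smean fun i => by fun_prop

lemma measurable_etaHat {n : ℕ} {X Y : Fin n → W → ℝ} (hX : ∀ i, Measurable (X i))
    (hY : ∀ i, Measurable (Y i)) : Measurable fun w => etaHat (fun i => X i w) fun i => Y i w := by
  unfold etaHat
  exact ((measurable_scov hX hY).div (measurable_scov hY hY)).neg

lemma measurable_cvTerm {n : ℕ} {X Y : Fin n → W → ℝ} (hX : ∀ i, Measurable (X i))
    (hY : ∀ i, Measurable (Y i)) (i : Fin n) :
    Measurable fun w => cvTerm (fun i => X i w) (fun i => Y i w) i := by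
  have := measurable_etaHat hX hY
  unfold cvTerm
  fun_prop

lemma measurable_divHat {n : ℕ} {X Y : Fin n → W → ℝ} (hX : ∀ i, Measurable (X i))
    (hY : ∀ i, Measurable (Y i)) : Measurable fun w => divHat (fun i => X i w) fun i => Y i w := by
  have h := measurable_cvTerm hX hY
  unfold divHat
  exact (measurable_smean fun i => (h i).pow_const 2).sub ((measurable_smean h).pow_const 2)

lemma measurable_fedDA {m : Fin K → ℕ} {X Y : (j : Fin K) → Fin (m j) → W → ℝ}
    (hX : ∀ j i, Measurable (X j i)) (hY : ∀ j i, Measurable (Y j i)) :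
    Measurable fun w => fedDA m (fun j i => X j i w) fun j i => Y j i w := by
  have h1 := fun j => measurable_divHat (hX j) (hY j)
  have h2 := fun j => measurable_smean (measurable_cvTerm (hX j) (hY j))
  unfold fedDA lamHat fCV
  refine Finset.measurable_sum _ fun j _ => ?_
  refine Measurable.mul (Measurable.mul (Measurable.inv (Measurable.mul (h1 j) ?_)) ?_) (h2 j)
  · exact Finset.measurable_sum _ fun k _ => (h1 k).const_div _
  · fun_prop

variable [IsProbabilityMeasure μ] {ν : Fin K → Measure E}
  {V : Fin K → ℕ → W → E} {r a : Fin K → E → ℝ} {f M : ℝ}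

/-- The deterministic bounds `abs_fedDA_sub_le_of_close` on `G` and `abs_fedDA_sub_le` off `G` are
dominated by one sum, in which the indicator of `Gᶜ` carries the crude constants. Minkowski's
inequality then gives the `L²` norm. The products of `η̂` with the fitting error and with the
indicator are split by Hölder into fourth means, which is where the exponent `1 / 4` arises. Only
the ideal combination enters with coefficient one; every other multiple of its standard deviation
has a factor `δ`. -/
lemma ValModel.eLpNorm_fedDA_sub_le [Nonempty (Fin K)] (hV : ValModel μ ν V r a f M) {B C δ : ℝ≥0}
    (hC1 : 1 ≤ C) (hCM : M ≤ C) (hCf : |f| ≤ C) (hCB : B ≤ C)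
    (hCc : ∀ j, |cvCoef (ν j) (r j) (a j)| ≤ C)
    (hCv : ∀ j, Var[r j; ν j] ≤ C ^ 2 * cvDiv (ν j) (r j) (a j) f)
    (hδ : δ ≤ 1 / 4) {m : Fin K → ℕ} (hm : ∀ j, 0 < m j) {A R : Fin K → ℕ → W → ℝ}
    (hA : ∀ j i, Measurable (A j i)) (hR : ∀ j i, Measurable (R j i)) {e : ℝ≥0∞}
    (heA : ∀ j i, eLpNorm (fun w => A j i w - a j (V j i w)) 4 μ ≤ e)
    (heR : ∀ j i, eLpNorm (fun w => R j i w - r j (V j i w)) 4 μ ≤ e)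
    (hη : ∀ j, eLpNorm (fun w => etaHat (fun i : Fin (m j) => A j i w) fun i => R j i w) 4 μ ≤ B)
    {G : Set W} (hG : MeasurableSet G)
    (hGd : ∀ w ∈ G, ∀ j, |divHat (fun i : Fin (m j) => A j i w) (fun i => R j i w) -
      cvDiv (ν j) (r j) (a j) f| ≤ δ * cvDiv (ν j) (r j) (a j) f)
    (hGc : ∀ w ∈ G, ∀ j, |etaHat (fun i : Fin (m j) => A j i w) (fun i => R j i w) -
      cvCoef (ν j) (r j) (a j)| ≤ δ) :
    eLpNorm (fun w => fedDA m (fun j i => A j i w) (fun j i => R j i w) - f) 2 μ ≤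
      (1 + 15 * K * C ^ 2 * δ) *
        ENNReal.ofReal (√((∑ k, m k / cvDiv (ν k) (r k) (a k) f)⁻¹)) +
      15 * K * C ^ 2 * (e + μ Gᶜ ^ (1 / 4 : ℝ)) := by
  have hprob := hV.prob
  have hD := hV.cvDiv_pos
  set D : Fin K → ℝ := fun j => cvDiv (ν j) (r j) (a j) f with hDdef
  set c : Fin K → ℝ := fun j => cvCoef (ν j) (r j) (a j) with hcdef
  have hm' : ∀ j, (0 : ℝ) < (fun k => (m k : ℝ)) j := fun j => by simpa using hm j
  set wj : Fin K → ℝ := wt (fun k => (m k : ℝ)) D with hw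
  have hw0 : ∀ j, 0 ≤ wj j := wt_nonneg (fun k => (hm' k).le) fun k => (hD k).le
  have hw1 : ∀ j, wj j ≤ 1 := wt_le_one (fun k => (hm' k).le) fun k => (hD k).le
  set S := ∑ k, m k / D k with hS
  set q : ℝ≥0∞ := ENNReal.ofReal (√(S⁻¹)) with hq
  -- the random variables of the decomposition
  set X0 : W → ℝ := fun w => ∑ j, wj j *
    smean (fun i : Fin (m j) => cvErr (ν j) (r j) (a j) f (V j i w)) with hX0
  set X1 : Fin K → W → ℝ := fun j w => wj j *
    smean (fun i : Fin (m j) => cvErr (ν j) (r j) (a j) f (V j i w)) with hX1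
  set X2 : Fin K → W → ℝ := fun j w => wj j *
    smean (fun i : Fin (m j) => r j (V j i w) - 1) with hX2
  set eA : Fin K → W → ℝ := fun j w =>
    smean (fun i : Fin (m j) => A j i w - a j (V j i w)) with heA'
  set eR : Fin K → W → ℝ := fun j w =>
    smean (fun i : Fin (m j) => R j i w - r j (V j i w)) with heR'
  set η : Fin K → W → ℝ := fun j w =>
    etaHat (fun i : Fin (m j) => A j i w) (fun i => R j i w) with hη'
  set I : W → ℝ := Gᶜ.indicator fun _ => (1 : ℝ) with hI
  have mr := hV.meas_r
  have ma := hV.meas_a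
  have mV := hV.measV
  have mE := hV.measurable_cvErr
  have mEV : ∀ j (i : Fin (m j)), Measurable fun w => cvErr (ν j) (r j) (a j) f (V j i w) :=
    fun j i => (mE j).comp (mV j i)
  have mrV : ∀ j (i : Fin (m j)), Measurable fun w => r j (V j i w) :=
    fun j i => (mr j).comp (mV j i)
  have maV : ∀ j (i : Fin (m j)), Measurable fun w => a j (V j i w) :=
    fun j i => (ma j).comp (mV j i)
  have mX1 : ∀ j, Measurable (X1 j) := fun j => (measurable_smean (mEV j)).const_mul _
  have mX2 : ∀ j, Measurable (X2 j) := fun j =>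
    (measurable_smean fun i => (mrV j i).sub_const 1).const_mul _
  have mX0 : Measurable X0 := Finset.measurable_sum _ fun j _ => mX1 j
  have meA : ∀ j, Measurable (eA j) := fun j => measurable_smean fun i => (hA j i).sub (maV j i)
  have meR : ∀ j, Measurable (eR j) := fun j => measurable_smean fun i => (hR j i).sub (mrV j i)
  have mη : ∀ j, Measurable (η j) := fun j => measurable_etaHat (fun i => hA j i) fun i => hR j i
  have mI : Measurable I := measurable_const.indicator hG.compl
  have hI0 : ∀ w, 0 ≤ I w := fun w => Set.indicator_nonneg (fun _ _ => zero_le_one) w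
  -- the norms of these random variables
  obtain ⟨Bc, hBc⟩ := hV.exists_cvErr_le
  have hE0 : ∀ j, ∫ z, cvErr (ν j) (r j) (a j) f z ∂ν j = 0 := fun j =>
    integral_cvErr (mr j) (ma j) (hV.bdd_r j) (hV.bdd_a j) (hV.int_r j) (hV.int_a j)
  have hEv : ∀ j, Var[cvErr (ν j) (r j) (a j) f; ν j] = D j := fun j =>
    cvDiv_eq_variance (mr j) (ma j) (hV.bdd_r j) (hV.bdd_a j) (hV.int_r j) (hV.int_a j)
  have nX0 : eLpNorm X0 2 μ ≤ q := by
    rw [hX0, eLpNorm_sum_smean mV hV.mapV hV.indepV mE hBc hE0]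
    simp_rw [hEv]
    rw [hq, hw, sum_wt_sq_mul_div hm' hD]
  have nX1 : ∀ j, eLpNorm (X1 j) 2 μ ≤ q := fun j => by
    rw [hX1, hV.eLpNorm_wt_mul_smean mE hBc hE0, hEv]
    exact ENNReal.ofReal_le_ofReal (Real.sqrt_le_sqrt (wt_sq_mul_div_le hm' hD j))
  have hr0 : ∀ j, ∫ z, (r j z - 1) ∂ν j = 0 := fun j => by
    rw [integral_sub (integrable_of_abs_le (mr j) (hV.bdd_r j)) (integrable_const _), hV.int_r j]
    simp
  -- By `hCv` the variance of `r j` is at most `C ^ 2` times the divergence, so this mean is again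
  -- of the order of the optimal standard deviation.
  have nX2 : ∀ j, eLpNorm (X2 j) 2 μ ≤ C * q := fun j => by
    have h1 : ∀ j z, |r j z - 1| ≤ M + 1 := fun j z =>
      (abs_sub _ _).trans (by simpa using hV.bdd_r j z)
    rw [hX2, hV.eLpNorm_wt_mul_smean (g := fun j z => r j z - 1) (fun j => (mr j).sub_const 1)
      h1 hr0, variance_sub_const (mr j).aestronglyMeasurable, hq, ← ENNReal.ofReal_coe_nnreal,
      ← ENNReal.ofReal_mul (show (0 : ℝ) ≤ C from C.2)]
    apply ENNReal.ofReal_le_ofReal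
    have h2 : (C : ℝ) * √(S⁻¹) = √(C ^ 2 * S⁻¹) := by
      rw [Real.sqrt_mul (by positivity), Real.sqrt_sq (show (0 : ℝ) ≤ C from C.2)]
    change _ ≤ (C : ℝ) * √(S⁻¹)
    rw [h2]
    apply Real.sqrt_le_sqrt
    calc wj j ^ 2 * Var[r j; ν j] / m j ≤ wj j ^ 2 * (C ^ 2 * D j) / m j := by
          gcongr; exact hCv j
      _ = C ^ 2 * (wj j ^ 2 * D j / m j) := by ring
      _ ≤ _ := by
        gcongr
        exact wt_sq_mul_div_le hm' hD j
  have h24 : ∀ {X : W → ℝ} {x : ℝ≥0∞}, Measurable X → eLpNorm X 4 μ ≤ x → eLpNorm X 2 μ ≤ x :=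
    fun hX h => (eLpNorm_le_eLpNorm_of_exponent_le (by norm_num) hX.aestronglyMeasurable).trans h
  have n4A : ∀ j, eLpNorm (eA j) 4 μ ≤ e := fun j =>
    eLpNorm_smean_le (fun i => (hA j i).sub (maV j i)) (by norm_num) fun i => heA j i
  have n4R : ∀ j, eLpNorm (eR j) 4 μ ≤ e := fun j =>
    eLpNorm_smean_le (fun i => (hR j i).sub (mrV j i)) (by norm_num) fun i => heR j i
  set P : ℝ≥0∞ := μ Gᶜ ^ (1 / 4 : ℝ) with hP
  have nI4 : eLpNorm I 4 μ ≤ P := by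
    rw [hI, eLpNorm_indicator_one hG.compl (by simp) (by simp)]
    simp [hP]
  have nηR : ∀ j, eLpNorm (fun w => |η j w| * |eR j w|) 2 μ ≤ C * e := fun j => by
    refine (eLpNorm_two_mul_le (by fun_prop) (by fun_prop)).trans ?_
    rw [eLpNorm_fun_abs, eLpNorm_fun_abs]
    exact mul_le_mul' ((hη j).trans (by exact_mod_cast hCB)) (n4R j)
  have nηI : ∀ j, eLpNorm (fun w => |η j w| * I w) 2 μ ≤ C * P := fun j => by
    refine (eLpNorm_two_mul_le (by fun_prop) (by fun_prop)).trans ?_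
    rw [eLpNorm_fun_abs]
    exact mul_le_mul' ((hη j).trans (by exact_mod_cast hCB)) nI4
  -- the pointwise bound
  have hpt : ∀ w, ‖fedDA m (fun j i => A j i w) (fun j i => R j i w) - f‖ ≤
      |X0 w| + ((∑ j, (4 * δ * |X1 j w| + (2 * δ * |X2 j w| + (3 * C * (|eA j w| + |eR j w|) +
        (|η j w| * |eR j w| + 2 * C * (|η j w| * I w)))))) + (2 * C * K + C) * I w) := by
    intro w
    have dA : ∀ j, smean (fun i : Fin (m j) => A j i w) =
        eA j w + smean (fun i : Fin (m j) => a j (V j i w)) := fun j => by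
      rw [heA']; simp only; rw [smean_sub]; ring
    have dR : ∀ j, smean (fun i : Fin (m j) => R j i w) =
        eR j w + smean (fun i : Fin (m j) => r j (V j i w)) := fun j => by
      rw [heR']; simp only; rw [smean_sub]; ring
    have dE : ∀ j, smean (fun i : Fin (m j) => cvErr (ν j) (r j) (a j) f (V j i w)) =
        smean (fun i : Fin (m j) => a j (V j i w)) - f +
          c j * (smean (fun i : Fin (m j) => r j (V j i w)) - 1) := fun j => by
      unfold cvErr
      rw [smean_add, smean_const_mul, smean_sub, smean_sub, smean_const (hm j),
        smean_const (hm j)]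
    have dr1 : ∀ j, smean (fun i : Fin (m j) => r j (V j i w) - 1) =
        smean (fun i : Fin (m j) => r j (V j i w)) - 1 := fun j => by
      rw [smean_sub, smean_const (hm j)]
    have hC1' : (1 : ℝ) ≤ C := by exact_mod_cast hC1
    have hδ' : (δ : ℝ) ≤ 1 / 4 := by exact_mod_cast hδ
    have hδ0 : (0 : ℝ) ≤ δ := δ.2
    rw [Real.norm_eq_abs]
    by_cases hwG : w ∈ G
    · have h := abs_fedDA_sub_le_of_close m hm (fun j (i : Fin (m j)) => A j i w)
        (fun j (i : Fin (m j)) => R j i w) f hδ0 hδ' hD (hGd w hwG) (hGc w hwG)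
      refine h.trans ?_
      -- The actual deviation is the ideal centered mean plus the fitting errors.
      have dU : ∀ j, smean (fun i : Fin (m j) => A j i w) - f +
          c j * (smean (fun i : Fin (m j) => R j i w) - 1) =
          smean (fun i : Fin (m j) => cvErr (ν j) (r j) (a j) f (V j i w)) +
            (eA j w + c j * eR j w) := fun j => by
        rw [dA, dR, dE]; ring
      have hU : ∀ j, |eA j w + c j * eR j w| ≤ |eA j w| + C * |eR j w| := fun j => by
        refine (abs_add_le _ _).trans (add_le_add le_rfl ?_)
        rw [abs_mul]; gcongr; exact hCc j
      have hIw : 0 ≤ (2 * C * K + C) * I w := mul_nonneg (by positivity) (hI0 w)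
      have t1 : |∑ j, wj j * (smean (fun i : Fin (m j) => A j i w) - f +
          c j * (smean (fun i : Fin (m j) => R j i w) - 1))| ≤
          |X0 w| + ∑ j, (|eA j w| + C * |eR j w|) := by
        simp_rw [dU, mul_add (wj _), Finset.sum_add_distrib]
        refine (abs_add_le _ _).trans (add_le_add le_rfl ?_)
        simp_rw [← Finset.sum_add_distrib, ← mul_add]
        refine (Finset.abs_sum_le_sum_abs _ _).trans (Finset.sum_le_sum fun j _ => ?_)
        rw [abs_mul, abs_of_nonneg (hw0 j)]
        exact (mul_le_of_le_one_left (abs_nonneg _) (hw1 j)).trans (hU j)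
      have t2 : ∀ j, wj j * |smean (fun i : Fin (m j) => A j i w) - f +
          c j * (smean (fun i : Fin (m j) => R j i w) - 1)| ≤
          |X1 j w| + (|eA j w| + C * |eR j w|) := fun j => by
        rw [dU, hX1]
        simp only
        rw [abs_mul (wj j), abs_of_nonneg (hw0 j)]
        refine (mul_le_mul_of_nonneg_left (abs_add_le _ _) (hw0 j)).trans ?_
        rw [mul_add]
        exact add_le_add le_rfl ((mul_le_of_le_one_left (abs_nonneg _) (hw1 j)).trans (hU j))
      have t3 : ∀ j, wj j * |smean (fun i : Fin (m j) => R j i w) - 1| ≤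
          |X2 j w| + |eR j w| := fun j => by
        rw [hX2]
        simp only
        rw [abs_mul (wj j), abs_of_nonneg (hw0 j), dr1, dR, add_sub_assoc, add_comm (eR j w)]
        refine (mul_le_mul_of_nonneg_left (abs_add_le _ _) (hw0 j)).trans ?_
        rw [mul_add]
        exact add_le_add le_rfl (mul_le_of_le_one_left (abs_nonneg _) (hw1 j))
      calc _ ≤ (|X0 w| + ∑ j, (|eA j w| + C * |eR j w|)) +
            4 * δ * (∑ j, (|X1 j w| + (|eA j w| + C * |eR j w|))) +
            2 * δ * ∑ j, (|X2 j w| + |eR j w|) := by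
            refine add_le_add (add_le_add t1 ?_) ?_
            · exact mul_le_mul_of_nonneg_left (Finset.sum_le_sum fun j _ => t2 j) (by positivity)
            · exact mul_le_mul_of_nonneg_left (Finset.sum_le_sum fun j _ => t3 j) (by positivity)
        _ = |X0 w| + ∑ j, ((|eA j w| + C * |eR j w|) +
            4 * δ * (|X1 j w| + (|eA j w| + C * |eR j w|)) +
            2 * δ * (|X2 j w| + |eR j w|)) := by
            simp only [Finset.sum_add_distrib, ← Finset.mul_sum]; ring
        _ ≤ |X0 w| + ∑ j, (4 * δ * |X1 j w| + (2 * δ * |X2 j w| +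
            (3 * C * (|eA j w| + |eR j w|) + (|η j w| * |eR j w| + 2 * C * (|η j w| * I w))))) := by
            refine add_le_add le_rfl (Finset.sum_le_sum fun j _ => ?_)
            have p1 : 0 ≤ |η j w| * |eR j w| := by positivity
            have p2 : 0 ≤ 2 * (C : ℝ) * (|η j w| * I w) :=
              mul_nonneg (by positivity) (mul_nonneg (abs_nonneg _) (hI0 w))
            have p3 := abs_nonneg (eA j w)
            have p4 := abs_nonneg (eR j w)
            have p5 : 4 * (δ : ℝ) * (|eA j w| + C * |eR j w|) ≤ |eA j w| + C * |eR j w| :=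
              mul_le_of_le_one_left (by positivity) (by linarith)
            have p6 : 2 * (δ : ℝ) * |eR j w| ≤ |eR j w| :=
              mul_le_of_le_one_left (by positivity) (by linarith)
            have p7 : |eA j w| ≤ C * |eA j w| := le_mul_of_one_le_left p3 hC1'
            have p8 : |eR j w| ≤ C * |eR j w| := le_mul_of_one_le_left p4 hC1'
            nlinarith
        _ ≤ _ := by linarith
    -- Off `G` the means of the ideal values are only known to be bounded by `C`; these constants
    -- are charged to the indicator, which is one here.
    · have hI1 : I w = 1 := by simp [hI, hwG]
      have h := abs_fedDA_sub_le m hm (fun j (i : Fin (m j)) => A j i w)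
        (fun j (i : Fin (m j)) => R j i w) f
      refine h.trans ?_
      rw [hI1]
      have b1 : ∀ j, |smean (fun i : Fin (m j) => a j (V j i w))| ≤ C := fun j => by
        refine (abs_smean_le _).trans ((smean_mono fun i => (hV.bdd_a j _).trans hCM).trans ?_)
        rw [smean_const (hm j)]
      have b2 : ∀ j, |smean (fun i : Fin (m j) => r j (V j i w))| ≤ C := fun j => by
        refine (abs_smean_le _).trans ((smean_mono fun i => (hV.bdd_r j _).trans hCM).trans ?_)
        rw [smean_const (hm j)]
      have s1 : ∀ j, |smean (fun i : Fin (m j) => A j i w) - f| +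
          |etaHat (fun i : Fin (m j) => A j i w) fun i => R j i w| *
            |smean (fun i : Fin (m j) => R j i w) - 1| ≤
          (4 * δ * |X1 j w| + (2 * δ * |X2 j w| +
            (3 * C * (|eA j w| + |eR j w|) + (|η j w| * |eR j w| + 2 * C * (|η j w| * 1))))) +
            2 * C := fun j => by
        have p1 : |smean (fun i : Fin (m j) => A j i w) - f| ≤ |eA j w| + 2 * C := by
          rw [dA, add_sub_assoc]
          refine (abs_add_le _ _).trans (add_le_add le_rfl ((abs_sub _ _).trans ?_))
          linarith [b1 j]
        have p2 : |smean (fun i : Fin (m j) => R j i w) - 1| ≤ |eR j w| + 2 * C := by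
          rw [dR, add_sub_assoc]
          refine (abs_add_le _ _).trans (add_le_add le_rfl ((abs_sub _ _).trans ?_))
          rw [abs_one]
          linarith [b2 j]
        have p3 := mul_le_mul_of_nonneg_left p2 (abs_nonneg (η j w))
        have p4 : 0 ≤ 4 * δ * |X1 j w| := by positivity
        have p5 : 0 ≤ 2 * δ * |X2 j w| := by positivity
        have p6 := abs_nonneg (eA j w)
        have p7 := abs_nonneg (eR j w)
        have p8 : |eA j w| ≤ C * |eA j w| := le_mul_of_one_le_left p6 hC1'
        have p9 : 0 ≤ (C : ℝ) * |eR j w| := by positivity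
        change _ + |η j w| * _ ≤ _
        nlinarith
      calc _ ≤ ∑ j, ((4 * δ * |X1 j w| + (2 * δ * |X2 j w| +
            (3 * C * (|eA j w| + |eR j w|) + (|η j w| * |eR j w| + 2 * C * (|η j w| * 1))))) +
            2 * C) + C := add_le_add (Finset.sum_le_sum fun j _ => s1 j) hCf
        _ = ∑ j, (4 * δ * |X1 j w| + (2 * δ * |X2 j w| +
            (3 * C * (|eA j w| + |eR j w|) + (|η j w| * |eR j w| + 2 * C * (|η j w| * 1))))) +
            (2 * C * K + C) * 1 := by
            rw [Finset.sum_add_distrib]; simp; ring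
        _ ≤ _ := le_add_of_nonneg_left (abs_nonneg _)
  refine (eLpNorm_mono_real hpt).trans ?_
  have one2 : (1 : ℝ≥0∞) ≤ 2 := by norm_num
  have hfin : eLpNorm (fun w => |X0 w| + ((∑ j, (4 * δ * |X1 j w| + (2 * δ * |X2 j w| +
      (3 * C * (|eA j w| + |eR j w|) + (|η j w| * |eR j w| + 2 * C * (|η j w| * I w)))))) +
      (2 * C * K + C) * I w)) 2 μ ≤
      q + ((∑ j : Fin K, (ENNReal.ofReal (4 * δ) * q + (ENNReal.ofReal (2 * δ) * (C * q) +
        (ENNReal.ofReal (3 * C) * (e + e) + (C * e + ENNReal.ofReal (2 * C) * (C * P)))))) +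
      ENNReal.ofReal (2 * C * K + C) * P) := by
    refine eLpNorm_fun_add_le (by fun_prop) (by fun_prop) one2 ?_ ?_
    · rw [eLpNorm_fun_abs]; exact nX0
    refine eLpNorm_fun_add_le (by fun_prop) (by fun_prop) one2 ?_ ?_
    swap
    · exact eLpNorm_fun_const_mul_le (by positivity) (h24 mI nI4)
    refine eLpNorm_fun_sum_le (fun j => by fun_prop) one2 fun j => ?_
    refine eLpNorm_fun_add_le (by fun_prop) (by fun_prop) one2 ?_ ?_
    · refine eLpNorm_fun_const_mul_le (by positivity) ?_
      rw [eLpNorm_fun_abs]; exact nX1 j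
    refine eLpNorm_fun_add_le (by fun_prop) (by fun_prop) one2 ?_ ?_
    · refine eLpNorm_fun_const_mul_le (by positivity) ?_
      rw [eLpNorm_fun_abs]; exact nX2 j
    refine eLpNorm_fun_add_le (by fun_prop) (by fun_prop) one2 ?_ ?_
    · refine eLpNorm_fun_const_mul_le (by positivity) ?_
      refine eLpNorm_fun_add_le (by fun_prop) (by fun_prop) one2 ?_ ?_
      · rw [eLpNorm_fun_abs]; exact h24 (meA j) (n4A j)
      · rw [eLpNorm_fun_abs]; exact h24 (meR j) (n4R j)
    exact eLpNorm_fun_add_le (by fun_prop) (by fun_prop) one2 (nηR j)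
      (eLpNorm_fun_const_mul_le (by positivity) (nηI j))
  refine hfin.trans ?_
  have hK1 : (1 : ℝ≥0∞) ≤ K := by
    have : 0 < K := Fin.pos_iff_nonempty.2 inferInstance
    exact_mod_cast this
  have hC1e : (1 : ℝ≥0∞) ≤ C := by exact_mod_cast hC1
  have o1 : ENNReal.ofReal (4 * δ) = 4 * δ := by
    rw [ENNReal.ofReal_mul (by norm_num)]; simp
  have o2 : ENNReal.ofReal (2 * δ) = 2 * δ := by
    rw [ENNReal.ofReal_mul (by norm_num)]; simp
  have o3 : ENNReal.ofReal (3 * C) = 3 * C := by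
    rw [ENNReal.ofReal_mul (by norm_num)]; simp
  have o4 : ENNReal.ofReal (2 * C) = 2 * C := by
    rw [ENNReal.ofReal_mul (by norm_num)]; simp
  have o5 : ENNReal.ofReal (2 * C * K + C) = 2 * C * K + C := by
    rw [ENNReal.ofReal_add (by positivity) (by positivity), ENNReal.ofReal_mul (by positivity), o4]
    simp
  rw [o1, o2, o3, o4, o5, Finset.sum_const, Finset.card_univ, Fintype.card_fin, nsmul_eq_mul]
  have hCC : (C : ℝ≥0∞) ≤ C ^ 2 := by
    rw [pow_two]; exact le_mul_of_one_le_left' hC1e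
  have h1C : (1 : ℝ≥0∞) ≤ C ^ 2 := hC1e.trans hCC
  calc q + ((K : ℝ≥0∞) * (4 * δ * q + (2 * δ * (C * q) + (3 * C * (e + e) +
        (C * e + 2 * C * (C * P))))) + (2 * C * K + C) * P)
      = (1 + K * (4 * 1 + 2 * C) * δ) * q + K * (7 * C) * e +
        (K * (2 * C ^ 2) + 2 * C * K + 1 * C) * P := by ring
    _ ≤ (1 + K * (4 * C ^ 2 + 2 * C ^ 2) * δ) * q + K * (7 * C ^ 2) * e +
        (K * (2 * C ^ 2) + 2 * C ^ 2 * K + K * C ^ 2) * P := by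
        gcongr
    _ = (1 + 6 * K * C ^ 2 * δ) * q + (7 * K * C ^ 2 * e + 5 * K * C ^ 2 * P) := by ring
    _ ≤ (1 + 15 * K * C ^ 2 * δ) * q + (15 * K * C ^ 2 * e + 15 * K * C ^ 2 * P) := by
        gcongr <;> norm_num
    _ = _ := by ring

end MainEstimate

/-! ### Closeness and concentration of the sample moments -/

section Comparison

variable {W E : Type*} [MeasurableSpace W] [MeasurableSpace E] {K : ℕ} {μ : Measure W}
  {ν : Fin K → Measure E}
  {V : Fin K → ℕ → W → E} {r a : Fin K → E → ℝ} {f M : ℝ}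

/-- The event that the sample moments are close to the population moments. -/
def goodEvent (ν : Fin K → Measure E) (r a : Fin K → E → ℝ) (τ : ℝ) (m : Fin K → ℕ)
    (A R : Fin K → ℕ → W → ℝ) : Set W :=
  {w | ∀ j k, |smom (fun i : Fin (m j) => A j i w) (fun i => R j i w) k -
    pmom (ν j) (r j) (a j) k| < τ}

lemma measurable_smom {n : ℕ} {X Y : Fin n → W → ℝ} (hX : ∀ i, Measurable (X i))
    (hY : ∀ i, Measurable (Y i)) (k : Fin 5) :
    Measurable fun w => smom (fun i => X i w) (fun i => Y i w) k := by
  unfold smom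
  exact measurable_smean fun i => (measurable_monom k).comp ((hX i).prodMk (hY i))

lemma measurableSet_goodEvent {τ : ℝ} {m : Fin K → ℕ} {A R : Fin K → ℕ → W → ℝ}
    (hA : ∀ j i, Measurable (A j i)) (hR : ∀ j i, Measurable (R j i)) :
    MeasurableSet (goodEvent ν r a τ m A R) := by
  have h := fun j k => measurable_smom (n := m j) (fun i => hA j i) (fun i => hR j i) k
  have e : goodEvent ν r a τ m A R = ⋂ j, ⋂ k,
      {w | |smom (fun i : Fin (m j) => A j i w) (fun i => R j i w) k -
        pmom (ν j) (r j) (a j) k| < τ} := by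
    ext w; simp [goodEvent]
  rw [e]
  refine MeasurableSet.iInter fun j => MeasurableSet.iInter fun k => ?_
  exact measurableSet_lt (by have := h j k; fun_prop) measurable_const

/-- `coefOf` and `divOf` are continuous at the population moments because the variance of `r j` is
nonzero there. A relative tolerance for the divergence is possible since it is positive, and a
single `τ` serves the finitely many sources. -/
lemma ValModel.exists_tolerance (hV : ValModel μ ν V r a f M) {δ : ℝ} (hδ : 0 < δ) :
    ∃ τ > 0, ∀ (m : Fin K → ℕ) (_ : ∀ j, 0 < m j) (A R : Fin K → ℕ → W → ℝ),
      ∀ w ∈ goodEvent ν r a τ m A R, ∀ j,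
      |divHat (fun i : Fin (m j) => A j i w) (fun i => R j i w) -
        cvDiv (ν j) (r j) (a j) f| ≤ δ * cvDiv (ν j) (r j) (a j) f ∧
      |etaHat (fun i : Fin (m j) => A j i w) (fun i => R j i w) -
        cvCoef (ν j) (r j) (a j)| ≤ δ := by
  have key : ∀ j, ∀ᶠ τ in 𝓝[>] (0 : ℝ), ∀ x : Fin 5 → ℝ,
      (∀ k, |x k - pmom (ν j) (r j) (a j) k| < τ) →
      |divOf x - cvDiv (ν j) (r j) (a j) f| ≤ δ * cvDiv (ν j) (r j) (a j) f ∧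
      |coefOf x - cvCoef (ν j) (r j) (a j)| ≤ δ := by
    intro j
    have := hV.prob j
    have hne : pmom (ν j) (r j) (a j) 1 - pmom (ν j) (r j) (a j) 0 ^ 2 ≠ 0 := by
      rw [← variance_eq_pmom (hV.meas_r j) (hV.bdd_r j)]
      exact hV.var_ne j
    have c1 := Metric.continuousAt_iff.1 (continuousAt_coefOf hne) δ hδ
    have c2 := Metric.continuousAt_iff.1 (continuousAt_divOf hne) _ (mul_pos hδ (hV.cvDiv_pos j))
    rw [coefOf_pmom (hV.meas_r j) (hV.meas_a j) (hV.bdd_r j) (hV.bdd_a j)] at c1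
    rw [divOf_pmom (hV.meas_r j) (hV.meas_a j) (hV.bdd_r j) (hV.bdd_a j) (hV.int_r j)
      (hV.int_a j)] at c2
    obtain ⟨τ1, h1, c1⟩ := c1
    obtain ⟨τ2, h2, c2⟩ := c2
    have hev : Set.Ioo 0 (min τ1 τ2) ∈ 𝓝[>] (0 : ℝ) := Ioo_mem_nhdsGT (lt_min h1 h2)
    filter_upwards [hev] with τ hτ x hx
    have hd : dist x (pmom (ν j) (r j) (a j)) < min τ1 τ2 := by
      refine lt_of_le_of_lt ((dist_pi_le_iff hτ.1.le).2 fun k => ?_) hτ.2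
      rw [Real.dist_eq]; exact (hx k).le
    constructor
    · exact (c2 (hd.trans_le (min_le_right _ _))).le
    · exact (c1 (hd.trans_le (min_le_left _ _))).le
  obtain ⟨τ, h1, h2⟩ := ((eventually_all.2 key).and (self_mem_nhdsWithin)).exists
  refine ⟨τ, h2, fun m hm A R w hw j => ?_⟩
  rw [divHat_eq_divOf (hm j), etaHat_eq_coefOf (hm j)]
  exact h1 j _ (hw j)

variable [IsProbabilityMeasure μ]

lemma meas_ge_abs_le {X : W → ℝ} (hX : Measurable X) {s : ℝ} (hs : 0 < s) :
    μ {w | s ≤ |X w|} ≤ (ENNReal.ofReal s)⁻¹ * eLpNorm X 2 μ := by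
  have h := meas_ge_le_mul_pow_eLpNorm_enorm μ (p := 1) one_ne_zero (by simp)
    hX.aestronglyMeasurable (ε := ENNReal.ofReal s) (by simpa using hs) (by simp)
  simp only [ENNReal.toReal_one, ENNReal.rpow_one] at h
  refine le_trans (le_trans (measure_mono fun w hw => ?_) h) ?_
  · simp only [Set.mem_ofPred_eq] at hw ⊢
    rw [Real.enorm_eq_ofReal_abs]
    exact ENNReal.ofReal_le_ofReal hw
  · gcongr
    exact eLpNorm_le_eLpNorm_of_exponent_le (by norm_num) hX.aestronglyMeasurable

/-- The tolerance is halved. Fitted and ideal sample moments differ by `e + e ^ 2` up to a constant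
in `L²`, so Markov's inequality applies; the ideal values are bounded, so Hoeffding's inequality
compares their moments with the population. The constants do not depend on the sizes or on the
fitted values. -/
lemma ValModel.exists_measure_compl_goodEvent_le (hV : ValModel μ ν V r a f M) {τ : ℝ}
    (hτ : 0 < τ) : ∃ C : ℝ≥0, ∃ κ > 0, ∀ (m : Fin K → ℕ) (A R : Fin K → ℕ → W → ℝ)
      (_ : ∀ j i, Measurable (A j i)) (_ : ∀ j i, Measurable (R j i)) (e : ℝ≥0∞)
      (_ : ∀ j i, eLpNorm (fun w => A j i w - a j (V j i w)) 4 μ ≤ e)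
      (_ : ∀ j i, eLpNorm (fun w => R j i w - r j (V j i w)) 4 μ ≤ e),
      μ (goodEvent ν r a τ m A R)ᶜ ≤
        C * (e + e ^ 2) + ∑ j, ENNReal.ofReal (10 * Real.exp (-κ * m j)) := by
  have hτ2 : 0 < τ / 2 := by positivity
  have mr := hV.meas_r
  have ma := hV.meas_a
  have mV := hV.measV
  -- the exponential rate
  have hκ : ∃ κ > 0, ∀ j k (n : ℕ), μ {w | τ / 2 ≤ |smean (fun i : Fin n =>
      monom k (a j (V j i w)) (r j (V j i w))) - pmom (ν j) (r j) (a j) k|} ≤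
      ENNReal.ofReal (2 * Real.exp (-κ * n)) := by
    -- A smaller rate also works, so stating this for all small `κ > 0` yields one rate for all
    -- sources and moments.
    have h1 : ∀ j k, ∀ᶠ κ in 𝓝[>] (0 : ℝ), ∀ n : ℕ, μ {w | τ / 2 ≤ |smean (fun i : Fin n =>
        monom k (a j (V j i w)) (r j (V j i w))) - pmom (ν j) (r j) (a j) k|} ≤
        ENNReal.ofReal (2 * Real.exp (-κ * n)) := by
      intro j k
      obtain ⟨κ, hκ, h⟩ := exists_measure_smean_ge_le (mV j) (hV.mapV j)
        (hV.indepV.precomp (g := fun i : ℕ => (j, i)) (Prod.mk_right_injective j))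
        ((measurable_monom k).comp ((ma j).prodMk (mr j)))
        (fun z => abs_monom_le k (hV.bdd_a j z) (hV.bdd_r j z)) hτ2
      have hev : Set.Ioo 0 κ ∈ 𝓝[>] (0 : ℝ) := Ioo_mem_nhdsGT hκ
      filter_upwards [hev] with κ' hκ' n
      refine (h n).trans ?_
      apply ENNReal.ofReal_le_ofReal
      have := hκ'.2
      gcongr
    obtain ⟨κ, h2, h3⟩ := ((eventually_all.2 fun j => eventually_all.2 (h1 j)).and
      self_mem_nhdsWithin).exists
    exact ⟨κ, h3, h2⟩
  obtain ⟨κ, hκ0, hκ⟩ := hκ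
  set c1 : ℝ≥0 := 1 + 2 * M.toNNReal with hc1
  -- There are `K` sources with five moments each; `(τ / 2)⁻¹` comes from Markov's inequality and `2
  -- * c1 + 2` from the increment of the monomials.
  refine ⟨K * 5 * ((τ / 2).toNNReal⁻¹ * (2 * c1 + 2)), κ, hκ0, fun m A R hA hR e heA heR => ?_⟩
  -- the moments of the actual values and of the ideal values
  have hdiff : ∀ j k, eLpNorm (fun w => smom (fun i : Fin (m j) => A j i w) (fun i => R j i w) k -
      smean (fun i : Fin (m j) => monom k (a j (V j i w)) (r j (V j i w)))) 2 μ ≤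
      (2 * c1 + 2) * (e + e ^ 2) := by
    intro j k
    simp only [smom]
    simp_rw [← smean_sub]
    have mm : ∀ i, Measurable fun w => monom k (A j i w) (R j i w) -
        monom k (a j (V j i w)) (r j (V j i w)) := fun i =>
      ((measurable_monom k).comp ((hA j i).prodMk (hR j i))).sub
        ((measurable_monom k).comp (((ma j).comp (mV j i)).prodMk ((mr j).comp (mV j i))))
    refine eLpNorm_smean_le (fun i => mm i) (by norm_num) fun i => ?_
    have mdA : Measurable fun w => A j i w - a j (V j i w) := (hA j i).sub ((ma j).comp (mV j i))
    have mdR : Measurable fun w => R j i w - r j (V j i w) := (hR j i).sub ((mr j).comp (mV j i))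
    have hb : ∀ w, ‖monom k (A j i w) (R j i w) - monom k (a j (V j i w)) (r j (V j i w))‖ ≤
        (c1 : ℝ) * (|A j i w - a j (V j i w)| + |R j i w - r j (V j i w)|) +
        (|A j i w - a j (V j i w)| * |A j i w - a j (V j i w)| +
          |R j i w - r j (V j i w)| * |R j i w - r j (V j i w)|) := fun w => by
      have hMM : M ≤ M.toNNReal := Real.le_coe_toNNReal M
      have := abs_monom_sub_le (a' := A j i w) (r' := R j i w) k ((hV.bdd_a j (V j i w)).trans hMM)
        ((hV.bdd_r j (V j i w)).trans hMM)
      rw [pow_two, pow_two] at this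
      simpa [hc1] using this
    refine (eLpNorm_mono_real hb).trans ?_
    have one2 : (1 : ℝ≥0∞) ≤ 2 := by norm_num
    have h24 : ∀ {X : W → ℝ}, Measurable X → eLpNorm X 4 μ ≤ e →
        eLpNorm (fun w => |X w|) 2 μ ≤ e := fun hX h => by
      rw [eLpNorm_fun_abs]
      exact (eLpNorm_le_eLpNorm_of_exponent_le (by norm_num) hX.aestronglyMeasurable).trans h
    have hsq : ∀ {X : W → ℝ}, Measurable X → eLpNorm X 4 μ ≤ e →
        eLpNorm (fun w => |X w| * |X w|) 2 μ ≤ e ^ 2 := fun hX h => by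
      refine (eLpNorm_two_mul_le (by fun_prop) (by fun_prop)).trans ?_
      rw [eLpNorm_fun_abs, pow_two]
      exact mul_le_mul' h h
    have hle : eLpNorm (fun w => (c1 : ℝ) * (|A j i w - a j (V j i w)| +
        |R j i w - r j (V j i w)|) + (|A j i w - a j (V j i w)| * |A j i w - a j (V j i w)| +
          |R j i w - r j (V j i w)| * |R j i w - r j (V j i w)|)) 2 μ ≤
        ENNReal.ofReal c1 * (e + e) + (e ^ 2 + e ^ 2) := by
      refine eLpNorm_fun_add_le (by fun_prop) (by fun_prop) one2 ?_ ?_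
      · refine eLpNorm_fun_const_mul_le c1.2 ?_
        exact eLpNorm_fun_add_le (by fun_prop) (by fun_prop) one2 (h24 mdA (heA j i))
          (h24 mdR (heR j i))
      · exact eLpNorm_fun_add_le (by fun_prop) (by fun_prop) one2 (hsq mdA (heA j i))
          (hsq mdR (heR j i))
    refine hle.trans ?_
    rw [ENNReal.ofReal_coe_nnreal]
    calc (c1 : ℝ≥0∞) * (e + e) + (e ^ 2 + e ^ 2) = 2 * c1 * e + 2 * e ^ 2 := by ring
      _ ≤ (2 * c1 + 2) * e + (2 * c1 + 2) * e ^ 2 := by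
        gcongr
        · exact le_self_add
        · exact le_add_self
      _ = _ := by ring
  have hsub : (goodEvent ν r a τ m A R)ᶜ ⊆ ⋃ j, ⋃ k,
      ({w | τ / 2 ≤ |smom (fun i : Fin (m j) => A j i w) (fun i => R j i w) k -
        smean (fun i : Fin (m j) => monom k (a j (V j i w)) (r j (V j i w)))|} ∪
      {w | τ / 2 ≤ |smean (fun i : Fin (m j) => monom k (a j (V j i w)) (r j (V j i w))) -
        pmom (ν j) (r j) (a j) k|}) := by
    intro w hw
    simp only [goodEvent, Set.mem_compl_iff, Set.mem_ofPred_eq, not_forall, not_lt] at hw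
    obtain ⟨j, k, h⟩ := hw
    simp only [Set.mem_iUnion]
    refine ⟨j, k, ?_⟩
    by_contra hc
    simp only [Set.mem_union, Set.mem_ofPred_eq, not_or, not_le] at hc
    have := abs_sub_le (smom (fun i : Fin (m j) => A j i w) (fun i => R j i w) k)
      (smean (fun i : Fin (m j) => monom k (a j (V j i w)) (r j (V j i w))))
      (pmom (ν j) (r j) (a j) k)
    linarith [hc.1, hc.2]
  have hjk : ∀ j k, μ ({w | τ / 2 ≤ |smom (fun i : Fin (m j) => A j i w) (fun i => R j i w) k -
        smean (fun i : Fin (m j) => monom k (a j (V j i w)) (r j (V j i w)))|} ∪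
      {w | τ / 2 ≤ |smean (fun i : Fin (m j) => monom k (a j (V j i w)) (r j (V j i w))) -
        pmom (ν j) (r j) (a j) k|}) ≤
      (ENNReal.ofReal (τ / 2))⁻¹ * ((2 * c1 + 2) * (e + e ^ 2)) +
        ENNReal.ofReal (2 * Real.exp (-κ * m j)) := fun j k => by
    refine (measure_union_le _ _).trans (add_le_add ?_ (hκ j k (m j)))
    refine (meas_ge_abs_le ?_ hτ2).trans (by gcongr; exact hdiff j k)
    exact (measurable_smom (fun i => hA j i) (fun i => hR j i) k).sub (measurable_smean fun i =>
      (measurable_monom k).comp (((ma j).comp (mV j i)).prodMk ((mr j).comp (mV j i))))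
  calc μ (goodEvent ν r a τ m A R)ᶜ ≤ ∑ j : Fin K, ∑ _k : Fin 5,
        ((ENNReal.ofReal (τ / 2))⁻¹ * ((2 * c1 + 2) * (e + e ^ 2)) +
        ENNReal.ofReal (2 * Real.exp (-κ * m j))) := by
        refine (measure_mono hsub).trans ((measure_iUnion_fintype_le _ _).trans ?_)
        refine Finset.sum_le_sum fun j _ => (measure_iUnion_fintype_le _ _).trans ?_
        exact Finset.sum_le_sum fun k _ => hjk j k
    _ = _ := by
        simp only [Finset.sum_const, Finset.card_univ, Fintype.card_fin, nsmul_eq_mul, mul_add,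
          Finset.sum_add_distrib]
        congr 1
        · have : ENNReal.ofReal (τ / 2) = ((τ / 2).toNNReal : ℝ≥0∞) := rfl
          have h0 : (τ / 2).toNNReal ≠ 0 := by simpa using hτ
          rw [this]
          push_cast
          rw [ENNReal.coe_inv h0]
          ring
        · refine Finset.sum_congr rfl fun j _ => ?_
          rw [show (10 : ℝ) * Real.exp (-κ * m j) = 5 * (2 * Real.exp (-κ * m j)) by ring,
            ENNReal.ofReal_mul (p := 5) (by norm_num)]
          simp

end Comparison

/-! ### Comparison of the two estimates at fixed sample sizes -/

section Comparison

variable {W E : Type*} [MeasurableSpace W] [MeasurableSpace E] {K : ℕ} {μ : Measure W}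
  {ν : Fin K → Measure E}
  {V : Fin K → ℕ → W → E} {r a : Fin K → E → ℝ} {f M : ℝ}

lemma fedIW_eq (m : Fin K → ℕ) (A : (j : Fin K) → Fin (m j) → ℝ) :
    fedIW m A = ∑ j, (m j / ∑ k, (m k : ℝ)) * smean (A j) := by
  rw [fedIW, Finset.mul_sum]
  exact Finset.sum_congr rfl fun j _ => by ring

lemma ValModel.eLpNorm_fedIW_sub_le (hV : ValModel μ ν V r a f M) (m : Fin K → ℕ)
    {A : Fin K → ℕ → W → ℝ} (hA : ∀ j i, Measurable (A j i)) {p e : ℝ≥0∞} (hp : 1 ≤ p)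
    (heA : ∀ j i, eLpNorm (fun w => A j i w - a j (V j i w)) p μ ≤ e) :
    eLpNorm (fun w => fedIW m (fun j i => A j i w) - fedIW m (fun j i => a j (V j i w))) p μ ≤
      e := by
  have mA : ∀ j i, Measurable fun w => A j i w - a j (V j i w) := fun j i =>
    (hA j i).sub ((hV.meas_a j).comp (hV.measV j i))
  have e1 : (fun w => fedIW m (fun j i => A j i w) - fedIW m (fun j i => a j (V j i w))) =
      fun w => ∑ j, (m j / ∑ k, (m k : ℝ)) *
        smean (fun i : Fin (m j) => A j i w - a j (V j i w)) := by
    ext w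
    rw [fedIW_eq, fedIW_eq, ← Finset.sum_sub_distrib]
    exact Finset.sum_congr rfl fun j _ => by rw [smean_sub]; ring
  have h0 : ∀ j, 0 ≤ (m j : ℝ) / ∑ k, (m k : ℝ) := fun j => by positivity
  rw [e1]
  refine (eLpNorm_fun_sum_le (fun j => (measurable_smean fun i => mA j i).const_mul _) hp
    (fun j => eLpNorm_fun_const_mul_le (h0 j) (eLpNorm_smean_le (fun i => mA j i) hp
      fun i => heA j i))).trans ?_
  rw [← Finset.sum_mul, ← ENNReal.ofReal_sum_of_nonneg fun j _ => h0 j, ← Finset.sum_div]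
  refine mul_le_of_le_one_left' ?_
  rw [← ENNReal.ofReal_one]
  exact ENNReal.ofReal_le_ofReal (div_self_le_one _)

variable [IsProbabilityMeasure μ]

/-- The error bound for FedDAE: the first term is the standard deviation of the optimally weighted
ideal control variate estimate up to a factor `1 + x`. -/
lemma ValModel.exists_eLpNorm_fedDA_sub_le [Nonempty (Fin K)] (hV : ValModel μ ν V r a f M)
    (B : ℝ≥0) {x : ℝ} (hx : 0 < x) :
    ∃ C : ℝ≥0, ∃ κ > 0, ∀ (m : Fin K → ℕ) (_ : ∀ j, 0 < m j) (A R : Fin K → ℕ → W → ℝ)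
      (_ : ∀ j i, Measurable (A j i)) (_ : ∀ j i, Measurable (R j i)) (e : ℝ≥0∞)
      (_ : ∀ j i, eLpNorm (fun w => A j i w - a j (V j i w)) 4 μ ≤ e)
      (_ : ∀ j i, eLpNorm (fun w => R j i w - r j (V j i w)) 4 μ ≤ e)
      (_ : ∀ j, eLpNorm (fun w => etaHat (fun i : Fin (m j) => A j i w) fun i => R j i w) 4 μ ≤ B),
      eLpNorm (fun w => fedDA m (fun j i => A j i w) (fun j i => R j i w) - f) 2 μ ≤
        ENNReal.ofReal ((1 + x) * √((∑ k, m k / cvDiv (ν k) (r k) (a k) f)⁻¹)) +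
        C * (e + (C * (e + e ^ 2)) ^ (1 / 4 : ℝ)) +
        C * (∑ j, ENNReal.ofReal (10 * Real.exp (-κ * m j))) ^ (1 / 4 : ℝ) := by
  -- a common constant
  set C0 : ℝ≥0 := 1 + M.toNNReal + |f|.toNNReal + B +
    (∑ j, |cvCoef (ν j) (r j) (a j)|).toNNReal +
    (∑ j, √(Var[r j; ν j] / cvDiv (ν j) (r j) (a j) f)).toNNReal with hC0
  have b1 : 1 ≤ C0 := by
    rw [hC0]; simp only [add_assoc]; exact le_self_add
  have b2 : M.toNNReal ≤ C0 := by
    calc _ ≤ 1 + M.toNNReal := le_add_self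
      _ ≤ _ := by rw [hC0]; simp only [add_assoc]; gcongr; exact le_self_add
  have b3 : |f|.toNNReal ≤ C0 := by
    calc _ ≤ 1 + M.toNNReal + |f|.toNNReal := le_add_self
      _ ≤ _ := by rw [hC0]; simp only [add_assoc]; gcongr; exact le_self_add
  have b4 : B ≤ C0 := by
    calc _ ≤ 1 + M.toNNReal + |f|.toNNReal + B := le_add_self
      _ ≤ _ := by rw [hC0]; simp only [add_assoc]; gcongr; exact le_self_add
  have b5 : (∑ j, |cvCoef (ν j) (r j) (a j)|).toNNReal ≤ C0 := by
    rw [hC0]; exact le_trans le_add_self le_self_add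
  have b6 : (∑ j, √(Var[r j; ν j] / cvDiv (ν j) (r j) (a j) f)).toNNReal ≤ C0 := le_add_self
  have b5' : ∀ j, |cvCoef (ν j) (r j) (a j)| ≤ C0 := fun j =>
    (Finset.single_le_sum (f := fun j => |cvCoef (ν j) (r j) (a j)|)
      (fun _ _ => abs_nonneg _) (Finset.mem_univ j)).trans (Real.toNNReal_le_iff_le_coe.1 b5)
  have b6' : ∀ j, Var[r j; ν j] ≤ C0 ^ 2 * cvDiv (ν j) (r j) (a j) f := fun j => by
    have h := (Finset.single_le_sum (f := fun j => √(Var[r j; ν j] / cvDiv (ν j) (r j) (a j) f))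
      (fun _ _ => Real.sqrt_nonneg _) (Finset.mem_univ j)).trans (Real.toNNReal_le_iff_le_coe.1 b6)
    rw [Real.sqrt_le_left (show (0 : ℝ) ≤ C0 from C0.2), div_le_iff₀ (hV.cvDiv_pos j)] at h
    exact h
  -- the accuracy on the good event
  set c : ℝ≥0 := 15 * K * C0 ^ 2 with hc
  obtain ⟨δ, hδ0, hδ4, hδx⟩ : ∃ δ : ℝ≥0, 0 < δ ∧ δ ≤ 1 / 4 ∧ (c : ℝ) * δ ≤ x := by
    refine ⟨min (1 / 4) (x.toNNReal / (c + 1)), ?_, min_le_left _ _, ?_⟩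
    · refine lt_min (by norm_num) (div_pos (by simpa using hx) (by positivity))
    · have : (min (1 / 4) (x.toNNReal / (c + 1)) : ℝ≥0) ≤ x.toNNReal / (c + 1) := min_le_right _ _
      have h2 : ((min (1 / 4) (x.toNNReal / (c + 1)) : ℝ≥0) : ℝ) ≤ x / (c + 1) := by
        refine (NNReal.coe_le_coe.2 this).trans (le_of_eq ?_)
        push_cast
        rw [Real.coe_toNNReal _ hx.le]
      calc (c : ℝ) * _ ≤ c * (x / (c + 1)) := by gcongr
        _ = x * (c / (c + 1)) := by ring
        _ ≤ x := mul_le_of_le_one_right hx.le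
          ((div_le_one (by positivity)).2 (by simp))
  obtain ⟨τ, hτ, hgood⟩ := hV.exists_tolerance (show (0 : ℝ) < δ from hδ0)
  obtain ⟨C1, κ, hκ, hbad⟩ := hV.exists_measure_compl_goodEvent_le hτ
  -- One constant plays two roles: the factor in front, and the factor inside the fourth root.
  refine ⟨c + C1, κ, hκ, fun m hm A R hA hR e heA heR hη => ?_⟩
  have hmain := hV.eLpNorm_fedDA_sub_le b1 (Real.toNNReal_le_iff_le_coe.1 b2)
    (Real.toNNReal_le_iff_le_coe.1 b3) b4 b5' b6' hδ4 hm hA hR heA heR hη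
    (measurableSet_goodEvent (ν := ν) (r := r) (a := a) (τ := τ) (m := m) hA hR)
    (fun w hw j => (hgood m hm A R w hw j).1) (fun w hw j => (hgood m hm A R w hw j).2)
  refine hmain.trans ?_
  have hcE : (15 * K * C0 ^ 2 : ℝ≥0∞) = c := by rw [hc]; push_cast; rfl
  rw [hcE]
  set q := √((∑ k, m k / cvDiv (ν k) (r k) (a k) f)⁻¹) with hq
  set ρ := ∑ j, ENNReal.ofReal (10 * Real.exp (-κ * m j)) with hρ
  have h1 : (1 + (c : ℝ≥0∞) * δ) * ENNReal.ofReal q ≤ ENNReal.ofReal ((1 + x) * q) := by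
    rw [ENNReal.ofReal_mul (by positivity)]
    gcongr
    rw [ENNReal.ofReal_add zero_le_one hx.le, ENNReal.ofReal_one]
    gcongr
    rw [← ENNReal.coe_mul, ← ENNReal.ofReal_coe_nnreal]
    exact ENNReal.ofReal_le_ofReal (by simpa using hδx)
  -- Subadditivity of the fourth root separates the fitting error from the exponential term, since
  -- the two vanish in different limits.
  have h2 : μ (goodEvent ν r a τ m A R)ᶜ ^ (1 / 4 : ℝ) ≤
      ((c + C1 : ℝ≥0) * (e + e ^ 2)) ^ (1 / 4 : ℝ) + ρ ^ (1 / 4 : ℝ) := by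
    refine le_trans ?_ (ENNReal.rpow_add_le_add_rpow _ _ (by norm_num) (by norm_num))
    gcongr
    refine (hbad m A R hA hR e heA heR).trans ?_
    gcongr
    exact le_add_self
  calc _ ≤ ENNReal.ofReal ((1 + x) * q) + (c + C1 : ℝ≥0) * (e +
        (((c + C1 : ℝ≥0) * (e + e ^ 2)) ^ (1 / 4 : ℝ) + ρ ^ (1 / 4 : ℝ))) := by
        gcongr
        exact le_self_add
    _ = _ := by ring

lemma ValModel.memLp_fedIW_ideal (hV : ValModel μ ν V r a f M) (m : Fin K → ℕ) :
    MemLp (fun w => fedIW m (fun j i => a j (V j i w))) 2 μ := by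
  have hbd : ∀ j i, MemLp (fun w => a j (V j i w)) 2 μ := fun j i =>
    MemLp.of_bound ((hV.meas_a j).comp (hV.measV j i)).aestronglyMeasurable M
      (ae_of_all _ fun w => hV.bdd_a j _)
  simp_rw [fedIW_eq]
  refine memLp_finsetSum _ fun j _ => MemLp.const_mul ?_ _
  simp only [smean, div_eq_mul_inv]
  exact (memLp_finsetSum _ fun (i : Fin (m j)) _ => hbd j i).mul_const _

lemma ValModel.variance_fedIW_ideal (hV : ValModel μ ν V r a f M) (m : Fin K → ℕ) :
    Var[fun w => fedIW m (fun j i => a j (V j i w)); μ] =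
      ∑ j, ((m j : ℝ) / ∑ k, (m k : ℝ)) ^ 2 * Var[a j; ν j] / m j := by
  have := hV.prob
  simp_rw [fedIW_eq]
  exact variance_sum_smean hV.measV hV.mapV hV.indepV hV.meas_a hV.bdd_a m _

/-- Two effects combine. The control variate replaces `Var a` by the smaller divergence `D`. Then
Cauchy-Schwarz for `√(m D)` and `√(m / D)`, whose product is `m`, gives `(∑ m)² ≤ (∑ m D) (∑ m /
D)`, the optimality of inverse variance weights. -/
lemma ValModel.inv_sum_le_variance_fedIW [Nonempty (Fin K)] (hV : ValModel μ ν V r a f M)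
    {m : Fin K → ℕ} (hm : ∀ j, 0 < m j) :
    (∑ k, m k / cvDiv (ν k) (r k) (a k) f)⁻¹ ≤
      Var[fun w => fedIW m (fun j i => a j (V j i w)); μ] := by
  have hprob := hV.prob
  have hm' : ∀ j, (0 : ℝ) < (fun k => (m k : ℝ)) j := fun j => by simpa using hm j
  have hD := hV.cvDiv_pos
  have hS := sum_div_pos hm' hD
  have hn : 0 < ∑ k, (m k : ℝ) := Finset.sum_pos (fun k _ => hm' k) Finset.univ_nonempty
  have hcs := Finset.sum_mul_sq_le_sq_mul_sq Finset.univ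
    (fun k => √(m k * cvDiv (ν k) (r k) (a k) f)) (fun k => √(m k / cvDiv (ν k) (r k) (a k) f))
  have e1 : ∀ k, √(m k * cvDiv (ν k) (r k) (a k) f) * √(m k / cvDiv (ν k) (r k) (a k) f) =
      m k := fun k => by
    have := (hD k).ne'
    rw [← Real.sqrt_mul (mul_nonneg (hm' k).le (hD k).le)]
    rw [show (m k : ℝ) * cvDiv (ν k) (r k) (a k) f * (m k / cvDiv (ν k) (r k) (a k) f) =
      (m k : ℝ) ^ 2 by field_simp]
    exact Real.sqrt_sq (hm' k).le
  have e2 : ∀ k, √(m k * cvDiv (ν k) (r k) (a k) f) ^ 2 = m k * cvDiv (ν k) (r k) (a k) f :=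
    fun k => Real.sq_sqrt (mul_nonneg (hm' k).le (hD k).le)
  have e3 : ∀ k, √(m k / cvDiv (ν k) (r k) (a k) f) ^ 2 = m k / cvDiv (ν k) (r k) (a k) f :=
    fun k => Real.sq_sqrt (div_nonneg (hm' k).le (hD k).le)
  simp only [e1, e2, e3] at hcs
  rw [hV.variance_fedIW_ideal]
  set S := ∑ k, m k / cvDiv (ν k) (r k) (a k) f
  set n := ∑ k, (m k : ℝ)
  have hle : (∑ k, m k * cvDiv (ν k) (r k) (a k) f) / n ^ 2 ≤
      ∑ j, ((m j : ℝ) / n) ^ 2 * Var[a j; ν j] / m j := by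
    rw [Finset.sum_div]
    refine Finset.sum_le_sum fun j _ => ?_
    have h1 := cvDiv_le_variance (hV.meas_r j) (hV.meas_a j) (hV.bdd_r j) (hV.bdd_a j)
      (hV.int_r j) (hV.int_a j) (hV.var_ne j)
    have := (hm' j).ne'
    calc (m j : ℝ) * cvDiv (ν j) (r j) (a j) f / n ^ 2 ≤ m j * Var[a j; ν j] / n ^ 2 := by gcongr
      _ = _ := by field_simp
  refine le_trans ?_ hle
  rw [inv_eq_one_div, div_le_div_iff₀ hS (by positivity), one_mul]
  exact hcs

lemma ValModel.variance_fedIW_le (hV : ValModel μ ν V r a f M) (m : Fin K → ℕ) :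
    Var[fun w => fedIW m (fun j i => a j (V j i w)); μ] ≤ ∑ j, Var[a j; ν j] / m j := by
  rw [hV.variance_fedIW_ideal]
  refine Finset.sum_le_sum fun j _ => ?_
  have h1 : (m j : ℝ) / ∑ k, (m k : ℝ) ≤ 1 := by
    refine div_le_one_of_le₀ ?_ (by positivity)
    exact Finset.single_le_sum (f := fun k => (m k : ℝ)) (fun _ _ => by positivity)
      (Finset.mem_univ j)
  have h2 : ((m j : ℝ) / ∑ k, (m k : ℝ)) ^ 2 ≤ 1 := pow_le_one₀ (by positivity) h1
  have := variance_nonneg (a j) (ν j)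
  gcongr
  exact mul_le_of_le_one_left this h2

end Comparison

/-! ### Passage to the limit in the sample sizes -/

section Limit

variable {W E T : Type*} [MeasurableSpace W] [MeasurableSpace E] {K : ℕ} {μ : Measure W}
 {ν : Fin K → Measure E}
  {V : Fin K → ℕ → W → E} {r a : Fin K → E → ℝ} {f M : ℝ}
  {l : Filter T} {A R : T → Fin K → ℕ → W → ℝ} {e : T → ℝ≥0∞} {B : ℝ≥0}

lemma tendsto_apply_atTop {ι : Type*} (j : ι) :
    Tendsto (fun m : ι → ℕ => m j) atTop atTop :=
  tendsto_atTop.2 fun b => (eventually_ge_atTop fun _ => b).mono fun _ hm => hm j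

lemma tendsto_sample_size (j : Fin K) :
    Tendsto (fun m : Fin K → ℕ => (m j : ℝ)) atTop atTop :=
  tendsto_natCast_atTop_atTop.comp (tendsto_apply_atTop j)

lemma eventually_sample_size_pos : ∀ᶠ m : Fin K → ℕ in atTop, ∀ j, 0 < m j :=
  eventually_all.2 fun j => (tendsto_apply_atTop j).eventually_gt_atTop 0

lemma tendsto_sum_div_atTop [Nonempty (Fin K)] {D : Fin K → ℝ} (hD : ∀ j, 0 < D j) :
    Tendsto (fun m : Fin K → ℕ => ∑ k, (m k : ℝ) / D k) atTop atTop := by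
  obtain ⟨j⟩ := ‹Nonempty (Fin K)›
  refine tendsto_atTop_mono (fun m => ?_) ((tendsto_sample_size j).atTop_div_const (hD j))
  exact Finset.single_le_sum (f := fun k => (m k : ℝ) / D k)
    (fun k _ => div_nonneg (Nat.cast_nonneg _) (hD k).le) (Finset.mem_univ j)

lemma tendsto_sqrt_inv_sum [Nonempty (Fin K)] {D : Fin K → ℝ} (hD : ∀ j, 0 < D j) :
    Tendsto (fun m : Fin K → ℕ => √((∑ k, (m k : ℝ) / D k)⁻¹)) atTop (𝓝 0) := by
  have h := (tendsto_inv_atTop_zero.comp (tendsto_sum_div_atTop hD)).sqrt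
  simpa using h

lemma tendsto_exp_neg_sample_size {κ : ℝ} (hκ : 0 < κ) (j : Fin K) :
    Tendsto (fun m : Fin K → ℕ => Real.exp (-κ * m j)) atTop (𝓝 0) := by
  refine Real.tendsto_exp_atBot.comp ?_
  exact (tendsto_sample_size j).const_mul_atTop_of_neg (by linarith)

lemma tendsto_rate_zero (C : ℝ≥0) (he : Tendsto e l (𝓝 0)) :
    Tendsto (fun t => (C : ℝ≥0∞) * (e t + (C * (e t + e t ^ 2)) ^ (1 / 4 : ℝ))) l (𝓝 0) := by
  have h1 : Tendsto (fun t => (C : ℝ≥0∞) * (e t + e t ^ 2)) l (𝓝 0) := by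
    have := ENNReal.Tendsto.const_mul (a := C) (he.add (ENNReal.Tendsto.pow (n := 2) he))
      (Or.inr ENNReal.coe_ne_top)
    simpa using this
  have h2 := h1.ennrpow_const (1 / 4)
  have := ENNReal.Tendsto.const_mul (a := C) (he.add h2) (Or.inr ENNReal.coe_ne_top)
  simpa using this

lemma tendsto_exp_rate_zero (C : ℝ≥0) {κ : ℝ} (hκ : 0 < κ) :
    Tendsto (fun m : Fin K → ℕ => (C : ℝ≥0∞) *
      (∑ j, ENNReal.ofReal (10 * Real.exp (-κ * m j))) ^ (1 / 4 : ℝ)) atTop (𝓝 0) := by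
  have h1 : Tendsto (fun m : Fin K → ℕ => ∑ j, ENNReal.ofReal (10 * Real.exp (-κ * m j)))
      atTop (𝓝 (∑ _j : Fin K, 0)) := by
    refine tendsto_finsetSum _ fun j _ => ?_
    have := ENNReal.tendsto_ofReal ((tendsto_exp_neg_sample_size hκ j).const_mul 10)
    simpa using this
  have h2 := h1.ennrpow_const (1 / 4)
  have := ENNReal.Tendsto.const_mul (a := C) h2 (Or.inr ENNReal.coe_ne_top)
  simpa using this

/-- With proportionally growing sample sizes the exponential rate is negligible with respect to
the standard deviation of the optimally weighted estimate. -/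
lemma eventually_exp_rate_le [Nonempty (Fin K)] {D : Fin K → ℝ} (hD : ∀ j, 0 < D j) (C : ℝ≥0)
    {κ c x : ℝ} (hκ : 0 < κ) (hc : 0 < c) (hx : 0 < x) :
    ∀ᶠ m : Fin K → ℕ in atTop, (∀ j, c * ∑ k, (m k : ℝ) ≤ m j) →
      (C : ℝ≥0∞) * (∑ j, ENNReal.ofReal (10 * Real.exp (-κ * m j))) ^ (1 / 4 : ℝ) ≤
        ENNReal.ofReal (x * √((∑ k, (m k : ℝ) / D k)⁻¹)) := by
  set Q := ∑ k, (D k)⁻¹ with hQ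
  have hn : Tendsto (fun m : Fin K → ℕ => κ * c * ∑ k, (m k : ℝ)) atTop atTop := by
    have := tendsto_sum_div_atTop (K := K) (D := fun _ => 1) fun _ => one_pos
    simp only [div_one] at this
    exact this.const_mul_atTop (by positivity)
  -- This is the fourth power of the claim. The fourth power of the standard deviation is `S⁻²` with
  -- `S ≤ Q n`, so it suffices that `n² exp (-κ c n)` tends to zero; proportionality bounds every `m
  -- j` below by `c n`.
  have hlim : Tendsto (fun m : Fin K → ℕ => (C ^ 4 * (K * 10) * (Q / (κ * c)) ^ 2) *
      ((κ * c * ∑ k, (m k : ℝ)) ^ 2 * Real.exp (-(κ * c * ∑ k, (m k : ℝ))))) atTop (𝓝 0) := by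
    have := ((Real.tendsto_pow_mul_exp_neg_atTop_nhds_zero 2).comp hn).const_mul
      ((C : ℝ) ^ 4 * (K * 10) * (Q / (κ * c)) ^ 2)
    simpa using this
  filter_upwards [hlim.eventually_lt_const (show (0 : ℝ) < x ^ 4 by positivity),
    eventually_sample_size_pos] with m hm hpos hprop
  have hm' : ∀ j, (0 : ℝ) < (fun k => (m k : ℝ)) j := fun j => by simpa using hpos j
  have hS := sum_div_pos hm' hD
  set n := ∑ k, (m k : ℝ) with hn'
  set S := ∑ k, (m k : ℝ) / D k with hS'
  set u := K * 10 * Real.exp (-(κ * c * n)) with hu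
  have hu0 : 0 ≤ u := by positivity
  have h1 : ∑ j, ENNReal.ofReal (10 * Real.exp (-κ * m j)) ≤ ENNReal.ofReal u := by
    rw [← ENNReal.ofReal_sum_of_nonneg fun j _ => by positivity]
    apply ENNReal.ofReal_le_ofReal
    calc ∑ j, 10 * Real.exp (-κ * m j) ≤ ∑ _j : Fin K, 10 * Real.exp (-(κ * c * n)) := by
          refine Finset.sum_le_sum fun j _ => ?_
          have := mul_le_mul_of_nonneg_left (hprop j) hκ.le
          gcongr
          linarith
      _ = u := by rw [Finset.sum_const]; simp [hu]; ring
  have h2 : S ≤ Q * n := by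
    rw [hQ, Finset.sum_mul]
    refine Finset.sum_le_sum fun k _ => ?_
    rw [div_eq_inv_mul]
    have := hD k
    gcongr
    exact Finset.single_le_sum (f := fun k => (m k : ℝ)) (fun k _ => (hm' k).le)
      (Finset.mem_univ k)
  calc _ ≤ (C : ℝ≥0∞) * (ENNReal.ofReal u) ^ (1 / 4 : ℝ) := by gcongr
    _ = ENNReal.ofReal (C * u ^ (1 / 4 : ℝ)) := by
        rw [ENNReal.ofReal_rpow_of_nonneg hu0 (by norm_num),
          ENNReal.ofReal_mul (show (0 : ℝ) ≤ C from C.2),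
          ENNReal.ofReal_coe_nnreal]
    _ ≤ _ := by
        apply ENNReal.ofReal_le_ofReal
        rw [← pow_le_pow_iff_left₀ (by positivity) (by positivity) (show 4 ≠ 0 by norm_num),
          mul_pow, mul_pow, ← Real.rpow_natCast (u ^ (1 / 4 : ℝ)), ← Real.rpow_mul hu0]
        have e1 : √(S⁻¹) ^ 4 = (S ^ 2)⁻¹ := by
          rw [show 4 = 2 * 2 by norm_num, pow_mul, Real.sq_sqrt (by positivity), inv_pow]
        rw [e1]
        norm_num
        rw [← div_eq_mul_inv, le_div_iff₀ (by positivity)]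
        refine le_trans ?_ hm.le
        calc (C : ℝ) ^ 4 * u * S ^ 2 ≤ C ^ 4 * u * (Q * n) ^ 2 := by gcongr
          _ = _ := by rw [hu]; field_simp

lemma memLp_of_eLpNorm_sub_lt_top {X Y : W → ℝ} (hX : Measurable X) (hY : MemLp Y 2 μ)
    (hYm : Measurable Y) (h : eLpNorm (fun w => X w - Y w) 2 μ < ∞) : MemLp X 2 μ := by
  have h1 : MemLp (fun w => X w - Y w) 2 μ := ⟨(hX.sub hYm).aestronglyMeasurable, h⟩
  have e1 : X = fun w => (X w - Y w) + Y w := by ext w; ring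
  rw [e1]
  exact h1.add hY

variable [IsProbabilityMeasure μ]

lemma memLp_of_eLpNorm_sub_const_lt_top {X : W → ℝ} (hX : Measurable X) {c : ℝ} {p : ℝ≥0∞}
    (h : eLpNorm (fun w => X w - c) p μ < ∞) : MemLp X p μ := by
  have h1 : MemLp (fun w => X w - c) p μ := ⟨(hX.sub_const c).aestronglyMeasurable, h⟩
  have e1 : X = fun w => (X w - c) + c := by ext w; ring
  rw [e1]
  exact h1.add (memLp_const c)

lemma measurable_fedIW {m : Fin K → ℕ} {X : (j : Fin K) → Fin (m j) → W → ℝ}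
    (hX : ∀ j i, Measurable (X j i)) : Measurable fun w => fedIW m (fun j i => X j i w) := by
  simp_rw [fedIW_eq]
  exact Finset.measurable_sum _ fun j _ => (measurable_smean (hX j)).const_mul _

/-- FedDAE has asymptotically at most the variance of FedIWE whenever the validation values
converge in fourth mean, uniformly over the validation points. -/
theorem ValModel.variance_comparison [Nonempty (Fin K)] (hV : ValModel μ ν V r a f M)
    (hA : ∀ t j i, Measurable (A t j i)) (hR : ∀ t j i, Measurable (R t j i))
    (he : Tendsto e l (𝓝 0))
    (heA : ∀ t j i, eLpNorm (fun w => A t j i w - a j (V j i w)) 4 μ ≤ e t)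
    (heR : ∀ t j i, eLpNorm (fun w => R t j i w - r j (V j i w)) 4 μ ≤ e t)
    (hη : ∀ j, ∀ᶠ s : (Fin K → ℕ) × T in atTop ×ˢ l,
      eLpNorm (fun w => etaHat (fun i : Fin (s.1 j) => A s.2 j i w) fun i => R s.2 j i w) 4 μ
        ≤ B) :
    (∀ᶠ s : (Fin K → ℕ) × T in atTop ×ˢ l,
      MemLp (fun w => fedDA s.1 (fun j i => A s.2 j i w) fun j i => R s.2 j i w) 2 μ ∧
      MemLp (fun w => fedIW s.1 (fun j i => A s.2 j i w)) 2 μ) ∧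
    (Tendsto (fun s : (Fin K → ℕ) × T =>
      Var[fun w => fedDA s.1 (fun j i => A s.2 j i w) fun j i => R s.2 j i w; μ]) (atTop ×ˢ l)
        (𝓝 0) ∧
    Tendsto (fun s : (Fin K → ℕ) × T => Var[fun w => fedIW s.1 (fun j i => A s.2 j i w); μ])
      (atTop ×ˢ l) (𝓝 0)) ∧
    (∀ c > (0 : ℝ), ∀ ε > (0 : ℝ), ∀ᶠ m : Fin K → ℕ in atTop,
      (∀ j, c * ∑ k, (m k : ℝ) ≤ m j) → ∀ᶠ t in l,
        Var[fun w => fedDA m (fun j i => A t j i w) fun j i => R t j i w; μ] ≤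
          (1 + ε) * Var[fun w => fedIW m (fun j i => A t j i w); μ]) := by
  have hD := hV.cvDiv_pos
  have hηall := eventually_all.2 hη
  have he2 : ∀ t j i, eLpNorm (fun w => A t j i w - a j (V j i w)) 2 μ ≤ e t := fun t j i =>
    (eLpNorm_le_eLpNorm_of_exponent_le (by norm_num)
      ((hA t j i).sub ((hV.meas_a j).comp (hV.measV j i))).aestronglyMeasurable).trans (heA t j i)
  have hIWe : ∀ m t, eLpNorm (fun w => fedIW m (fun j i => A t j i w) -
      fedIW m (fun j i => a j (V j i w))) 2 μ ≤ e t := fun m t =>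
    hV.eLpNorm_fedIW_sub_le m (hA t) (by norm_num) (he2 t)
  have mIW : ∀ m : Fin K → ℕ, Measurable fun w => fedIW m (fun j i => a j (V j i w)) := fun m =>
    measurable_fedIW fun j i => (hV.meas_a j).comp (hV.measV j i)
  have hpos : ∀ᶠ s : (Fin K → ℕ) × T in atTop ×ˢ l, ∀ j, 0 < s.1 j :=
    tendsto_fst.eventually eventually_sample_size_pos
  have hesmall : ∀ {y : ℝ≥0∞}, 0 < y → ∀ᶠ t in l, e t < y := fun hy => he.eventually_lt_const hy
  have hIWmem : ∀ᶠ s : (Fin K → ℕ) × T in atTop ×ˢ l,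
      MemLp (fun w => fedIW s.1 (fun j i => A s.2 j i w)) 2 μ := by
    filter_upwards [tendsto_snd.eventually (hesmall one_pos)] with s hs
    exact memLp_of_eLpNorm_sub_lt_top (measurable_fedIW fun j i => hA s.2 j i)
      (hV.memLp_fedIW_ideal s.1) (mIW s.1)
      ((hIWe s.1 s.2).trans_lt (hs.trans ENNReal.one_lt_top))
  -- the joint limit
  obtain ⟨C, κ, hκ, hb⟩ := hV.exists_eLpNorm_fedDA_sub_le B one_pos
  have hbd : ∀ᶠ s : (Fin K → ℕ) × T in atTop ×ˢ l,
      eLpNorm (fun w => fedDA s.1 (fun j i => A s.2 j i w) (fun j i => R s.2 j i w) - f) 2 μ ≤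
        ENNReal.ofReal ((1 + 1) * √((∑ k, s.1 k / cvDiv (ν k) (r k) (a k) f)⁻¹)) +
        C * (e s.2 + (C * (e s.2 + e s.2 ^ 2)) ^ (1 / 4 : ℝ)) +
        C * (∑ j, ENNReal.ofReal (10 * Real.exp (-κ * s.1 j))) ^ (1 / 4 : ℝ) := by
    filter_upwards [hpos, hηall] with s h1 h2
    exact hb s.1 h1 (A s.2) (R s.2) (hA s.2) (hR s.2) (e s.2) (heA s.2) (heR s.2) h2
  have hlim : Tendsto (fun s : (Fin K → ℕ) × T =>
      eLpNorm (fun w => fedDA s.1 (fun j i => A s.2 j i w) (fun j i => R s.2 j i w) - f) 2 μ)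
      (atTop ×ˢ l) (𝓝 0) := by
    refine tendsto_of_tendsto_of_tendsto_of_le_of_le' tendsto_const_nhds ?_
      (Eventually.of_forall fun _ => zero_le) hbd
    have t1 := (ENNReal.tendsto_ofReal ((tendsto_sqrt_inv_sum hD).const_mul (1 + 1))).comp
      (tendsto_fst (f := atTop) (g := l))
    have t2 := (tendsto_rate_zero C he).comp (tendsto_snd (f := (atTop : Filter (Fin K → ℕ))))
    have t3 := (tendsto_exp_rate_zero (K := K) C hκ).comp (tendsto_fst (f := atTop) (g := l))
    simpa using (t1.add t2).add t3
  have mDA : ∀ s : (Fin K → ℕ) × T, Measurable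
      fun w => fedDA s.1 (fun j i => A s.2 j i w) (fun j i => R s.2 j i w) := fun s =>
    measurable_fedDA (fun j i => hA s.2 j i) fun j i => hR s.2 j i
  have hDAfin : ∀ᶠ s : (Fin K → ℕ) × T in atTop ×ˢ l,
      eLpNorm (fun w => fedDA s.1 (fun j i => A s.2 j i w) (fun j i => R s.2 j i w) - f) 2 μ < ∞ :=
    (hlim.eventually_lt_const one_pos).mono fun s hs => hs.trans ENNReal.one_lt_top
  have hDAmem : ∀ᶠ s : (Fin K → ℕ) × T in atTop ×ˢ l,
      MemLp (fun w => fedDA s.1 (fun j i => A s.2 j i w) fun j i => R s.2 j i w) 2 μ :=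
    hDAfin.mono fun s hs => memLp_of_eLpNorm_sub_const_lt_top (mDA s) hs
  refine ⟨hDAmem.and hIWmem, ⟨?_, ?_⟩, ?_⟩
  · have h1 := ((ENNReal.tendsto_toReal ENNReal.zero_ne_top).comp hlim).pow 2
    simp only [ENNReal.toReal_zero, ne_eq, OfNat.ofNat_ne_zero, not_false_eq_true, zero_pow] at h1
    refine tendsto_of_tendsto_of_tendsto_of_le_of_le' tendsto_const_nhds h1
      (Eventually.of_forall fun _ => variance_nonneg _ _) ?_
    filter_upwards [hDAmem, hDAfin] with s hs hs'
    exact variance_le_sq hs f ENNReal.toReal_nonneg (ENNReal.ofReal_toReal hs'.ne).ge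
  · have h1 : Tendsto (fun m : Fin K → ℕ => ∑ j, Var[a j; ν j] / m j) atTop
        (𝓝 (∑ _j : Fin K, 0)) :=
      tendsto_finsetSum _ fun j _ => (tendsto_sample_size j).const_div_atTop _
    have h2 : Tendsto (fun s : (Fin K → ℕ) × T =>
        (√(∑ j, Var[a j; ν j] / s.1 j) + (e s.2).toReal) ^ 2) (atTop ×ˢ l) (𝓝 0) := by
      have t1 := (h1.sqrt).comp (tendsto_fst (f := atTop) (g := l))
      have t2 := ((ENNReal.tendsto_toReal ENNReal.zero_ne_top).comp he).comp
        (tendsto_snd (f := (atTop : Filter (Fin K → ℕ))))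
      simpa using (t1.add t2).pow 2
    refine tendsto_of_tendsto_of_tendsto_of_le_of_le' tendsto_const_nhds h2
      (Eventually.of_forall fun _ => variance_nonneg _ _) ?_
    filter_upwards [hIWmem, tendsto_snd.eventually (hesmall one_pos)] with s hs hs'
    have hne : e s.2 ≠ ∞ := (hs'.trans ENNReal.one_lt_top).ne
    have h3 := sqrt_variance_le (hV.memLp_fedIW_ideal s.1) hs ENNReal.toReal_nonneg
      (s := (e s.2).toReal) (by
        rw [ENNReal.ofReal_toReal hne]
        refine le_trans (le_of_eq ?_) (hIWe s.1 s.2)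
        exact eLpNorm_sub_comm _ _ _ _)
    rw [← Real.sqrt_le_left (by positivity)]
    exact h3.trans (by gcongr; exact hV.variance_fedIW_le s.1)
  · intro c hc ε hε
    -- Chosen so that `(1 + 3 x)² ≤ (1 + 16 x) (1 - x)²` and `16 x ≤ ε`. FedDAE has deviation at
    -- most `(1 + 3 x) q`, where the ideal part, the exponential term and the fitting error each
    -- cost `x q`; FedIWE has standard deviation at least `(1 - x) q`.
    set x := min ε 1 / 16 with hx
    have hx0 : 0 < x := by positivity
    have hx1 : 16 * x ≤ 1 := by
      have := min_le_right ε 1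
      rw [hx]; linarith
    have hxε : 16 * x ≤ ε := by
      have := min_le_left ε 1
      rw [hx]; linarith
    obtain ⟨C', κ', hκ', hb'⟩ := hV.exists_eLpNorm_fedDA_sub_le B hx0
    filter_upwards [eventually_sample_size_pos, eventually_exp_rate_le hD C' hκ' hc hx0,
      hηall.curry, (hDAmem.and hIWmem).curry] with m hm hrate hηm hmem hprop
    have hm' : ∀ j, (0 : ℝ) < (fun k => (m k : ℝ)) j := fun j => by simpa using hm j
    have hS := sum_div_pos hm' hD
    specialize hrate hprop
    have hq0 : 0 < √((∑ k, m k / cvDiv (ν k) (r k) (a k) f)⁻¹) := Real.sqrt_pos.2 (inv_pos.2 hS)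
    have hIWq : √((∑ k, m k / cvDiv (ν k) (r k) (a k) f)⁻¹) ≤
        √(Var[fun w => fedIW m (fun j i => a j (V j i w)); μ]) :=
      Real.sqrt_le_sqrt (hV.inv_sum_le_variance_fedIW hm)
    have hbm := hb' m hm
    set q := √((∑ k, m k / cvDiv (ν k) (r k) (a k) f)⁻¹) with hq
    have hxq : 0 < ENNReal.ofReal (x * q) := ENNReal.ofReal_pos.2 (by positivity)
    -- The size `m` is fixed now, so the fitting error eventually drops below the fixed positive
    -- number `x * q`.
    filter_upwards [hηm, hmem, (tendsto_rate_zero C' he).eventually_lt_const hxq,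
      hesmall hxq] with t h1 h2 h3 h4
    have h5 : eLpNorm (fun w => fedDA m (fun j i => A t j i w) (fun j i => R t j i w) - f) 2 μ ≤
        ENNReal.ofReal ((1 + 3 * x) * q) := by
      refine (hbm (A t) (R t) (hA t) (hR t) (e t) (heA t) (heR t) h1).trans ?_
      calc _ ≤ ENNReal.ofReal ((1 + x) * q) + ENNReal.ofReal (x * q) +
            ENNReal.ofReal (x * q) := by gcongr
        _ = _ := by
          rw [← ENNReal.ofReal_add (by positivity) (by positivity),
            ← ENNReal.ofReal_add (by positivity) (by positivity)]
          congr 1; ring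
    have h6 := variance_le_sq h2.1 f (by positivity) h5
    have h7 := sqrt_variance_le h2.2 (hV.memLp_fedIW_ideal m) (s := x * q) (by positivity)
      ((hIWe m t).trans h4.le)
    have h8 : (1 - x) * q ≤ √(Var[fun w => fedIW m (fun j i => A t j i w); μ]) := by linarith
    have h9 : ((1 - x) * q) ^ 2 ≤ Var[fun w => fedIW m (fun j i => A t j i w); μ] := by
      rw [← Real.le_sqrt' (mul_pos (by linarith) hq0)]; exact h8
    calc _ ≤ ((1 + 3 * x) * q) ^ 2 := h6
      _ = (1 + 3 * x) ^ 2 * q ^ 2 := by ring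
      _ ≤ ((1 + 16 * x) * (1 - x) ^ 2) * q ^ 2 := by
        gcongr
        nlinarith
      _ = (1 + 16 * x) * ((1 - x) * q) ^ 2 := by ring
      _ ≤ (1 + ε) * Var[fun w => fedIW m (fun j i => A t j i w); μ] := by
        gcongr

end Limit

/-! ### Measurability of maps into separable spaces -/

section Measurability

/-- An open set is a countable union of closed balls with centers in a countable dense set and
rational radii. -/
lemma measurable_of_closedBall {α E : Type*} [MeasurableSpace α] [PseudoMetricSpace E]
    [TopologicalSpace.SeparableSpace E] [MeasurableSpace E] [BorelSpace E] {g : α → E}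
    (h : ∀ c r, MeasurableSet (g ⁻¹' Metric.closedBall c r)) : Measurable g := by
  refine measurable_of_isOpen fun U hU => ?_
  obtain ⟨D, hDc, hD⟩ := TopologicalSpace.exists_countable_dense E
  have e : g ⁻¹' U = ⋃ c ∈ D, ⋃ q : ℚ, ⋃ _ : Metric.closedBall c (q : ℝ) ⊆ U,
      g ⁻¹' Metric.closedBall c (q : ℝ) := by
    ext x
    simp only [Set.mem_preimage, Set.mem_iUnion, exists_prop]
    constructor
    · intro hx
      obtain ⟨ε, hε, hb⟩ := Metric.isOpen_iff.1 hU _ hx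
      obtain ⟨c, hc, hcx⟩ := Metric.dense_iff.1 hD (g x) (ε / 4) (by positivity)
      rw [Metric.mem_ball, dist_comm] at hc
      obtain ⟨q, hq1, hq2⟩ := exists_rat_btwn (show ε / 4 < ε / 2 by linarith)
      refine ⟨c, hcx, q, fun y hy => hb ?_, ?_⟩
      · rw [Metric.mem_ball]
        rw [Metric.mem_closedBall] at hy
        have := dist_triangle y c (g x)
        rw [dist_comm c] at this
        linarith
      · rw [Metric.mem_closedBall]; linarith
    · rintro ⟨c, _, q, hsub, hx⟩
      exact hsub hx
  rw [e]
  refine MeasurableSet.biUnion hDc fun c _ => MeasurableSet.iUnion fun q =>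
    MeasurableSet.iUnion fun _ => h c q

/-- A closed ball is an intersection of half-spaces whose normals run through a countable dense set.
-/
lemma measurable_of_inner {α H : Type*} [MeasurableSpace α] [NormedAddCommGroup H]
    [InnerProductSpace ℝ H] [TopologicalSpace.SeparableSpace H] [MeasurableSpace H]
    [BorelSpace H] {g : α → H} (h : ∀ u : H, Measurable fun x => inner ℝ u (g x)) :
    Measurable g := by
  refine measurable_of_closedBall fun c r => ?_
  obtain ⟨D, hDc, hD⟩ := TopologicalSpace.exists_countable_dense H
  rcases lt_or_ge r 0 with hr | hr
  · simp [Metric.closedBall_eq_empty.2 hr]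
  have e : g ⁻¹' Metric.closedBall c r =
      ⋂ u ∈ D, {x | inner ℝ u (g x) - inner ℝ u c ≤ r * ‖u‖} := by
    ext x
    simp only [Set.mem_preimage, Metric.mem_closedBall, Set.mem_iInter, Set.mem_ofPred_eq,
      ← inner_sub_right, dist_eq_norm]
    constructor
    · intro hx u _
      refine (real_inner_le_norm _ _).trans ?_
      rw [mul_comm]; gcongr
    · intro hx
      have hall : ∀ u : H, inner ℝ u (g x - c) ≤ r * ‖u‖ := by
        have hcl : IsClosed {u : H | inner ℝ u (g x - c) ≤ r * ‖u‖} :=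
          isClosed_le (by fun_prop) (by fun_prop)
        intro u
        exact (hcl.closure_subset_iff.2 fun v hv => hx v hv) (hD u)
      have := hall (g x - c)
      rw [real_inner_self_eq_norm_sq, pow_two] at this
      by_contra hlt
      push Not at hlt
      nlinarith
  rw [e]
  refine MeasurableSet.biInter hDc fun u _ => ?_
  exact measurableSet_le ((h u).sub_const _) measurable_const

/-- A closed ball for the supremum norm is cut out by the evaluations on a countable dense set, by
continuity. -/
lemma measurable_of_eval {α S : Type*} [MeasurableSpace α] [TopologicalSpace S] [CompactSpace S]
    [TopologicalSpace.SeparableSpace S] [TopologicalSpace.SeparableSpace C(S, ℝ)]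
    [MeasurableSpace C(S, ℝ)] [BorelSpace C(S, ℝ)] {g : α → C(S, ℝ)}
    (h : ∀ s, Measurable fun x => g x s) : Measurable g := by
  refine measurable_of_closedBall fun c r => ?_
  obtain ⟨D, hDc, hD⟩ := TopologicalSpace.exists_countable_dense S
  rcases lt_or_ge r 0 with hr | hr
  · simp [Metric.closedBall_eq_empty.2 hr]
  have e : g ⁻¹' Metric.closedBall c r = ⋂ s ∈ D, {x | |g x s - c s| ≤ r} := by
    ext x
    simp only [Set.mem_preimage, Metric.mem_closedBall, Set.mem_iInter, Set.mem_ofPred_eq]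
    rw [ContinuousMap.dist_le hr]
    simp only [Real.dist_eq]
    constructor
    · intro hx s _; exact hx s
    · intro hx s
      have hcl : IsClosed {s : S | |g x s - c s| ≤ r} :=
        isClosed_le (by fun_prop) continuous_const
      exact (hcl.closure_subset_iff.2 fun v hv => hx v hv) (hD s)
  rw [e]
  refine MeasurableSet.biInter hDc fun s _ => ?_
  exact measurableSet_le (by have := h s; fun_prop) measurable_const

end Measurability

/-! ### Moments of sums of independent vectors and laws of large numbers in mean -/

section Moments

variable {W H : Type*} [MeasurableSpace W] {μ : Measure W} [IsProbabilityMeasure μ]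
  [NormedAddCommGroup H] [InnerProductSpace ℝ H] [CompleteSpace H]
  [TopologicalSpace.SeparableSpace H] [MeasurableSpace H] [BorelSpace H]

lemma integrable_of_norm_le {F : Type*} [NormedAddCommGroup F] {X : W → F}
    (hX : AEStronglyMeasurable X μ) {C : ℝ} (hC : ∀ w, ‖X w‖ ≤ C) : Integrable X μ :=
  Integrable.of_bound hX C (ae_of_all _ hC)

/-- In the expansion of `‖S + ξ‖ ^ 4` the terms linear in `ξ` integrate to zero by independence and
centering. The others are at most `8 M² ‖S‖² + 3 M⁴` beyond `‖S‖ ^ 4`. The second moment feeds this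
recursion, so both bounds are proved together, and `4 n² + 8 n + 3 ≤ 4 (n + 1)²` closes it. -/
lemma integral_norm_sum_pow_le {ξ : ℕ → W → H} {M : ℝ} (hm : ∀ i, Measurable (ξ i))
    (hi : iIndepFun ξ μ) (h0 : ∀ i, ∫ w, ξ i w ∂μ = 0) (hb : ∀ i w, ‖ξ i w‖ ≤ M) (n : ℕ) :
    ∫ w, ‖∑ i ∈ Finset.range n, ξ i w‖ ^ 2 ∂μ ≤ n * M ^ 2 ∧
    ∫ w, ‖∑ i ∈ Finset.range n, ξ i w‖ ^ 4 ∂μ ≤ 4 * n ^ 2 * M ^ 4 := by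
  induction n with
  | zero => simp
  | succ n ih =>
    have hM : 0 ≤ M := by
      have : Nonempty W := nonempty_of_isProbabilityMeasure μ
      exact (norm_nonneg _).trans (hb 0 this.some)
    set S : W → H := fun w => ∑ i ∈ Finset.range n, ξ i w with hS
    have mS : Measurable S := Finset.measurable_sum _ fun i _ => hm i
    have bS : ∀ w, ‖S w‖ ≤ n * M := fun w => by
      refine (norm_sum_le _ _).trans ((Finset.sum_le_sum fun i _ => hb i w).trans ?_)
      simp
    have hind : IndepFun S (ξ n) μ := by
      have := hi.indepFun_finsetSum_of_notMem hm (s := Finset.range n) (i := n) (by simp)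
      have e : ∑ j ∈ Finset.range n, ξ j = S := by ext w; simp [hS]
      rwa [e] at this
    have iξ : Integrable (ξ n) μ := integrable_of_norm_le (hm n).aestronglyMeasurable (hb n)
    have iS : Integrable S μ := integrable_of_norm_le mS.aestronglyMeasurable bS
    have i2 : Integrable (fun w => ‖S w‖ ^ 2) μ :=
      integrable_of_norm_le (C := (n * M) ^ 2) (by fun_prop) fun w => by
        rw [norm_pow, norm_norm]; exact pow_le_pow_left₀ (norm_nonneg _) (bS w) 2
    have i4 : Integrable (fun w => ‖S w‖ ^ 4) μ :=
      integrable_of_norm_le (C := (n * M) ^ 4) (by fun_prop) fun w => by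
        rw [norm_pow, norm_norm]; exact pow_le_pow_left₀ (norm_nonneg _) (bS w) 4
    have z1 : ∫ w, inner ℝ (S w) (ξ n w) ∂μ = 0 := by
      have := hind.integral_bilin iS iξ (innerSL ℝ)
      rw [h0 n, map_zero] at this
      exact this
    -- As a function of `S` this vector is independent of the next summand, which turns the cubic
    -- cross term into an inner product of independent vectors.
    have m3 : Measurable fun w => ‖S w‖ ^ 2 • S w := by fun_prop
    have iS3 : Integrable (fun w => ‖S w‖ ^ 2 • S w) μ :=
      integrable_of_norm_le (C := (n * M) ^ 2 * (n * M)) m3.aestronglyMeasurable fun w => by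
        rw [norm_smul, norm_pow, norm_norm]
        have := bS w
        gcongr
    have z3 : ∫ w, inner ℝ (‖S w‖ ^ 2 • S w) (ξ n w) ∂μ = 0 := by
      have h := hind.comp (φ := fun s : H => ‖s‖ ^ 2 • s) (ψ := id) (by fun_prop) measurable_id
      have := h.integral_bilin iS3 iξ (innerSL ℝ)
      simp only [Function.comp_def, id, h0 n, map_zero] at this
      exact this
    have ii1 : Integrable (fun w => inner ℝ (S w) (ξ n w)) μ :=
      integrable_of_norm_le (C := n * M * M) ((mS.inner (hm n)).aestronglyMeasurable) fun w => by
        refine (norm_inner_le_norm _ _).trans ?_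
        have := bS w
        have := hb n w
        gcongr
    have ii3 : Integrable (fun w => inner ℝ (‖S w‖ ^ 2 • S w) (ξ n w)) μ :=
      integrable_of_norm_le (C := (n * M) ^ 2 * (n * M) * M)
        ((m3.inner (hm n)).aestronglyMeasurable) fun w => by
        refine (norm_inner_le_norm _ _).trans ?_
        rw [norm_smul, norm_pow, norm_norm]
        have := bS w
        have := hb n w
        gcongr
    have hsq : ∀ w, ‖S w + ξ n w‖ ^ 2 = ‖S w‖ ^ 2 + 2 * inner ℝ (S w) (ξ n w) + ‖ξ n w‖ ^ 2 :=
      fun w => norm_add_sq_real _ _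
    have hξ2 : ∀ w, ‖ξ n w‖ ^ 2 ≤ M ^ 2 := fun w => pow_le_pow_left₀ (norm_nonneg _) (hb n w) 2
    simp_rw [Finset.sum_range_succ]
    change ∫ w, ‖S w + ξ n w‖ ^ 2 ∂μ ≤ _ ∧ ∫ w, ‖S w + ξ n w‖ ^ 4 ∂μ ≤ _
    have bSn : ∀ w, ‖S w + ξ n w‖ ≤ n * M + M := fun w =>
      (norm_add_le _ _).trans (add_le_add (bS w) (hb n w))
    have mSn : Measurable fun w => ‖S w + ξ n w‖ := (mS.add (hm n)).norm
    constructor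
    · calc ∫ w, ‖S w + ξ n w‖ ^ 2 ∂μ
          ≤ ∫ w, ((‖S w‖ ^ 2 + 2 * inner ℝ (S w) (ξ n w)) + M ^ 2) ∂μ := by
            refine integral_mono ?_ (by fun_prop) fun w => ?_
            · exact integrable_of_norm_le (C := (n * M + M) ^ 2) (by fun_prop) fun w => by
                rw [norm_pow, norm_norm]; exact pow_le_pow_left₀ (norm_nonneg _) (bSn w) 2
            · simp only [hsq]; linarith [hξ2 w]
        _ = ∫ w, ‖S w‖ ^ 2 ∂μ + M ^ 2 := by
            rw [integral_add (by fun_prop) (by fun_prop), integral_add i2 (by fun_prop),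
              integral_const_mul, z1]
            simp
        _ ≤ _ := by push_cast; linarith [ih.1]
    · calc ∫ w, ‖S w + ξ n w‖ ^ 4 ∂μ
          ≤ ∫ w, (‖S w‖ ^ 4 + 4 * inner ℝ (‖S w‖ ^ 2 • S w) (ξ n w) +
              (8 * M ^ 2 * ‖S w‖ ^ 2 + 3 * M ^ 4)) ∂μ := by
            refine integral_mono ?_ (by fun_prop) fun w => ?_
            · exact integrable_of_norm_le (C := (n * M + M) ^ 4) (by fun_prop) fun w => by
                rw [norm_pow, norm_norm]; exact pow_le_pow_left₀ (norm_nonneg _) (bSn w) 4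
            · have e4 : ‖S w + ξ n w‖ ^ 4 = (‖S w + ξ n w‖ ^ 2) ^ 2 := by ring
              simp only [e4, hsq, real_inner_smul_left]
              have t1 := abs_real_inner_le_norm (S w) (ξ n w)
              have t2 : |inner ℝ (S w) (ξ n w)| ≤ ‖S w‖ * M :=
                t1.trans (by have := hb n w; gcongr)
              set t := inner ℝ (S w) (ξ n w)
              set s := ‖S w‖
              set y := ‖ξ n w‖ ^ 2
              have hs : 0 ≤ s := norm_nonneg _
              have hy0 : 0 ≤ y := sq_nonneg _
              have hy := hξ2 w
              have t3 : t ^ 2 ≤ s ^ 2 * M ^ 2 := by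
                rw [← mul_pow, ← sq_abs]; exact pow_le_pow_left₀ (abs_nonneg _) t2 2
              have t4 : t * y ≤ s * M * M ^ 2 :=
                (mul_le_mul_of_nonneg_right ((le_abs_self t).trans t2) hy0).trans
                  (by gcongr)
              have t5 : s ^ 2 * y ≤ s ^ 2 * M ^ 2 := by gcongr
              have t6 : y ^ 2 ≤ (M ^ 2) ^ 2 := pow_le_pow_left₀ hy0 hy 2
              have t7 : 2 * (s * M * M ^ 2) ≤ M ^ 4 + M ^ 2 * s ^ 2 := by
                nlinarith [mul_nonneg (sq_nonneg M) (sq_nonneg (s - M))]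
              nlinarith
        _ = ∫ w, ‖S w‖ ^ 4 ∂μ + (8 * M ^ 2 * ∫ w, ‖S w‖ ^ 2 ∂μ + 3 * M ^ 4) := by
            rw [integral_add (by fun_prop) (by fun_prop), integral_add i4 (by fun_prop),
              integral_const_mul, z3, integral_add (by fun_prop) (by fun_prop), integral_const_mul]
            simp
        _ ≤ _ := by
            have h1 := ih.1
            have h2 := ih.2
            have : 8 * M ^ 2 * ∫ w, ‖S w‖ ^ 2 ∂μ ≤ 8 * M ^ 2 * (n * M ^ 2) := by gcongr
            have h3 : 0 ≤ M ^ 4 := by positivity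
            push_cast
            nlinarith

/-- The fourth moment of the deviation of a mean of independent bounded vectors. -/
lemma integral_norm_mean_sub_pow_four_le {ξ : ℕ → W → H} {M : ℝ} (hm : ∀ i, Measurable (ξ i))
    (hi : iIndepFun ξ μ) {g : H} (h0 : ∀ i, ∫ w, ξ i w ∂μ = g) (hb : ∀ i w, ‖ξ i w‖ ≤ M)
    {n : ℕ} (hn : 0 < n) :
    ∫ w, ‖(n : ℝ)⁻¹ • (∑ i ∈ Finset.range n, ξ i w) - g‖ ^ 4 ∂μ ≤ 64 * M ^ 4 / n ^ 2 := by
  have hg : ‖g‖ ≤ M := by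
    rw [← h0 0]
    refine (norm_integral_le_of_norm_le_const (ae_of_all _ (hb 0))).trans ?_
    simp
  have h := (integral_norm_sum_pow_le (μ := μ) (ξ := fun i w => ξ i w - g) (M := 2 * M)
    (fun i => (hm i).sub_const g)
    (hi.comp (fun _ x => x - g) fun _ => by fun_prop) (fun i => ?_) (fun i w => ?_) n).2
  · have e : ∀ w, ‖(n : ℝ)⁻¹ • (∑ i ∈ Finset.range n, ξ i w) - g‖ ^ 4 =
        ((n : ℝ)⁻¹) ^ 4 * ‖∑ i ∈ Finset.range n, (ξ i w - g)‖ ^ 4 := fun w => by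
      rw [← mul_pow]
      congr 1
      have : (0 : ℝ) < n := by exact_mod_cast hn
      rw [Finset.sum_sub_distrib, Finset.sum_const, Finset.card_range, ← Nat.cast_smul_eq_nsmul ℝ]
      rw [← Real.norm_of_nonneg (show (0 : ℝ) ≤ (n : ℝ)⁻¹ by positivity), ← norm_smul, smul_sub,
        smul_smul]
      simp [this.ne']
    simp_rw [e]
    rw [integral_const_mul]
    calc ((n : ℝ)⁻¹) ^ 4 * _ ≤ ((n : ℝ)⁻¹) ^ 4 * (4 * n ^ 2 * (2 * M) ^ 4) := by gcongr
      _ = _ := by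
        have : (n : ℝ) ≠ 0 := by positivity
        field_simp; ring
  · rw [integral_sub (integrable_of_norm_le (hm i).aestronglyMeasurable (hb i))
      (integrable_const _), h0 i]
    simp
  · exact (norm_sub_le _ _).trans (by linarith [hb i w])

/-- The law of large numbers in mean for independent bounded vectors in a Banach space. -/
lemma tendsto_integral_norm_mean_sub {F : Type*} [NormedAddCommGroup F] [NormedSpace ℝ F]
    [CompleteSpace F] [MeasurableSpace F] [BorelSpace F] {ξ : ℕ → W → F} {M : ℝ}
    (hm : ∀ i, StronglyMeasurable (ξ i)) (hi : iIndepFun ξ μ)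
    (hid : ∀ i, IdentDistrib (ξ i) (ξ 0) μ μ) (hb : ∀ i w, ‖ξ i w‖ ≤ M) :
    Tendsto (fun n : ℕ => ∫ w, ‖(n : ℝ)⁻¹ • (∑ i ∈ Finset.range n, ξ i w) - μ[ξ 0]‖ ∂μ) atTop
      (𝓝 0) := by
  have hM : 0 ≤ M := by
    have : Nonempty W := nonempty_of_isProbabilityMeasure μ
    exact (norm_nonneg _).trans (hb 0 this.some)
  have hlln := strong_law_ae ξ (integrable_of_norm_le (hm 0).aestronglyMeasurable (hb 0))
    (fun i j hij => hi.indepFun hij) hid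
  have hg : ‖μ[ξ 0]‖ ≤ M := by
    refine (norm_integral_le_of_norm_le_const (ae_of_all _ (hb 0))).trans ?_
    simp
  have := tendsto_integral_of_dominated_convergence (μ := μ)
    (F := fun (n : ℕ) w => ‖(n : ℝ)⁻¹ • (∑ i ∈ Finset.range n, ξ i w) - μ[ξ 0]‖) (f := fun _ => 0)
    (fun _ => M + M) (fun n => ?_) (integrable_const _) (fun n => ae_of_all _ fun w => ?_) ?_
  · simpa using this
  · refine AEStronglyMeasurable.norm (AEStronglyMeasurable.sub ?_ aestronglyMeasurable_const)
    refine AEStronglyMeasurable.const_smul ?_ _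
    exact (Finset.stronglyMeasurable_fun_sum _ fun i _ => hm i).aestronglyMeasurable
  · rw [norm_norm]
    refine (norm_sub_le _ _).trans (add_le_add ?_ hg)
    rw [norm_smul]
    rcases Nat.eq_zero_or_pos n with rfl | hn
    · simpa using hM
    have : (0 : ℝ) < n := by exact_mod_cast hn
    calc ‖(n : ℝ)⁻¹‖ * ‖∑ i ∈ Finset.range n, ξ i w‖ ≤ (n : ℝ)⁻¹ * (n * M) := by
          rw [Real.norm_of_nonneg (by positivity)]
          gcongr
          refine (norm_sum_le _ _).trans ((Finset.sum_le_sum fun i _ => hb i w).trans ?_)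
          simp
      _ = M := by field_simp
  · filter_upwards [hlln] with w hw
    exact tendsto_iff_norm_sub_tendsto_zero.1 hw

end Moments

/-! ### Consistency of kernel unconstrained least-squares importance fitting -/

section Quad

variable {H : Type*} [NormedAddCommGroup H] [InnerProductSpace ℝ H]

/-- The quadratic form of an operator at `v`, as a functional of the operator. -/
noncomputable def quadAt (v : H) : (H →L[ℝ] H) →L[ℝ] ℝ :=
  (innerSL ℝ v).comp (ContinuousLinearMap.apply ℝ H v)

lemma quadAt_apply (v : H) (T : H →L[ℝ] H) : quadAt v T = inner ℝ v (T v) := rfl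

lemma abs_quadAt_le (v : H) (T : H →L[ℝ] H) : |quadAt v T| ≤ ‖T‖ * ‖v‖ ^ 2 := by
  rw [quadAt_apply]
  refine (abs_real_inner_le_norm _ _).trans ?_
  calc ‖v‖ * ‖T v‖ ≤ ‖v‖ * (‖T‖ * ‖v‖) := by gcongr; exact T.le_opNorm v
    _ = _ := by ring

lemma continuous_rankOne_self :
    Continuous fun v : H => (InnerProductSpace.rankOne ℝ v v : H →L[ℝ] H) := by
  have h : Continuous fun v : H => InnerProductSpace.rankOne ℝ (F := H) v :=
    (InnerProductSpace.rankOne ℝ (E := H) (F := H)).continuous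
  exact h.clm_apply continuous_id

/-- The norm of a mean of bounded vectors. -/
lemma norm_mean_le {F : Type*} [NormedAddCommGroup F] [NormedSpace ℝ F] {M : ℝ} {ξ : ℕ → F}
    (h : ∀ i, ‖ξ i‖ ≤ M) (n : ℕ) : ‖(n : ℝ)⁻¹ • ∑ i ∈ Finset.range n, ξ i‖ ≤ M := by
  have hM : 0 ≤ M := (norm_nonneg _).trans (h 0)
  rw [norm_smul]
  rcases Nat.eq_zero_or_pos n with rfl | hn
  · simpa using hM
  have : (0 : ℝ) < n := by exact_mod_cast hn
  calc ‖(n : ℝ)⁻¹‖ * ‖∑ i ∈ Finset.range n, ξ i‖ ≤ (n : ℝ)⁻¹ * (n * M) := by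
        rw [Real.norm_of_nonneg (by positivity)]
        gcongr
        refine (norm_sum_le _ _).trans ((Finset.sum_le_sum fun i _ => h i).trans ?_)
        simp
    _ = M := by field_simp

lemma measurable_norm_mean_sub {W F : Type*} [MeasurableSpace W] [NormedAddCommGroup F]
    [NormedSpace ℝ F] {ξ : ℕ → W → F} (hm : ∀ i, StronglyMeasurable (ξ i)) (g : F) (n : ℕ) :
    Measurable fun w => ‖(n : ℝ)⁻¹ • (∑ i ∈ Finset.range n, ξ i w) - g‖ :=
  (((Finset.stronglyMeasurable_fun_sum _ fun i _ => hm i).const_smul _).sub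
    stronglyMeasurable_const).norm.measurable

/-- The first order condition for the uLSIF objective. -/
lemma ulsifObj_first_order {X : Type*} [RKHS ℝ H X ℝ] {lam : ℝ} {n m : ℕ} {xs : Fin n → X}
    {xt : Fin m → X} {u : H}
    (h : IsMinOn (ulsifObj (H := H) lam xs xt) Set.univ u) (v : H) :
    (∑ i, u (xs i) * v (xs i)) / n - (∑ i, v (xt i)) / m + lam * inner ℝ u v = 0 := by
  set A := (∑ i, u (xs i) * v (xs i)) / n - (∑ i, v (xt i)) / m + lam * inner ℝ u v with hA
  set B := (∑ i, v (xs i) ^ 2) / (2 * n) + lam / 2 * ‖v‖ ^ 2 with hB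
  -- Along the line `u + s • v` the objective exceeds its minimum by `s * A + s ^ 2 * B`.
  have key : ∀ s : ℝ, 0 ≤ s * A + s ^ 2 * B := by
    intro s
    have h1 := isMinOn_iff.1 h (u + s • v) (Set.mem_univ _)
    have e1 : ∑ i, (u + s • v) (xs i) ^ 2 = ∑ i, u (xs i) ^ 2 +
        2 * s * ∑ i, u (xs i) * v (xs i) + s ^ 2 * ∑ i, v (xs i) ^ 2 := by
      rw [Finset.mul_sum, Finset.mul_sum, ← Finset.sum_add_distrib, ← Finset.sum_add_distrib]
      refine Finset.sum_congr rfl fun i _ => ?_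
      simp only [RKHS.coe_add, RKHS.coe_smul, Pi.add_apply, Pi.smul_apply, smul_eq_mul]
      ring
    have e2 : ∑ i, (u + s • v) (xt i) = ∑ i, u (xt i) + s * ∑ i, v (xt i) := by
      rw [Finset.mul_sum, ← Finset.sum_add_distrib]
      refine Finset.sum_congr rfl fun i _ => ?_
      simp only [RKHS.coe_add, RKHS.coe_smul, Pi.add_apply, Pi.smul_apply, smul_eq_mul]
    have e3 : ‖u + s • v‖ ^ 2 = ‖u‖ ^ 2 + 2 * s * inner ℝ u v + s ^ 2 * ‖v‖ ^ 2 := by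
      rw [norm_add_sq_real, real_inner_smul_right, norm_smul, mul_pow, Real.norm_eq_abs, sq_abs]
      ring
    simp only [ulsifObj, e1, e2, e3] at h1
    have e4 : s * A + s ^ 2 * B = ((∑ i, u (xs i) ^ 2 +
        2 * s * ∑ i, u (xs i) * v (xs i) + s ^ 2 * ∑ i, v (xs i) ^ 2) / (2 * n) -
        (∑ i, u (xt i) + s * ∑ i, v (xt i)) / m +
        lam / 2 * (‖u‖ ^ 2 + 2 * s * inner ℝ u v + s ^ 2 * ‖v‖ ^ 2)) -
        ((∑ i, u (xs i) ^ 2) / (2 * n) - (∑ i, u (xt i)) / m + lam / 2 * ‖u‖ ^ 2) := by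
      rw [hA, hB]
      rcases Nat.eq_zero_or_pos n with rfl | hn
      · simp; ring
      · field_simp; ring
    rw [e4]
    linarith
  by_contra hne
  have hB0 : 0 ≤ B := by have := key 1; have := key (-1); linarith
  -- A step against the slope; `B + 1` in place of `B` avoids a vanishing denominator.
  have h2 := key (-A / (B + 1))
  have : (-A / (B + 1)) * A + (-A / (B + 1)) ^ 2 * B = -(A ^ 2 / (B + 1) ^ 2) := by
    field_simp; ring
  rw [this] at h2
  have : 0 < A ^ 2 / (B + 1) ^ 2 := by positivity
  linarith

end Quad

section Ulsif

variable {X H : Type*} [NormedAddCommGroup H] [InnerProductSpace ℝ H] [CompleteSpace H]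
  [RKHS ℝ H X ℝ]

/-- The kernel function at `x`, representing the evaluation at `x`. -/
noncomputable def kfun (H : Type*) [NormedAddCommGroup H] [InnerProductSpace ℝ H]
    [CompleteSpace H] [RKHS ℝ H X ℝ] (x : X) : H := RKHS.kerFun H x 1

lemma inner_kfun (u : H) (x : X) : inner ℝ u (kfun H x) = u x := by
  rw [kfun, RKHS.inner_kerFun]
  simp

lemma abs_apply_le {b : ℝ} (hb : ∀ x, ‖kfun H x‖ ≤ b) (u : H) (x : X) : |u x| ≤ ‖u‖ * b := by
  rw [← inner_kfun]
  refine (abs_real_inner_le_norm _ _).trans ?_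
  gcongr
  exact hb x

/-- The discrepancy between the empirical embeddings of the target features and of the source
features weighted by `u`. -/
noncomputable def embDiff {n m : ℕ} (u : H) (xs : Fin n → X) (xt : Fin m → X) : H :=
  (m : ℝ)⁻¹ • (∑ i, kfun H (xt i)) - (n : ℝ)⁻¹ • ∑ i, u (xs i) • kfun H (xs i)

lemma inner_embDiff {n m : ℕ} (u v : H) (xs : Fin n → X) (xt : Fin m → X) :
    inner ℝ v (embDiff u xs xt) = (∑ i, v (xt i)) / m - (∑ i, u (xs i) * v (xs i)) / n := by
  rw [embDiff, inner_sub_right, inner_smul_right, inner_smul_right, inner_sum, inner_sum]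
  simp only [inner_kfun, inner_smul_right]
  ring

/-- Testing the first order condition with the error `e` itself bounds the empirical square error
plus `lam ‖e‖²` by `‖e‖ (‖embDiff‖ + lam ‖u‖)`. The second summand on the left controls `‖e‖`, and
inserting this controls the first. The norm error need not be small, but the empirical square error
carries a factor `lam`. -/
lemma ulsif_err {lam : ℝ} (hlam : 0 < lam) {n m : ℕ} {xs : Fin n → X}
    {xt : Fin m → X} {uh : H} (h : IsMinOn (ulsifObj (H := H) lam xs xt) Set.univ uh) (u : H) :
    ‖uh - u‖ ≤ ‖embDiff u xs xt‖ / lam + ‖u‖ ∧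
    (∑ i, (uh - u) (xs i) ^ 2) / n ≤ lam * (‖embDiff u xs xt‖ / lam + ‖u‖) ^ 2 := by
  set e := uh - u with he
  have h1 := ulsifObj_first_order h e
  have e1 : ∑ i, uh (xs i) * e (xs i) = ∑ i, e (xs i) ^ 2 + ∑ i, u (xs i) * e (xs i) := by
    rw [← Finset.sum_add_distrib]
    refine Finset.sum_congr rfl fun i _ => ?_
    simp only [he, RKHS.coe_sub, Pi.sub_apply]
    ring
  have e2 : inner ℝ uh e = ‖e‖ ^ 2 + inner ℝ u e := by
    rw [← real_inner_self_eq_norm_sq, ← inner_add_left, he, sub_add_cancel]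
  have e3 := inner_embDiff u e xs xt
  have e4 := real_inner_le_norm e (embDiff u xs xt)
  have e5 := abs_real_inner_le_norm u e
  have e6 := (abs_le.1 e5).1
  set ξ := ‖embDiff u xs xt‖ with hξ
  have hξ0 : 0 ≤ ξ := norm_nonneg _
  have hs0 : 0 ≤ (∑ i, e (xs i) ^ 2) / n :=
    div_nonneg (Finset.sum_nonneg fun _ _ => sq_nonneg _) (Nat.cast_nonneg _)
  rw [e1, e2, add_div] at h1
  have hmain : (∑ i, e (xs i) ^ 2) / n + lam * ‖e‖ ^ 2 ≤ lam * (ξ / lam + ‖u‖) * ‖e‖ := by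
    have : lam * (ξ / lam + ‖u‖) * ‖e‖ = ‖e‖ * ξ + lam * (‖u‖ * ‖e‖) := by field_simp
    rw [this]
    nlinarith
  have hR : 0 ≤ ξ / lam + ‖u‖ := by positivity
  have hle : ‖e‖ ≤ ξ / lam + ‖u‖ := by
    by_contra hlt
    push Not at hlt
    have hep : 0 < ‖e‖ := hR.trans_lt hlt
    have : lam * (ξ / lam + ‖u‖) * ‖e‖ < lam * ‖e‖ * ‖e‖ := by gcongr
    nlinarith
  refine ⟨hle, ?_⟩
  have : lam * (ξ / lam + ‖u‖) * ‖e‖ ≤ lam * (ξ / lam + ‖u‖) * (ξ / lam + ‖u‖) := by gcongr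
  have : 0 ≤ lam * ‖e‖ ^ 2 := by positivity
  nlinarith

/-- The operator `v ↦ v(x) k_x`. -/
noncomputable def evalOp (H : Type*) [NormedAddCommGroup H] [InnerProductSpace ℝ H]
    [CompleteSpace H] [RKHS ℝ H X ℝ] (x : X) : H →L[ℝ] H :=
  InnerProductSpace.rankOne ℝ (kfun H x) (kfun H x)

lemma quadAt_evalOp (v : H) (x : X) : quadAt v (evalOp H x) = v x ^ 2 := by
  rw [quadAt_apply, evalOp, InnerProductSpace.rankOne_apply, inner_smul_right, real_inner_comm,
    inner_kfun, pow_two]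

lemma norm_evalOp_le {b : ℝ} (hb : ∀ x, ‖kfun H x‖ ≤ b) (x : X) : ‖evalOp H x‖ ≤ b ^ 2 := by
  rw [evalOp, InnerProductSpace.norm_rankOne, pow_two]
  have := hb x
  have := (norm_nonneg _).trans this
  gcongr

variable [MeasurableSpace X]

lemma lintegral_enorm_pow_four {ν : Measure X} [IsProbabilityMeasure ν] {g : X → ℝ}
    (hg : Measurable g) {C : ℝ} (hC : ∀ x, |g x| ≤ C) :
    ∫⁻ x, ‖g x‖ₑ ^ 4 ∂ν = ENNReal.ofReal (∫ x, g x ^ 4 ∂ν) := by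
  rw [ofReal_integral_eq_lintegral_ofReal]
  · refine lintegral_congr fun x => ?_
    rw [Real.enorm_eq_ofReal_abs, ← ENNReal.ofReal_pow (abs_nonneg _), Even.pow_abs (by decide)]
  · exact integrable_of_norm_le (C := C ^ 4) (by fun_prop) fun x => by
      rw [norm_pow]; exact pow_le_pow_left₀ (norm_nonneg _) (hC x) 4
  · exact ae_of_all _ fun x => Even.pow_nonneg (by decide) _

/-- The fourth moment is at most the squared supremum times the second moment. The reproducing
property bounds the supremum by `b` times the norm error; `hΓ` bounds the second moment by the
empirical one. -/
lemma lintegral_ulsif_err_le {ν : Measure X} [IsProbabilityMeasure ν]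
    (hH : ∀ u : H, Measurable fun x => u x) {b : ℝ} (hb : ∀ x, ‖kfun H x‖ ≤ b)
    {lam : ℝ} (hlam : 0 < lam) {n m : ℕ} {xs : Fin n → X}
    {xt : Fin m → X} {uh : H} (h : IsMinOn (ulsifObj (H := H) lam xs xt) Set.univ uh) (u : H)
    {Γ : ℝ} (hΓ : ∀ v : H, ∫ x, v x ^ 2 ∂ν ≤ (∑ i, v (xs i) ^ 2) / n + Γ * ‖v‖ ^ 2)
    (hΓ0 : 0 ≤ Γ) :
    ∫⁻ x, ‖uh x - u x‖ₑ ^ 4 ∂ν ≤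
      ENNReal.ofReal (b ^ 2 * (lam + Γ) * (‖embDiff u xs xt‖ / lam + ‖u‖) ^ 4) := by
  obtain ⟨h1, h2⟩ := ulsif_err hlam h u
  set e := uh - u with he
  set R := ‖embDiff u xs xt‖ / lam + ‖u‖ with hR
  have e1 : ∀ x, uh x - u x = e x := fun x => by simp [he]
  have hbd := abs_apply_le hb e
  simp_rw [e1]
  rw [lintegral_enorm_pow_four (hH e) hbd]
  apply ENNReal.ofReal_le_ofReal
  have i2 : Integrable (fun x => e x ^ 2) ν :=
    integrable_of_norm_le (C := (‖e‖ * b) ^ 2) ((hH e).pow_const 2).aestronglyMeasurable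
      fun x => by rw [norm_pow]; exact pow_le_pow_left₀ (norm_nonneg _) (hbd x) 2
  have hsq : ∀ x, e x ^ 2 ≤ b ^ 2 * R ^ 2 := fun x => by
    rw [← sq_abs, ← mul_pow, mul_comm b]
    have hb0 : 0 ≤ b := (norm_nonneg _).trans (hb x)
    exact pow_le_pow_left₀ (abs_nonneg _) ((hbd x).trans (by gcongr)) 2
  calc ∫ x, e x ^ 4 ∂ν ≤ ∫ x, b ^ 2 * R ^ 2 * e x ^ 2 ∂ν := by
        refine integral_mono_of_nonneg (ae_of_all _ fun x => Even.pow_nonneg (by decide) _)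
          (i2.const_mul _) (ae_of_all _ fun x => ?_)
        have := hsq x
        calc e x ^ 4 = e x ^ 2 * e x ^ 2 := by ring
          _ ≤ _ := mul_le_mul_of_nonneg_right this (sq_nonneg _)
    _ = b ^ 2 * R ^ 2 * ∫ x, e x ^ 2 ∂ν := integral_const_mul _ _
    _ ≤ b ^ 2 * R ^ 2 * (lam * R ^ 2 + Γ * R ^ 2) := by
        gcongr
        refine (hΓ e).trans (add_le_add h2 ?_)
        exact mul_le_mul_of_nonneg_left (pow_le_pow_left₀ (norm_nonneg _) h1 2) hΓ0
    _ = _ := by ring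

variable [TopologicalSpace.SeparableSpace H]

lemma measurable_kfun [MeasurableSpace H] [BorelSpace H] (hH : ∀ u : H, Measurable fun x => u x) :
    Measurable (kfun H : X → H) :=
  measurable_of_inner fun u => by simpa only [inner_kfun] using hH u

lemma stronglyMeasurable_evalOp (hH : ∀ u : H, Measurable fun x => u x) :
    StronglyMeasurable (evalOp H : X → H →L[ℝ] H) := by
  borelize H
  exact continuous_rankOne_self.comp_stronglyMeasurable (measurable_kfun hH).stronglyMeasurable

variable {W : Type*} [MeasurableSpace W] {μ : Measure W} [IsProbabilityMeasure μ]

/-- A uniform law of large numbers over the continuous linear functionals. -/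
lemma exists_integral_le_mean_add {F : Type*} [NormedAddCommGroup F] [NormedSpace ℝ F]
    [CompleteSpace F] {ν : Measure X} {T : X → F} (mT : StronglyMeasurable T) {C : ℝ}
    (hC : ∀ x, ‖T x‖ ≤ C) {xs : ℕ → W → X} (hxs : ∀ i, Measurable (xs i))
    (hxsν : ∀ i, μ.map (xs i) = ν) (hxsi : iIndepFun xs μ) :
    ∃ Γ : ℕ → W → ℝ, (∀ n, Measurable (Γ n)) ∧ (∀ n w, 0 ≤ Γ n w) ∧ (∀ n w, Γ n w ≤ 2 * C) ∧
      Tendsto (fun n => ∫ w, Γ n w ∂μ) atTop (𝓝 0) ∧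
      ∀ n w (φ : F →L[ℝ] ℝ),
        ∫ x, φ (T x) ∂ν ≤ (∑ i : Fin n, φ (T (xs i w))) / n + Γ n w * ‖φ‖ := by
  borelize F
  have mξ : ∀ i, StronglyMeasurable fun w => T (xs i w) := fun i => mT.comp_measurable (hxs i)
  have i0 : Integrable (fun w => T (xs 0 w)) μ :=
    integrable_of_norm_le (mξ 0).aestronglyMeasurable fun w => hC _
  have hg : ‖∫ w, T (xs 0 w) ∂μ‖ ≤ C := by
    refine (norm_integral_le_of_norm_le_const (ae_of_all _ fun w => hC _)).trans ?_
    simp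
  -- The norm of the deviation of the mean vector serves all functionals at once, including ones
  -- chosen from the same sample.
  refine ⟨fun n w => ‖(n : ℝ)⁻¹ • (∑ i ∈ Finset.range n, T (xs i w)) - ∫ w, T (xs 0 w) ∂μ‖,
    fun n => measurable_norm_mean_sub mξ _ n, fun n w => norm_nonneg _, fun n w => ?_, ?_,
    fun n w φ => ?_⟩
  · exact (norm_sub_le _ _).trans (by linarith [norm_mean_le (fun i => hC (xs i w)) n])
  · refine tendsto_integral_norm_mean_sub mξ (hxsi.comp (fun _ => T) fun _ => mT.measurable) ?_
      fun i w => hC _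
    intro i
    have : IdentDistrib (xs i) (xs 0) μ μ :=
      ⟨(hxs i).aemeasurable, (hxs 0).aemeasurable, by rw [hxsν, hxsν]⟩
    exact this.comp mT.measurable
  · have e1 : φ (∫ w, T (xs 0 w) ∂μ) = ∫ x, φ (T x) ∂ν := by
      rw [← φ.integral_comp_comm i0, ← hxsν 0, integral_map (hxs 0).aemeasurable
        (φ.continuous.comp_stronglyMeasurable mT).aestronglyMeasurable]
    have e2 : φ ((n : ℝ)⁻¹ • (∑ i ∈ Finset.range n, T (xs i w))) =
        (∑ i : Fin n, φ (T (xs i w))) / n := by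
      rw [map_smul, map_sum, Finset.sum_range, smul_eq_mul, div_eq_inv_mul]
    have e3 := φ.le_opNorm
      ((n : ℝ)⁻¹ • (∑ i ∈ Finset.range n, T (xs i w)) - ∫ w, T (xs 0 w) ∂μ)
    rw [map_sub, e1, e2, Real.norm_eq_abs] at e3
    have := (abs_le.1 e3).1
    linarith

/-- The second moment of `v` is bounded by the empirical one, up to the error of the empirical
covariance operator. -/
lemma exists_quad_le {ν : Measure X} (hH : ∀ u : H, Measurable fun x => u x) {b : ℝ}
    (hb : ∀ x, ‖kfun H x‖ ≤ b) {xs : ℕ → W → X} (hxs : ∀ i, Measurable (xs i))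
    (hxsν : ∀ i, μ.map (xs i) = ν) (hxsi : iIndepFun xs μ) :
    ∃ Γ : ℕ → W → ℝ, (∀ n, Measurable (Γ n)) ∧ (∀ n w, 0 ≤ Γ n w) ∧ (∀ n w, Γ n w ≤ 2 * b ^ 2) ∧
      Tendsto (fun n => ∫ w, Γ n w ∂μ) atTop (𝓝 0) ∧
      ∀ n w (v : H), ∫ x, v x ^ 2 ∂ν ≤ (∑ i : Fin n, v (xs i w) ^ 2) / n + Γ n w * ‖v‖ ^ 2 := by
  obtain ⟨Γ, mΓ, hΓ0, hΓb, hΓlim, hφ⟩ := exists_integral_le_mean_add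
    (stronglyMeasurable_evalOp hH) (fun x => norm_evalOp_le hb x) hxs hxsν hxsi
  refine ⟨Γ, mΓ, hΓ0, hΓb, hΓlim, fun n w v => ?_⟩
  have h1 := hφ n w (quadAt v)
  simp only [quadAt_evalOp] at h1
  have h2 : ‖quadAt v‖ ≤ ‖v‖ ^ 2 := ContinuousLinearMap.opNorm_le_bound _ (sq_nonneg _) fun T => by
    rw [mul_comm]; exact abs_quadAt_le v T
  exact h1.trans (add_le_add le_rfl (mul_le_mul_of_nonneg_left h2 (hΓ0 n w)))

lemma integral_norm_sub_pow_four_le {F : Type*} [NormedAddCommGroup F]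
    [TopologicalSpace.SeparableSpace F] [MeasurableSpace F] [BorelSpace F] {P Q : W → F} {M : ℝ}
    (mP : Measurable P) (mQ : Measurable Q) (hP : ∀ w, ‖P w‖ ≤ M) (hQ : ∀ w, ‖Q w‖ ≤ M) :
    Integrable (fun w => ‖P w - Q w‖ ^ 4) μ ∧
    ∫ w, ‖P w - Q w‖ ^ 4 ∂μ ≤ 8 * (∫ w, ‖P w‖ ^ 4 ∂μ + ∫ w, ‖Q w‖ ^ 4 ∂μ) := by
  have i4 : ∀ {R : W → F}, Measurable R → (∀ w, ‖R w‖ ≤ M) →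
      Integrable (fun w => ‖R w‖ ^ 4) μ := fun mR hR =>
    integrable_of_norm_le (C := M ^ 4) (by fun_prop) fun w => by
      rw [norm_pow, norm_norm]; exact pow_le_pow_left₀ (norm_nonneg _) (hR w) 4
  have hPQ : ∀ w, ‖P w - Q w‖ ^ 4 ≤ 8 * (‖P w‖ ^ 4 + ‖Q w‖ ^ 4) := fun w => by
    refine (pow_le_pow_left₀ (norm_nonneg _) (norm_sub_le _ _) 4).trans ?_
    refine (add_pow_le (norm_nonneg _) (norm_nonneg _) 4).trans ?_
    norm_num
  have iD : Integrable (fun w => ‖P w - Q w‖ ^ 4) μ := by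
    refine (((i4 mP hP).add (i4 mQ hQ)).const_mul 8).mono'
      ((mP.sub mQ).norm.pow_const 4).aestronglyMeasurable (ae_of_all _ fun w => ?_)
    rw [Real.norm_of_nonneg (Even.pow_nonneg (by decide) _)]
    exact hPQ w
  refine ⟨iD, (integral_mono iD (((i4 mP hP).add (i4 mQ hQ)).const_mul 8) hPQ).trans ?_⟩
  rw [integral_const_mul]
  exact (congrArg _ (integral_add (i4 mP hP) (i4 mQ hQ))).le

/-- The fourth moment of the discrepancy of the embeddings. -/
lemma integral_embDiff_pow_four_le {ν ρ : Measure X}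
    (hH : ∀ u : H, Measurable fun x => u x) {b : ℝ} (hb : ∀ x, ‖kfun H x‖ ≤ b) (u : H)
    (hu : ∫ x, kfun H x ∂ρ = ∫ x, u x • kfun H x ∂ν)
    {xs xt : ℕ → W → X} (hxs : ∀ i, Measurable (xs i)) (hxt : ∀ i, Measurable (xt i))
    (hxsν : ∀ i, μ.map (xs i) = ν) (hxtρ : ∀ i, μ.map (xt i) = ρ)
    (hxsi : iIndepFun xs μ) (hxti : iIndepFun xt μ) :
    ∃ C : ℝ, ∀ n m : ℕ, 0 < n → 0 < m →
      Integrable (fun w => ‖embDiff u (fun k : Fin n => xs k w) (fun k : Fin m => xt k w)‖ ^ 4) μ ∧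
      ∫ w, ‖embDiff u (fun k : Fin n => xs k w) (fun k : Fin m => xt k w)‖ ^ 4 ∂μ ≤
        C / ((min n m : ℕ) : ℝ) ^ 2 := by
  borelize H
  have hb0 : 0 ≤ b := by
    have : Nonempty W := nonempty_of_isProbabilityMeasure μ
    exact (norm_nonneg _).trans (hb (xs 0 this.some))
  have mk := measurable_kfun hH
  set M := b + ‖u‖ * b * b with hM
  have hM1 : ∀ i w, ‖kfun H (xt i w)‖ ≤ M := fun i w =>
    (hb _).trans (le_add_of_nonneg_right (by positivity))
  have hM2 : ∀ i w, ‖u (xs i w) • kfun H (xs i w)‖ ≤ M := fun i w => by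
    rw [norm_smul]
    have h1 := abs_apply_le hb u (xs i w)
    have h2 := hb (xs i w)
    calc ‖u (xs i w)‖ * ‖kfun H (xs i w)‖ ≤ (‖u‖ * b) * b := by
          rw [Real.norm_eq_abs]; gcongr
      _ ≤ M := by linarith
  have muk : Measurable fun x => u x • kfun H x := (hH u).smul mk
  have m1 : ∀ i, Measurable fun w => kfun H (xt i w) := fun i => mk.comp (hxt i)
  have m2 : ∀ i, Measurable fun w => u (xs i w) • kfun H (xs i w) := fun i => muk.comp (hxs i)
  set g := ∫ x, kfun H x ∂ρ with hg
  refine ⟨1024 * M ^ 4, fun n m hn hm => ?_⟩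
  -- By `hu` both empirical embeddings have the mean `g`, so the discrepancy is a difference of two
  -- centered means.
  set P : W → H := fun w => (m : ℝ)⁻¹ • (∑ i ∈ Finset.range m, kfun H (xt i w)) - g with hP
  set Q : W → H := fun w =>
    (n : ℝ)⁻¹ • (∑ i ∈ Finset.range n, u (xs i w) • kfun H (xs i w)) - g with hQ
  have mP : Measurable P := ((Finset.measurable_sum _ fun i _ => m1 i).const_smul _).sub_const _
  have mQ : Measurable Q := ((Finset.measurable_sum _ fun i _ => m2 i).const_smul _).sub_const _
  have bP : ∫ w, ‖P w‖ ^ 4 ∂μ ≤ 64 * M ^ 4 / m ^ 2 :=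
    integral_norm_mean_sub_pow_four_le m1 (hxti.comp (fun _ => kfun H) fun _ => mk)
      (fun i => by
        rw [hg, ← hxtρ i, integral_map (hxt i).aemeasurable mk.aestronglyMeasurable]) hM1 hm
  have bQ : ∫ w, ‖Q w‖ ^ 4 ∂μ ≤ 64 * M ^ 4 / n ^ 2 :=
    integral_norm_mean_sub_pow_four_le m2
      (hxsi.comp (fun _ x => u x • kfun H x) fun _ => muk)
      (fun i => by
        rw [hu, ← hxsν i, integral_map (hxs i).aemeasurable muk.aestronglyMeasurable]) hM2 hn
  have e1 : ∀ w, embDiff u (fun k : Fin n => xs k w) (fun k : Fin m => xt k w) = P w - Q w := by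
    intro w
    rw [embDiff, hP, hQ]
    simp only
    rw [Finset.sum_range, Finset.sum_range]
    abel
  simp only [e1]
  obtain ⟨iD, hD⟩ := integral_norm_sub_pow_four_le (μ := μ) (M := M + ‖g‖) mP mQ
    (fun w => (norm_sub_le _ _).trans (add_le_add (norm_mean_le (fun i => hM1 i w) m) le_rfl))
    (fun w => (norm_sub_le _ _).trans (add_le_add (norm_mean_le (fun i => hM2 i w) n) le_rfl))
  refine ⟨iD, hD.trans ?_⟩
  have hmin' : (0 : ℝ) < (min n m : ℕ) := by exact_mod_cast lt_min hn hm
  have c1 : ((min n m : ℕ) : ℝ) ≤ n := by exact_mod_cast min_le_left n m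
  have c2 : ((min n m : ℕ) : ℝ) ≤ m := by exact_mod_cast min_le_right n m
  have hM4 : 0 ≤ M ^ 4 := by positivity
  calc 8 * (∫ w, ‖P w‖ ^ 4 ∂μ + ∫ w, ‖Q w‖ ^ 4 ∂μ)
      ≤ 8 * (64 * M ^ 4 / (min n m : ℕ) ^ 2 + 64 * M ^ 4 / (min n m : ℕ) ^ 2) := by
        refine mul_le_mul_of_nonneg_left (add_le_add (bP.trans ?_) (bQ.trans ?_)) (by norm_num)
        · gcongr
        · gcongr
    _ = _ := by ring

/-- A bound on the mean of a right-hand side of the form `b² (l + Γ) (D / l + U)⁴`. -/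
lemma lintegral_err_bound_le {b l U : ℝ} (hl : 0 < l) (hU : 0 ≤ U) {Γ D : W → ℝ}
    (mΓ : Measurable Γ) (hΓ0 : ∀ w, 0 ≤ Γ w) (hΓb : ∀ w, Γ w ≤ 2 * b ^ 2) (hD0 : ∀ w, 0 ≤ D w)
    (iD : Integrable (fun w => D w ^ 4) μ) {c : ℝ} (hDle : ∫ w, D w ^ 4 ∂μ ≤ c) :
    ∫⁻ w, ENNReal.ofReal (b ^ 2 * (l + Γ w) * (D w / l + U) ^ 4) ∂μ ≤
      ENNReal.ofReal (8 * b ^ 2 * (l + 2 * b ^ 2) * (c / l ^ 4) +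
        8 * b ^ 2 * U ^ 4 * (l + ∫ w, Γ w ∂μ)) := by
  have iΓ : Integrable Γ μ := integrable_of_norm_le mΓ.aestronglyMeasurable fun w => by
    rw [Real.norm_of_nonneg (hΓ0 w)]; exact hΓb w
  have i1 := iD.const_mul (8 * b ^ 2 * (l + 2 * b ^ 2) / l ^ 4)
  have i2 : Integrable (fun w => 8 * b ^ 2 * U ^ 4 * (l + Γ w)) μ :=
    ((integrable_const l).add iΓ).const_mul _
  -- `Γ` and `D` come from the same sample, so their product is avoided: next to `D ^ 4` the uniform
  -- bound on `Γ` is used, next to the constant `U ^ 4` its mean.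
  calc ∫⁻ w, ENNReal.ofReal (b ^ 2 * (l + Γ w) * (D w / l + U) ^ 4) ∂μ
      ≤ ∫⁻ w, ENNReal.ofReal (8 * b ^ 2 * (l + 2 * b ^ 2) / l ^ 4 * D w ^ 4 +
          8 * b ^ 2 * U ^ 4 * (l + Γ w)) ∂μ := by
        refine lintegral_mono fun w => ENNReal.ofReal_le_ofReal ?_
        have h0 := hΓ0 w
        have hD0 := hD0 w
        have h4 : (D w / l + U) ^ 4 ≤ 8 * ((D w / l) ^ 4 + U ^ 4) := by
          refine (add_pow_le (by positivity) hU 4).trans ?_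
          norm_num
        calc b ^ 2 * (l + Γ w) * (D w / l + U) ^ 4
            ≤ b ^ 2 * (l + Γ w) * (8 * ((D w / l) ^ 4 + U ^ 4)) := by gcongr
          _ = 8 * b ^ 2 * (l + Γ w) * (D w / l) ^ 4 + 8 * b ^ 2 * U ^ 4 * (l + Γ w) := by ring
          _ ≤ 8 * b ^ 2 * (l + 2 * b ^ 2) * (D w / l) ^ 4 + 8 * b ^ 2 * U ^ 4 * (l + Γ w) := by
              have := hΓb w
              gcongr
          _ = _ := by rw [div_pow]; ring
    _ = ENNReal.ofReal (∫ w, (8 * b ^ 2 * (l + 2 * b ^ 2) / l ^ 4 * D w ^ 4 +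
          8 * b ^ 2 * U ^ 4 * (l + Γ w)) ∂μ) := by
        refine (ofReal_integral_eq_lintegral_ofReal (i1.add i2) ?_).symm
        refine ae_of_all _ fun w => ?_
        have h0 := hΓ0 w
        have hD0 := hD0 w
        simp only [Pi.zero_apply, Pi.add_apply]
        positivity
    _ ≤ _ := by
        apply ENNReal.ofReal_le_ofReal
        have e1 : ∫ w, (l + Γ w) ∂μ = l + ∫ w, Γ w ∂μ := by
          rw [integral_add (integrable_const l) iΓ]; simp
        rw [integral_add i1 i2, integral_const_mul, integral_const_mul, e1]
        refine add_le_add ?_ le_rfl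
        calc 8 * b ^ 2 * (l + 2 * b ^ 2) / l ^ 4 * ∫ w, D w ^ 4 ∂μ
            ≤ 8 * b ^ 2 * (l + 2 * b ^ 2) / l ^ 4 * c := by gcongr
          _ = _ := by ring

/-- The uLSIF estimate converges in fourth mean to `u`, if `u` is the density ratio. -/
theorem tendsto_ulsif_err {ν ρ : Measure X} [IsProbabilityMeasure ν]
    (hH : ∀ u : H, Measurable fun x => u x) {b : ℝ} (hb : ∀ x, ‖kfun H x‖ ≤ b) (u : H)
    (hu : ∫ x, kfun H x ∂ρ = ∫ x, u x • kfun H x ∂ν)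
    {lam : ℕ → ℕ → ℝ} (hlam0 : ∀ n m, 0 < lam n m)
    (hlam : Tendsto (fun s : ℕ × ℕ => lam s.1 s.2) atTop (𝓝 0))
    (hlam' : Tendsto (fun s : ℕ × ℕ => (lam s.1 s.2) ^ 2 * (min s.1 s.2 : ℕ)) atTop atTop)
    {rhat : (n m : ℕ) → (Fin n → X) → (Fin m → X) → H}
    (hrhat : ∀ n m, 0 < n → 0 < m → ∀ xs xt,
      IsMinOn (ulsifObj (H := H) (lam n m) xs xt) Set.univ (rhat n m xs xt))
    {xs xt : ℕ → W → X} (hxs : ∀ i, Measurable (xs i)) (hxt : ∀ i, Measurable (xt i))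
    (hxsν : ∀ i, μ.map (xs i) = ν) (hxtρ : ∀ i, μ.map (xt i) = ρ)
    (hxsi : iIndepFun xs μ) (hxti : iIndepFun xt μ) :
    Tendsto (fun s : ℕ × ℕ => ∫⁻ w, ∫⁻ x,
      ‖rhat s.1 s.2 (fun k => xs k w) (fun k => xt k w) x - u x‖ₑ ^ 4 ∂ν ∂μ) atTop (𝓝 0) := by
  obtain ⟨Γ, mΓ, hΓ0, hΓb, hΓlim, hquad⟩ := exists_quad_le hH hb hxs hxsν hxsi
  obtain ⟨C, hC⟩ := integral_embDiff_pow_four_le hH hb u hu hxs hxt hxsν hxtρ hxsi hxti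
  -- The discrepancy has fourth moment of order `min⁻²`; divided by `lam ^ 4` this is the inverse
  -- square of `lam ^ 2 * min`, hence the growth condition `hlam'`. The other summand vanishes
  -- because `lam` and the mean of `Γ` do.
  set F : ℕ × ℕ → ℝ := fun s => 8 * b ^ 2 * (lam s.1 s.2 + 2 * b ^ 2) *
    (C * (((lam s.1 s.2) ^ 2 * (min s.1 s.2 : ℕ))⁻¹) ^ 2) +
    8 * b ^ 2 * ‖u‖ ^ 4 * (lam s.1 s.2 + ∫ w, Γ s.1 w ∂μ) with hF
  have hFlim : Tendsto (fun s => ENNReal.ofReal (F s)) atTop (𝓝 0) := by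
    have t1 := tendsto_inv_atTop_zero.comp hlam'
    have t2 : Tendsto (fun s : ℕ × ℕ => ∫ w, Γ s.1 w ∂μ) atTop (𝓝 0) :=
      hΓlim.comp (by rw [← prod_atTop_atTop_eq]; exact tendsto_fst)
    have t3 := ((((hlam.add_const (2 * b ^ 2)).const_mul (8 * b ^ 2)).mul
      ((t1.pow 2).const_mul C)).add
      ((hlam.add t2).const_mul (8 * b ^ 2 * ‖u‖ ^ 4)))
    have t4 := ENNReal.tendsto_ofReal t3
    simpa [hF, Function.comp_def] using t4
  refine tendsto_of_tendsto_of_tendsto_of_le_of_le' tendsto_const_nhds hFlim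
    (Eventually.of_forall fun _ => zero_le) ?_
  filter_upwards [eventually_ge_atTop ((1, 1) : ℕ × ℕ)] with s hs
  have hn : 0 < s.1 := hs.1
  have hm : 0 < s.2 := hs.2
  obtain ⟨iD, hDle⟩ := hC s.1 s.2 hn hm
  have hl := hlam0 s.1 s.2
  refine (lintegral_mono fun w => lintegral_ulsif_err_le hH hb hl (hrhat s.1 s.2 hn hm _ _) u
    (hquad s.1 w) (hΓ0 s.1 w)).trans ?_
  refine (lintegral_err_bound_le hl (norm_nonneg u) (mΓ s.1) (hΓ0 s.1) (hΓb s.1)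
    (fun w => norm_nonneg _) iD hDle).trans (ENNReal.ofReal_le_ofReal (le_of_eq ?_))
  rw [hF]
  have : (0 : ℝ) < (min s.1 s.2 : ℕ) := by exact_mod_cast lt_min hn hm
  congr 2
  field_simp

end Ulsif

/-! ### Consistency of empirical risk minimization -/

section Erm

/-- Minimizers of uniformly convergent functions converge to the unique minimizer of the limit. -/
lemma tendsto_of_isMin {Om : Type*} [TopologicalSpace Om] [CompactSpace Om] {g : C(Om, ℝ)}
    {G : ℕ → C(Om, ℝ)} (hG : Tendsto G atTop (𝓝 g)) {ω₀ : Om} (h₀ : ∀ ω ≠ ω₀, g ω₀ < g ω)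
    {x : ℕ → Om} (hx : ∀ᶠ n in atTop, G n (x n) ≤ G n ω₀) : Tendsto x atTop (𝓝 ω₀) := by
  have hle : ∀ᶠ n in atTop, g (x n) ≤ g ω₀ + 2 * ‖G n - g‖ := by
    filter_upwards [hx] with n hn
    have h1 := (abs_le.1 ((G n - g).norm_coe_le_norm (x n))).1
    have h2 := (abs_le.1 ((G n - g).norm_coe_le_norm ω₀)).2
    simp only [ContinuousMap.sub_apply] at h1 h2
    linarith
  have hlim : Tendsto (fun n => g ω₀ + 2 * ‖G n - g‖) atTop (𝓝 (g ω₀)) := by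
    simpa using (((tendsto_iff_norm_sub_tendsto_zero.1 hG).const_mul 2).const_add (g ω₀))
  rw [tendsto_nhds]
  intro U hU hω
  rcases Uᶜ.eq_empty_or_nonempty with hE | hne
  · rw [Set.compl_empty_iff] at hE
    simp [hE]
  -- The limit attains its minimum on the compact complement of `U`, and it exceeds the value at
  -- `ω₀` by uniqueness.
  obtain ⟨k, hk, hmin⟩ := hU.isClosed_compl.isCompact.exists_isMinOn hne g.continuous.continuousOn
  have hlt : g ω₀ < g k := h₀ k fun e => hk (e ▸ hω)
  filter_upwards [hle, hlim.eventually_lt_const hlt] with n h1 h2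
  by_contra hn
  have := isMinOn_iff.1 hmin (x n) hn
  linarith

variable {E Om : Type*} [MeasurableSpace E] [MetricSpace Om] [CompactSpace Om]
  {W : Type*} [MeasurableSpace W] {μ : Measure W} [IsProbabilityMeasure μ]
  {ℓ : Om → E → ℝ} {M : ℝ} {ν : Measure E}
  {ζ : ℕ → W → E} {what : (n : ℕ) → (Fin n → E) → Om} {ω₀ : Om}

/-- The loss as a function of the parameter is a bounded random element of the separable Banach
space `C(Om, ℝ)`. The strong law there is uniform convergence of the empirical risks, and
`tendsto_of_isMin` applies. -/
lemma ae_tendsto_erm (mℓ : ∀ ω, Measurable (ℓ ω)) (cℓ : ∀ z, Continuous fun ω => ℓ ω z)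
    (hM : ∀ ω z, |ℓ ω z| ≤ M) (h₀ : ∀ ω ≠ ω₀, ∫ z, ℓ ω₀ z ∂ν < ∫ z, ℓ ω z ∂ν)
    (hζ : ∀ i, Measurable (ζ i)) (hζν : ∀ i, μ.map (ζ i) = ν) (hζi : iIndepFun ζ μ)
    (hwhat : ∀ n, 0 < n → ∀ D ω, (∑ i, ℓ (what n D) (D i)) / n ≤ (∑ i, ℓ ω (D i)) / n) :
    ∀ᵐ w ∂μ, Tendsto (fun n => what n fun k => ζ k w) atTop (𝓝 ω₀) := by
  borelize C(Om, ℝ)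
  set G : E → C(Om, ℝ) := fun z => ⟨fun ω => ℓ ω z, cℓ z⟩ with hG
  have mG : Measurable G := measurable_of_eval fun ω => mℓ ω
  have bG : ∀ z, ‖G z‖ ≤ M := fun z =>
    (ContinuousMap.norm_le _ ((abs_nonneg _).trans (hM ω₀ z))).2 fun ω => hM ω z
  have iG : Integrable (fun w => G (ζ 0 w)) μ :=
    integrable_of_norm_le (mG.comp (hζ 0)).aestronglyMeasurable fun w => bG _
  have hlln := strong_law_ae (μ := μ) (fun i w => G (ζ i w)) iG
    (fun i j hij => (hζi.indepFun hij).comp mG mG) fun i => by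
      have : IdentDistrib (ζ i) (ζ 0) μ μ :=
        ⟨(hζ i).aemeasurable, (hζ 0).aemeasurable, by rw [hζν, hζν]⟩
      exact this.comp mG
  have hg : ∀ ω, (∫ w, G (ζ 0 w) ∂μ) ω = ∫ z, ℓ ω z ∂ν := fun ω => by
    have := (ContinuousMap.evalCLM ℝ ω).integral_comp_comm iG
    rw [← hζν 0, integral_map (hζ 0).aemeasurable (mℓ ω).aestronglyMeasurable]
    exact this.symm
  filter_upwards [hlln] with w hw
  refine tendsto_of_isMin hw (fun ω hω => by rw [hg, hg]; exact h₀ ω hω) ?_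
  filter_upwards [eventually_gt_atTop 0] with n hn
  have e : ∀ ω, ((n : ℝ)⁻¹ • ∑ i ∈ Finset.range n, G (ζ i w)) ω =
      (∑ i : Fin n, ℓ ω (ζ i w)) / n := fun ω => by
    rw [ContinuousMap.smul_apply, ContinuousMap.sum_apply, Finset.sum_range, smul_eq_mul,
      div_eq_inv_mul]
    rfl
  rw [e, e]
  exact hwhat n hn _ _

variable [MeasurableSpace Om] [BorelSpace Om] [IsProbabilityMeasure ν]

/-- The loss of the empirical risk minimizer converges in fourth mean. -/
theorem tendsto_erm_err (mℓ : ∀ ω, Measurable (ℓ ω)) (cℓ : ∀ z, Continuous fun ω => ℓ ω z)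
    (hM : ∀ ω z, |ℓ ω z| ≤ M) (h₀ : ∀ ω ≠ ω₀, ∫ z, ℓ ω₀ z ∂ν < ∫ z, ℓ ω z ∂ν)
    (hζ : ∀ i, Measurable (ζ i)) (hζν : ∀ i, μ.map (ζ i) = ν) (hζi : iIndepFun ζ μ)
    (hwhat : ∀ n, 0 < n → ∀ D ω, (∑ i, ℓ (what n D) (D i)) / n ≤ (∑ i, ℓ ω (D i)) / n)
    (hwm : ∀ n, Measurable (what n)) :
    Tendsto (fun n => ∫⁻ w, ∫⁻ z, ‖ℓ (what n fun k => ζ k w) z - ℓ ω₀ z‖ₑ ^ 4 ∂ν ∂μ) atTop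
      (𝓝 0) := by
  have mu : Measurable (Function.uncurry ℓ) :=
    measurable_uncurry_of_continuous_of_measurable cℓ mℓ
  have mwh : ∀ n, Measurable fun w => what n fun k => ζ k w := fun n =>
    (hwm n).comp (measurable_pi_lambda _ fun k => hζ k)
  have hbd : ∀ ω z, ‖ℓ ω z - ℓ ω₀ z‖ₑ ^ 4 ≤ ENNReal.ofReal (2 * M) ^ 4 := fun ω z => by
    gcongr
    rw [Real.enorm_eq_ofReal_abs]
    refine ENNReal.ofReal_le_ofReal ((abs_sub _ _).trans ?_)
    linarith [hM ω z, hM ω₀ z]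
  have hfin : ENNReal.ofReal (2 * M) ^ 4 ≠ ∞ := ENNReal.pow_ne_top ENNReal.ofReal_ne_top
  have hin : ∀ᵐ w ∂μ, Tendsto (fun n => ∫⁻ z, ‖ℓ (what n fun k => ζ k w) z - ℓ ω₀ z‖ₑ ^ 4 ∂ν)
      atTop (𝓝 0) := by
    filter_upwards [ae_tendsto_erm mℓ cℓ hM h₀ hζ hζν hζi hwhat] with w hw
    have := tendsto_lintegral_of_dominated_convergence (μ := ν)
      (F := fun n z => ‖ℓ (what n fun k => ζ k w) z - ℓ ω₀ z‖ₑ ^ 4) (f := fun _ => 0)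
      (fun _ => ENNReal.ofReal (2 * M) ^ 4) (fun n => ?_) (fun n => ae_of_all _ fun z => hbd _ z)
      (by simpa using hfin) (ae_of_all _ fun z => ?_)
    · simpa using this
    · exact (((mℓ _).sub (mℓ _)).enorm).pow_const 4
    · have h1 : Tendsto (fun n => ℓ (what n fun k => ζ k w) z - ℓ ω₀ z) atTop (𝓝 0) := by
        simpa using (((cℓ z).tendsto ω₀).comp hw).sub_const (ℓ ω₀ z)
      have h2 := ((continuous_enorm.tendsto _).comp h1)
      rw [enorm_zero] at h2
      have h3 := (ENNReal.continuous_pow 4).tendsto 0 |>.comp h2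
      simpa [Function.comp_def] using h3
  have := tendsto_lintegral_of_dominated_convergence (μ := μ)
    (F := fun n w => ∫⁻ z, ‖ℓ (what n fun k => ζ k w) z - ℓ ω₀ z‖ₑ ^ 4 ∂ν) (f := fun _ => 0)
    (fun _ => ENNReal.ofReal (2 * M) ^ 4) (fun n => ?_) (fun n => ae_of_all _ fun w => ?_)
    (by simpa using hfin) hin
  · simpa using this
  · refine Measurable.lintegral_prod_right'
      (f := fun q : W × E => ‖ℓ (what n fun k => ζ k q.1) q.2 - ℓ ω₀ q.2‖ₑ ^ 4) ?_
    refine ((Measurable.sub ?_ ((mℓ ω₀).comp measurable_snd)).enorm).pow_const 4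
    exact mu.comp (((mwh n).comp measurable_fst).prodMk measurable_snd)
  · refine (lintegral_mono fun z => hbd _ z).trans ?_
    simp

end Erm

/-! ### Change of measure from a source to the target -/

section Change

variable {X Y : Type*} [MeasureSpace X] [MeasureSpace Y] {pS pT : X × Y → ℝ≥0∞}

lemma isProbabilityMeasure_law {p : X × Y → ℝ≥0∞} (h1 : ∫⁻ z, p z = 1) :
    IsProbabilityMeasure (law p) :=
  ⟨by rw [law, withDensity_apply _ MeasurableSet.univ, Measure.restrict_univ, h1]⟩

variable [SFinite (volume : Measure Y)]

lemma measurable_featDensity {p : X × Y → ℝ≥0∞} (hp : Measurable p) :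
    Measurable (featDensity p) := hp.lintegral_prod_right'

lemma lintegral_featDensity [SFinite (volume : Measure X)] {p : X × Y → ℝ≥0∞} (hp : Measurable p) :
    ∫⁻ x, featDensity p x = ∫⁻ z, p z := (lintegral_prod _ hp.aemeasurable).symm

variable [SFinite (volume : Measure X)]

/-- Where the target feature density is positive, the common conditional density gives `pT = pS *
(featDensity pT / featDensity pS)`. Where it vanishes, `pT x` vanishes for almost every output, and
so does the right-hand side. -/
lemma law_target_eq (hpS : Measurable pS) (hpT : Measurable pT) (hpS1 : ∫⁻ z, pS z = 1)
    (hpT1 : ∫⁻ z, pT z = 1)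
    (hsupp : ∀ᵐ x : X, 0 < featDensity pT x → 0 < featDensity pS x)
    (hcond : ∀ᵐ x : X, 0 < featDensity pT x →
      ∀ᵐ y : Y, condDensity pT x y = condDensity pS x y) :
    law pT = (law pS).withDensity fun z => featDensity pT z.1 / featDensity pS z.1 := by
  have mT := measurable_featDensity hpT
  have mS := measurable_featDensity hpS
  have mg : Measurable fun z : X × Y => featDensity pT z.1 / featDensity pS z.1 :=
    (mT.comp measurable_fst).div (mS.comp measurable_fst)
  -- Cancellation in `ℝ≥0∞` needs finite feature densities, which holds almost everywhere because
  -- their integrals are one.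
  have fin : ∀ {p : X × Y → ℝ≥0∞}, Measurable p → ∫⁻ z, p z = 1 →
      ∀ᵐ x : X, featDensity p x < ∞ := fun hp h1 =>
    ae_lt_top (measurable_featDensity hp) (by rw [lintegral_featDensity hp, h1]; simp)
  rw [law, law, ← withDensity_mul _ hpS mg]
  refine withDensity_congr_ae ?_
  have hms : MeasurableSet {z : X × Y |
      pT z = pS z * (featDensity pT z.1 / featDensity pS z.1)} :=
    measurableSet_eq_fun hpT (hpS.mul mg)
  refine (Measure.ae_prod_mem_iff_ae_ae_mem hms).2 ?_
  filter_upwards [hsupp, hcond, fin hpT hpT1, fin hpS hpS1] with x h1 h2 h3 h4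
  rcases eq_or_ne (featDensity pT x) 0 with h0 | h0
  · have : ∀ᵐ y : Y, pT (x, y) = 0 :=
      (lintegral_eq_zero_iff (hpT.comp measurable_prodMk_left)).1 h0
    filter_upwards [this] with y hy
    simp [hy, h0]
  · have hT := pos_iff_ne_zero.2 h0
    filter_upwards [h2 hT] with y hy
    have hS := (h1 hT).ne'
    simp only [condDensity] at hy
    rw [mul_div_assoc', mul_comm, mul_div_assoc, ← hy, ENNReal.mul_div_cancel h0 h3.ne]

/-- Integrals with respect to the target are importance weighted integrals with respect to the
source. -/
lemma integral_law_target (hpS : Measurable pS) (hpT : Measurable pT) (hpS1 : ∫⁻ z, pS z = 1)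
    (hpT1 : ∫⁻ z, pT z = 1)
    (hsupp : ∀ᵐ x : X, 0 < featDensity pT x → 0 < featDensity pS x)
    (hcond : ∀ᵐ x : X, 0 < featDensity pT x →
      ∀ᵐ y : Y, condDensity pT x y = condDensity pS x y)
    {G : Type*} [NormedAddCommGroup G] [NormedSpace ℝ G] {u : X → ℝ}
    (hu : ∀ᵐ z ∂(law pS), u z.1 = ratio pT pS z.1) (F : X × Y → G) :
    ∫ z, F z ∂(law pT) = ∫ z, u z.1 • F z ∂(law pS) := by
  have mg : Measurable fun z : X × Y => featDensity pT z.1 / featDensity pS z.1 :=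
    ((measurable_featDensity hpT).comp measurable_fst).div
      ((measurable_featDensity hpS).comp measurable_fst)
  have e := law_target_eq hpS hpT hpS1 hpT1 hsupp hcond
  have hfin : ∀ᵐ z ∂(law pS), featDensity pT z.1 / featDensity pS z.1 < ∞ := by
    refine ae_lt_top mg ?_
    have := isProbabilityMeasure_law hpT1
    rw [← setLIntegral_univ, ← withDensity_apply _ MeasurableSet.univ, ← e, measure_univ]
    simp
  rw [e, integral_withDensity_eq_integral_toReal_smul mg hfin]
  refine integral_congr_ae ?_
  filter_upwards [hu] with z hz
  rw [hz, ratio]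

end Change

/-! ### Averages over independent samples -/

section Indep

variable {W : Type*} [MeasurableSpace W] {μ : Measure W} [IsProbabilityMeasure μ]
  {α β γ : Type*} [MeasurableSpace α] [MeasurableSpace β] [MeasurableSpace γ]

/-- The hypotheses make the joint law a product of three laws, so its factors may be regrouped. -/
lemma indepFun_prodMk_of_prodMk {A : W → α} {V : W → β} {X : W → γ} (mA : Measurable A)
    (mV : Measurable V) (mX : Measurable X) (h1 : IndepFun A V μ)
    (h2 : IndepFun (fun w => (A w, V w)) X μ) : IndepFun (fun w => (A w, X w)) V μ := by
  have h3 : IndepFun A X μ := h2.comp measurable_fst measurable_id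
  have pA := Measure.isProbabilityMeasure_map (μ := μ) mA.aemeasurable
  have pV := Measure.isProbabilityMeasure_map (μ := μ) mV.aemeasurable
  have pX := Measure.isProbabilityMeasure_map (μ := μ) mX.aemeasurable
  rw [indepFun_iff_map_prod_eq_prod_map_map mA.aemeasurable mV.aemeasurable] at h1
  rw [indepFun_iff_map_prod_eq_prod_map_map mA.aemeasurable mX.aemeasurable] at h3
  rw [indepFun_iff_map_prod_eq_prod_map_map (mA.prodMk mV).aemeasurable mX.aemeasurable, h1] at h2
  rw [indepFun_iff_map_prod_eq_prod_map_map (mA.prodMk mX).aemeasurable mV.aemeasurable, h3]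
  have m1 := measurePreserving_prodAssoc (μ.map A) (μ.map V) (μ.map X)
  have m2 := (MeasurePreserving.id (μ.map A)).prod
    (Measure.measurePreserving_swap (μ := μ.map V) (ν := μ.map X))
  have m3 := (measurePreserving_prodAssoc (μ.map A) (μ.map X) (μ.map V)).symm
  have m4 := m3.comp (m2.comp m1)
  rw [← m4.map_eq, ← h2, Measure.map_map m4.measurable ((mA.prodMk mV).prodMk mX)]
  rfl

/-- Fubini's theorem for the product law. With `B` the training data and `V` a validation point, the
fitted functions may be frozen while integrating over the source law. -/
lemma lintegral_comp_prodMk {B : W → α} {V : W → β} (mB : Measurable B) (mV : Measurable V)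
    (h : IndepFun B V μ) {ν : Measure β} (hν : μ.map V = ν) {F : α × β → ℝ≥0∞}
    (mF : Measurable F) : ∫⁻ w, F (B w, V w) ∂μ = ∫⁻ w, ∫⁻ v, F (B w, v) ∂ν ∂μ := by
  have pV := Measure.isProbabilityMeasure_map (μ := μ) mV.aemeasurable
  rw [← lintegral_map mF (mB.prodMk mV),
    (indepFun_iff_map_prod_eq_prod_map_map mB.aemeasurable mV.aemeasurable).1 h,
    lintegral_prod _ mF.aemeasurable, lintegral_map mF.lintegral_prod_right' mB, hν]

end Indep

/-! ### The estimates on the validation parts -/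

section Concrete

variable {X Y Om Th H W : Type*} [MeasureSpace X] [MeasureSpace Y]
  {pS pT : X × Y → ℝ≥0∞} {L : Y → Y → ℝ} {h : X → Om → Th → Y} {θ : Th}

/-- Elements of `H` are bounded and measurable at every point, whereas the ratio agrees with one
only almost everywhere; population quantities do not see the difference. -/
lemma cvCoef_eq_eta {u : X → ℝ} {ω : Om}
    (hu : ∀ᵐ z ∂(law pS), u z.1 = ratio pT pS z.1) :
    cvCoef (law pS) (fun z => u z.1) (fun z => u z.1 * L (h z.1 ω θ) z.2) =
      eta L h θ pT pS ω := by
  have h1 : (fun z : X × Y => u z.1 * L (h z.1 ω θ) z.2) =ᵐ[law pS] wLoss L h θ pT pS ω := by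
    filter_upwards [hu] with z hz
    rw [hz, wLoss]
  rw [cvCoef, eta, variance_congr hu, covariance, covariance, integral_congr_ae h1,
    integral_congr_ae hu]
  congr 2
  refine integral_congr_ae ?_
  filter_upwards [h1, hu] with z h1z hz
  rw [h1z, hz]

lemma cvDiv_eq_diverg {u : X → ℝ} {ω : Om}
    (hu : ∀ᵐ z ∂(law pS), u z.1 = ratio pT pS z.1) (f : ℝ) :
    cvDiv (law pS) (fun z => u z.1) (fun z => u z.1 * L (h z.1 ω θ) z.2) f =
      diverg L h θ pT pS ω f := by
  rw [cvDiv, diverg, cvCoef_eq_eta hu]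
  congr 1
  refine integral_congr_ae ?_
  filter_upwards [hu] with z hz
  simp only [hz, wLoss]

/-- The validation values of the ideal density ratios and the ideal losses. -/
lemma valModel_of_sources [SFinite (volume : Measure X)] [SFinite (volume : Measure Y)] {K : ℕ}
    {pS : Fin K → X × Y → ℝ≥0∞}
    (hpS : ∀ j, Measurable (pS j)) (hpT : Measurable pT)
    (hpS1 : ∀ j, ∫⁻ z, pS j z = 1) (hpT1 : ∫⁻ z, pT z = 1)
    (hsupp : ∀ j, ∀ᵐ x : X, 0 < featDensity pT x → 0 < featDensity (pS j) x)
    (hcond : ∀ j, ∀ᵐ x : X, 0 < featDensity pT x →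
      ∀ᵐ y : Y, condDensity pT x y = condDensity (pS j) x y)
    (mL : ∀ ω, Measurable fun z : X × Y => L (h z.1 ω θ) z.2) {A M : ℝ}
    (hA : ∀ y y', |L y y'| ≤ A) {omS : Fin K → Om} {f : ℝ} (hf : ∀ j, risk L h θ pT (omS j) = f)
    (hvar : ∀ j, Var[fun z => ratio pT (pS j) z.1; law (pS j)] ≠ 0)
    (hdiv : ∀ j, diverg L h θ pT (pS j) (omS j) f ≠ 0)
    {u : Fin K → X → ℝ} (mu : ∀ j, Measurable (u j)) (hu : ∀ j x, |u j x| ≤ M)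
    (huS : ∀ j, ∀ᵐ z ∂(law (pS j)), u j z.1 = ratio pT (pS j) z.1)
    [MeasurableSpace W] {μ : Measure W} [IsProbabilityMeasure μ]
    {Z : Fin K → Part → ℕ → W → X × Y} (hZm : ∀ j s i, Measurable (Z j s i))
    (hZ : ∀ j s i, μ.map (Z j s i) = law (pS j))
    (hZind : iIndepFun (fun (q : Fin K × Part × ℕ) => Z q.1 q.2.1 q.2.2) μ) :
    ValModel μ (fun j => law (pS j)) (fun j i => Z j .val i) (fun j z => u j z.1)
      (fun j z => u j z.1 * L (h z.1 (omS j) θ) z.2) f (max M (M * A)) where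
  measV j i := hZm j _ i
  mapV j i := hZ j _ i
  indepV := hZind.precomp (g := fun q : Fin K × ℕ => (q.1, Part.val, q.2)) fun a b hab => by
    simpa [Prod.ext_iff] using hab
  prob j := isProbabilityMeasure_law (hpS1 j)
  meas_r j := (mu j).comp measurable_fst
  meas_a j := ((mu j).comp measurable_fst).mul (mL _)
  bdd_r j z := (hu j z.1).trans (le_max_left _ _)
  bdd_a j z := by
    have := hu j z.1
    have hM : 0 ≤ M := (abs_nonneg _).trans this
    rw [abs_mul]
    refine le_trans ?_ (le_max_right _ _)
    have := hA (h z.1 (omS j) θ) z.2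
    gcongr
  int_r j := by
    have := isProbabilityMeasure_law hpT1
    have := integral_law_target (hpS j) hpT (hpS1 j) hpT1 (hsupp j) (hcond j) (huS j)
      fun _ => (1 : ℝ)
    simpa using this.symm
  int_a j := by
    have := integral_law_target (hpS j) hpT (hpS1 j) hpT1 (hsupp j) (hcond j) (huS j)
      fun z => L (h z.1 (omS j) θ) z.2
    rw [← hf j, risk, this]
    rfl
  var_ne j := by rw [variance_congr (huS j)]; exact hvar j
  div_ne j := by rw [cvDiv_eq_diverg (huS j)]; exact hdiv j

/-- The `de` and `tr` indices are disjoint from the `val` index, so independence of the family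
applies; the target features are adjoined by `indepFun_prodMk_of_prodMk`. -/
lemma indepFun_train_val {X Y W : Type*} [MeasurableSpace X] [MeasurableSpace Y] {K : ℕ}
    [MeasurableSpace W] {μ : Measure W} [IsProbabilityMeasure μ]
    {Z : Fin K → Part → ℕ → W → X × Y} {XT : ℕ → W → X} (hZm : ∀ j s i, Measurable (Z j s i))
    (hXTm : ∀ i, Measurable (XT i))
    (hZind : iIndepFun (fun (q : Fin K × Part × ℕ) => Z q.1 q.2.1 q.2.2) μ)
    (hZXT : IndepFun (fun w (q : Fin K × Part × ℕ) => Z q.1 q.2.1 q.2.2 w)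
      (fun w i => XT i w) μ) (j : Fin K) (n n' m i : ℕ) :
    IndepFun (fun w => ((fun k : Fin n => Z j .de k w, fun k : Fin n' => Z j .tr k w),
      fun k : Fin m => XT k w)) (Z j .val i) μ := by
  classical
  set e : Fin n ⊕ Fin n' → Fin K × Part × ℕ :=
    Sum.elim (fun k => (j, .de, (k : ℕ))) fun k => (j, .tr, (k : ℕ)) with he
  have h1 : IndepFun (fun w => (fun k : Fin n => Z j .de k w, fun k : Fin n' => Z j .tr k w))
      (Z j .val i) μ := by
    have h := hZind.indepFun_finset (Finset.univ.image e) {(j, .val, i)} (by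
      rw [Finset.disjoint_singleton_right]
      simp [he]) fun q => hZm _ _ _
    have mem : ∀ k, e k ∈ Finset.univ.image e := fun k =>
      Finset.mem_image_of_mem _ (Finset.mem_univ k)
    exact h.comp
      (φ := fun (f : ↥(Finset.univ.image e) → X × Y) =>
        ((fun k : Fin n => f ⟨_, mem (.inl k)⟩), fun k : Fin n' => f ⟨_, mem (.inr k)⟩))
      (ψ := fun (f : ↥({(j, .val, i)} : Finset (Fin K × Part × ℕ)) → X × Y) =>
        f ⟨_, Finset.mem_singleton_self _⟩) (by fun_prop)
      (measurable_pi_apply _)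
  refine indepFun_prodMk_of_prodMk (by fun_prop) (by fun_prop) (by fun_prop) h1 ?_
  exact hZXT.comp
    (φ := fun f : Fin K × Part × ℕ → X × Y =>
      ((fun k : Fin n => f (j, .de, k), fun k : Fin n' => f (j, .tr, k)), f (j, .val, i)))
    (ψ := fun (f : ℕ → X) (k : Fin m) => f k) (by fun_prop) (by fun_prop)

end Concrete

/-! ### Convergence of the fitted validation values -/

lemma eLpNorm_four_comp_prodMk {W α β : Type*} [MeasurableSpace W] {μ : Measure W}
    [IsProbabilityMeasure μ] [MeasurableSpace α] [MeasurableSpace β] {B : W → α} {V : W → β}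
    (mB : Measurable B) (mV : Measurable V) (h : IndepFun B V μ) {ν : Measure β}
    (hν : μ.map V = ν) {F : α × β → ℝ} (mF : Measurable F) :
    eLpNorm (fun w => F (B w, V w)) 4 μ =
      (∫⁻ w, ∫⁻ v, ‖F (B w, v)‖ₑ ^ 4 ∂ν ∂μ) ^ (1 / 4 : ℝ) := by
  rw [eLpNorm_eq_lintegral_rpow_enorm_toReal (by norm_num) (by norm_num),
    ← lintegral_comp_prodMk mB mV h hν (F := fun q => ‖F q‖ₑ ^ 4) (mF.enorm.pow_const 4)]
  have e : (4 : ℝ≥0∞).toReal = ((4 : ℕ) : ℝ) := by norm_num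
  simp only [e, ENNReal.rpow_natCast]
  norm_num

lemma tendsto_rpow_quarter {T : Type*} {l : Filter T} {x : T → ℝ≥0∞} (h : Tendsto x l (𝓝 0)) :
    Tendsto (fun t => x t ^ (1 / 4 : ℝ)) l (𝓝 0) := by
  have := ((ENNReal.continuous_rpow_const (y := (1 / 4 : ℝ))).tendsto 0).comp h
  rwa [ENNReal.zero_rpow_of_pos (by norm_num)] at this

lemma tendsto_de_sizes {K : ℕ} (j : Fin K) :
    Tendsto (fun t : TrainSizes K => (t.1 j, t.2.2)) atTop atTop := by
  rw [← prod_atTop_atTop_eq, ← prod_atTop_atTop_eq, ← prod_atTop_atTop_eq]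
  exact ((tendsto_apply_atTop j).comp tendsto_fst).prodMk (tendsto_snd.comp tendsto_snd)

lemma tendsto_tr_size {K : ℕ} (j : Fin K) :
    Tendsto (fun t : TrainSizes K => t.2.1 j) atTop atTop := by
  rw [← prod_atTop_atTop_eq, ← prod_atTop_atTop_eq]
  exact (tendsto_apply_atTop j).comp (tendsto_fst.comp tendsto_snd)

section Main

variable {X Y Om Th H W : Type*} [MeasureSpace X] [MeasureSpace Y]
  {K : ℕ} {pS : Fin K → X × Y → ℝ≥0∞} {pT : X × Y → ℝ≥0∞}
  {L : Y → Y → ℝ} {h : X → Om → Th → Y} {θ : Th}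
  [NormedAddCommGroup H] [InnerProductSpace ℝ H] [RKHS ℝ H X ℝ]
  {rhat : Fin K → (n m : ℕ) → (Fin n → X) → (Fin m → X) → H}
  {what : Fin K → (n : ℕ) → (Fin n → X × Y) → Om}
  [MeasurableSpace W] {μ : Measure W}
  {Z : Fin K → Part → ℕ → W → X × Y} {XT : ℕ → W → X} {u : Fin K → H} {omS : Fin K → Om}

/-- The error in fourth mean of the fitted density ratio of source `j`. -/
noncomputable def ratioErr (pS : Fin K → X × Y → ℝ≥0∞)
    (rhat : Fin K → (n m : ℕ) → (Fin n → X) → (Fin m → X) → H) (μ : Measure W)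
    (Z : Fin K → Part → ℕ → W → X × Y) (XT : ℕ → W → X) (u : Fin K → H) (j : Fin K)
    (t : TrainSizes K) : ℝ≥0∞ :=
  (∫⁻ w, ∫⁻ z, ‖rhat j (t.1 j) t.2.2 (fun k => (Z j .de k w).1) (fun k => XT k w) z.1 -
    u j z.1‖ₑ ^ 4 ∂(law (pS j)) ∂μ) ^ (1 / 4 : ℝ)

/-- The error in fourth mean of the loss of the fitted model of source `j`. -/
noncomputable def lossErr (pS : Fin K → X × Y → ℝ≥0∞) (L : Y → Y → ℝ) (h : X → Om → Th → Y)
    (θ : Th) (what : Fin K → (n : ℕ) → (Fin n → X × Y) → Om) (μ : Measure W)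
    (Z : Fin K → Part → ℕ → W → X × Y) (omS : Fin K → Om) (j : Fin K)
    (t : TrainSizes K) : ℝ≥0∞ :=
  (∫⁻ w, ∫⁻ z, ‖L (h z.1 (what j (t.2.1 j) fun k => Z j .tr k w) θ) z.2 -
    L (h z.1 (omS j) θ) z.2‖ₑ ^ 4 ∂(law (pS j)) ∂μ) ^ (1 / 4 : ℝ)

variable [IsProbabilityMeasure μ]
  (hZm : ∀ j s i, Measurable (Z j s i)) (hXTm : ∀ i, Measurable (XT i))
  (hZ : ∀ j s i, μ.map (Z j s i) = law (pS j))
  (hZind : iIndepFun (fun (q : Fin K × Part × ℕ) => Z q.1 q.2.1 q.2.2) μ)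
  (hZXT : IndepFun (fun w (q : Fin K × Part × ℕ) => Z q.1 q.2.1 q.2.2 w) (fun w i => XT i w) μ)

include hZm hXTm hZ hZind hZXT in
-- The fitted ratio depends on training data only, so the validation point can be integrated out
-- separately. The result does not depend on `i`, which makes the bound uniform over validation
-- points.
lemma eLpNorm_ratio_sub (mu : ∀ j, Measurable fun x => u j x)
    (hrhatm : ∀ j n m, Measurable fun q : (Fin n → X) × (Fin m → X) × X =>
      (rhat j n m q.1 q.2.1) q.2.2) (t : TrainSizes K) (j : Fin K) (i : ℕ) :
    eLpNorm (fun w => rhat j (t.1 j) t.2.2 (fun k => (Z j .de k w).1) (fun k => XT k w)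
      (Z j .val i w).1 - u j (Z j .val i w).1) 4 μ = ratioErr pS rhat μ Z XT u j t := by
  have mB : Measurable fun w => ((fun k : Fin (t.1 j) => Z j .de k w,
    fun k : Fin (t.2.1 j) => Z j .tr k w), fun k : Fin t.2.2 => XT k w) := by fun_prop
  refine eLpNorm_four_comp_prodMk mB (hZm j _ i)
    (indepFun_train_val hZm hXTm hZind hZXT j _ _ _ i) (hZ j _ i)
    (F := fun q => rhat j (t.1 j) t.2.2 (fun k => (q.1.1.1 k).1) q.1.2 q.2.1 - u j q.2.1) ?_
  refine Measurable.sub ?_ ((mu j).comp (by fun_prop))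
  exact (hrhatm j (t.1 j) t.2.2).comp
    (f := fun q : (((Fin (t.1 j) → X × Y) × (Fin (t.2.1 j) → X × Y)) × (Fin t.2.2 → X)) × X × Y =>
      ((fun k => (q.1.1.1 k).1), q.1.2, q.2.1)) (by fun_prop)

include hZm hXTm hZ hZind hZXT in
lemma eLpNorm_loss_sub [MeasurableSpace Om]
    (mL : Measurable fun q : Om × X × Y => L (h q.2.1 q.1 θ) q.2.2)
    (hwhatm : ∀ j n, Measurable (what j n)) (t : TrainSizes K) (j : Fin K) (i : ℕ) :
    eLpNorm (fun w => L (h (Z j .val i w).1 (what j (t.2.1 j) fun k => Z j .tr k w) θ)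
      (Z j .val i w).2 - L (h (Z j .val i w).1 (omS j) θ) (Z j .val i w).2) 4 μ =
        lossErr pS L h θ what μ Z omS j t := by
  have mB : Measurable fun w => ((fun k : Fin (t.1 j) => Z j .de k w,
    fun k : Fin (t.2.1 j) => Z j .tr k w), fun k : Fin t.2.2 => XT k w) := by fun_prop
  refine eLpNorm_four_comp_prodMk mB (hZm j _ i)
    (indepFun_train_val hZm hXTm hZind hZXT j _ _ _ i) (hZ j _ i)
    (F := fun q => L (h q.2.1 (what j (t.2.1 j) q.1.1.2) θ) q.2.2 - L (h q.2.1 (omS j) θ) q.2.2) ?_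
  refine Measurable.sub ?_ ?_
  · exact mL.comp (f := fun q : (((Fin (t.1 j) → X × Y) × (Fin (t.2.1 j) → X × Y)) ×
        (Fin t.2.2 → X)) × X × Y => (what j (t.2.1 j) q.1.1.2, q.2))
      (((hwhatm j _).comp (by fun_prop)).prodMk measurable_snd)
  · exact mL.comp (f := fun q : (((Fin (t.1 j) → X × Y) × (Fin (t.2.1 j) → X × Y)) ×
        (Fin t.2.2 → X)) × X × Y => (omS j, q.2)) (by fun_prop)

include hZm hXTm hZ hZind in
lemma tendsto_ratioErr [CompleteSpace H] [TopologicalSpace.SeparableSpace H]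
    [SFinite (volume : Measure X)] [SFinite (volume : Measure Y)]
    (hpS : ∀ j, Measurable (pS j)) (hpT : Measurable pT)
    (hpS1 : ∀ j, ∫⁻ z, pS j z = 1) (hpT1 : ∫⁻ z, pT z = 1)
    (hsupp : ∀ j, ∀ᵐ x : X, 0 < featDensity pT x → 0 < featDensity (pS j) x)
    (hcond : ∀ j, ∀ᵐ x : X, 0 < featDensity pT x →
      ∀ᵐ y : Y, condDensity pT x y = condDensity (pS j) x y)
    (hH : ∀ u : H, Measurable fun x => u x) {b : ℝ} (hb : ∀ x, ‖kfun H x‖ ≤ b)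
    (hu : ∀ j, ∀ᵐ z ∂(law (pS j)), u j z.1 = ratio pT (pS j) z.1)
    {lam : Fin K → ℕ → ℕ → ℝ} (hlam0 : ∀ j n m, 0 < lam j n m)
    (hlam : ∀ j, Tendsto (fun s : ℕ × ℕ => lam j s.1 s.2) atTop (𝓝 0))
    (hlam' : ∀ j, Tendsto (fun s : ℕ × ℕ => (lam j s.1 s.2) ^ 2 * (min s.1 s.2 : ℕ)) atTop atTop)
    (hrhat : ∀ j n m, 0 < n → 0 < m → ∀ xs xt,
      IsMinOn (ulsifObj (H := H) (lam j n m) xs xt) Set.univ (rhat j n m xs xt))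
    (hXT : ∀ i, μ.map (XT i) = (law pT).map Prod.fst) (hXTind : iIndepFun XT μ) (j : Fin K) :
    Tendsto (ratioErr pS rhat μ Z XT u j) atTop (𝓝 0) := by
  borelize H
  have mk := measurable_kfun hH
  have := isProbabilityMeasure_law (hpS1 j)
  have : IsProbabilityMeasure ((law (pS j)).map Prod.fst) :=
    Measure.isProbabilityMeasure_map measurable_fst.aemeasurable
  have muk : Measurable fun x => u j x • kfun H x := (hH (u j)).smul mk
  -- The change of measure from target to source, applied to the `H`-valued kernel function.
  have hemb : ∫ x, kfun H x ∂((law pT).map Prod.fst) =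
      ∫ x, u j x • kfun H x ∂((law (pS j)).map Prod.fst) := by
    rw [integral_map measurable_fst.aemeasurable mk.aestronglyMeasurable,
      integral_map measurable_fst.aemeasurable muk.aestronglyMeasurable]
    exact integral_law_target (hpS j) hpT (hpS1 j) hpT1 (hsupp j) (hcond j) (hu j) _
  have hind : iIndepFun (fun k w => (Z j .de k w).1) μ := by
    have h1 := hZind.precomp (g := fun k : ℕ => (j, Part.de, k)) fun a b hab => by
      simpa using hab
    exact h1.comp (fun _ => Prod.fst) fun _ => measurable_fst
  have key := tendsto_ulsif_err (ν := (law (pS j)).map Prod.fst) hH hb (u j) hemb (hlam0 j)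
    (hlam j) (hlam' j) (hrhat j) (xs := fun k w => (Z j .de k w).1) (xt := XT)
    (fun k => (hZm j _ k).fst) hXTm
    (fun k => by rw [← hZ j .de k, Measure.map_map measurable_fst (hZm j _ k)]; rfl) hXT hind
    hXTind
  refine (tendsto_rpow_quarter (key.comp (tendsto_de_sizes j))).congr fun t => ?_
  rw [ratioErr]
  congr 1
  refine lintegral_congr fun w => ?_
  rw [lintegral_map _ measurable_fst]
  refine (Measurable.enorm (Measurable.sub ?_ (hH (u j)))).pow_const 4
  exact hH _

include hZm hZ hZind in
lemma tendsto_lossErr [MetricSpace Om] [CompactSpace Om] [MeasurableSpace Om] [BorelSpace Om]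
    (hpS1 : ∀ j, ∫⁻ z, pS j z = 1)
    (mL : ∀ ω, Measurable fun z : X × Y => L (h z.1 ω θ) z.2)
    (cL : ∀ z : X × Y, Continuous fun ω => L (h z.1 ω θ) z.2) {A : ℝ}
    (hA : ∀ y y', |L y y'| ≤ A)
    (homS : ∀ j, ∀ ω, ω ≠ omS j → risk L h θ (pS j) (omS j) < risk L h θ (pS j) ω)
    (hwhat : ∀ j n, 0 < n → ∀ D, IsMinOn (empRisk L h θ D) Set.univ (what j n D))
    (hwhatm : ∀ j n, Measurable (what j n)) (j : Fin K) :
    Tendsto (lossErr pS L h θ what μ Z omS j) atTop (𝓝 0) := by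
  have := isProbabilityMeasure_law (hpS1 j)
  have hind : iIndepFun (fun k w => Z j .tr k w) μ :=
    hZind.precomp (g := fun k : ℕ => (j, Part.tr, k)) fun a b hab => by simpa using hab
  have key := tendsto_erm_err (μ := μ) (ν := law (pS j)) (ω₀ := omS j) (what := what j)
    (ℓ := fun ω (z : X × Y) => L (h z.1 ω θ) z.2) (ζ := fun k w => Z j .tr k w) mL cL
    (fun ω z => hA _ _) (homS j) (hZm j _) (hZ j _) hind
    (fun n hn D ω => isMinOn_iff.1 (hwhat j n hn D) ω (Set.mem_univ _)) (hwhatm j)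
  exact tendsto_rpow_quarter (key.comp (tendsto_tr_size j))

end Main

/-- The error of a product of fitted values. -/
lemma eLpNorm_mul_sub_mul_le {W : Type*} [MeasurableSpace W] {μ : Measure W}
    {R r ℓ ℓ₀ : W → ℝ} (mR : Measurable R) (mr : Measurable r) (mℓ : Measurable ℓ)
    (mℓ₀ : Measurable ℓ₀) {A M : ℝ} (hA : ∀ w, |ℓ w| ≤ A) (hM : ∀ w, |r w| ≤ M) (hA0 : 0 ≤ A)
    (hM0 : 0 ≤ M) {x y : ℝ≥0∞} (hx : eLpNorm (fun w => R w - r w) 4 μ ≤ x)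
    (hy : eLpNorm (fun w => ℓ w - ℓ₀ w) 4 μ ≤ y) :
    eLpNorm (fun w => R w * ℓ w - r w * ℓ₀ w) 4 μ ≤
      ENNReal.ofReal A * x + ENNReal.ofReal M * y := by
  refine le_trans (eLpNorm_mono (g := fun w => A * |R w - r w| + M * |ℓ w - ℓ₀ w|) fun w => ?_)
    (eLpNorm_fun_add_le (by fun_prop) (by fun_prop) (by norm_num)
      (eLpNorm_fun_const_mul_le hA0 ((eLpNorm_fun_abs _ 4).trans_le hx))
      (eLpNorm_fun_const_mul_le hM0 ((eLpNorm_fun_abs _ 4).trans_le hy)))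
  have e : R w * ℓ w - r w * ℓ₀ w = (R w - r w) * ℓ w + r w * (ℓ w - ℓ₀ w) := by ring
  rw [Real.norm_eq_abs, Real.norm_of_nonneg (by positivity), e]
  refine (abs_add_le _ _).trans ?_
  rw [abs_mul, abs_mul, mul_comm A]
  have h1 := hA w
  have h2 := hM w
  gcongr

lemma isFiniteMeasure_subtype {d : ℕ} {s : Set (EuclideanSpace ℝ (Fin d))} (hs : MeasurableSet s)
    (hb : Bornology.IsBounded s) : IsFiniteMeasure (volume : Measure s) :=
  ⟨by rw [Measure.Subtype.volume_univ hs.nullMeasurableSet]; exact hb.measure_lt_top⟩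

lemma isFiniteMeasure_subtype_real {s : Set ℝ} (hs : MeasurableSet s)
    (hb : Bornology.IsBounded s) : IsFiniteMeasure (volume : Measure s) :=
  ⟨by rw [Measure.Subtype.volume_univ hs.nullMeasurableSet]; exact hb.measure_lt_top⟩

/-- A Lipschitz loss on a bounded set is bounded. -/
lemma exists_abs_loss_le {s : Set ℝ} (hb : Bornology.IsBounded s) {L : s → s → ℝ} {C : ℝ≥0}
    (hL : LipschitzWith C (Function.uncurry L)) : ∃ A : ℝ, 0 ≤ A ∧ ∀ y y', |L y y'| ≤ A := by
  rcases isEmpty_or_nonempty s with he | ⟨⟨y₀⟩⟩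
  · exact ⟨0, le_rfl, fun y => he.elim y⟩
  obtain ⟨D, hD⟩ := Metric.isBounded_iff.1 hb
  have hD0 : 0 ≤ D := dist_nonneg.trans (hD y₀.2 y₀.2)
  refine ⟨|L y₀ y₀| + C * D, by positivity, fun y y' => ?_⟩
  have h1 := hL.dist_le_mul (y, y') (y₀, y₀)
  have h2 : dist (y, y') (y₀, y₀) ≤ D := by
    rw [Prod.dist_eq]
    exact max_le (hD y.2 y₀.2) (hD y'.2 y₀.2)
  rw [Real.dist_eq] at h1
  simp only [Function.uncurry_apply_pair] at h1
  have h3 := abs_sub_abs_le_abs_sub (L y y') (L y₀ y₀)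
  have h4 : (C : ℝ) * dist (y, y') (y₀, y₀) ≤ C * D := by gcongr
  linarith

end FedCS

theorem corollary2
    {d K : ℕ}
    -- feature space, output space, parameter space, hyperparameter space
    {𝒳 : Set (EuclideanSpace ℝ (Fin d))} (h𝒳 : MeasurableSet 𝒳) (h𝒳b : Bornology.IsBounded 𝒳)
    {𝒴 : Set ℝ} (h𝒴 : MeasurableSet 𝒴) (h𝒴b : Bornology.IsBounded 𝒴)
    {Om Th : Type*} [MetricSpace Om] [CompactSpace Om] [MeasurableSpace Om] [BorelSpace Om]
    -- joint densities of the sources and of the target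
    (pS : Fin K → 𝒳 × 𝒴 → ℝ≥0∞) (pT : 𝒳 × 𝒴 → ℝ≥0∞)
    (hpS : ∀ j, Measurable (pS j)) (hpT : Measurable pT)
    (hpS1 : ∀ j, ∫⁻ z, pS j z = 1) (hpT1 : ∫⁻ z, pT z = 1)
    -- support condition and equality of the conditional output densities
    (hsupp : ∀ j, ∀ᵐ x : 𝒳, 0 < FedCS.featDensity pT x → 0 < FedCS.featDensity (pS j) x)
    (hcond : ∀ j, ∀ᵐ x : 𝒳, 0 < FedCS.featDensity pT x →
      ∀ᵐ y : 𝒴, FedCS.condDensity pT x y = FedCS.condDensity (pS j) x y)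
    -- loss function, parametric model, the given hyperparameter
    (L : 𝒴 → 𝒴 → ℝ) (hL0 : ∀ y y', 0 ≤ L y y')
    (hL : ∃ C : ℝ≥0, LipschitzWith C (Function.uncurry L))
    (h : 𝒳 → Om → Th → 𝒴) (θ : Th)
    (hmeas : ∀ ω, Measurable fun x => h x ω θ) (hcont : ∀ x, Continuous fun ω => h x ω θ)
    -- ideal model parameters of the sources, and the target risk
    -- `f_T(θ) = risk L h θ pT om`
    (omS : Fin K → Om)
    (homS : ∀ j, ∀ ω, ω ≠ omS j →
      FedCS.risk L h θ (pS j) (omS j) < FedCS.risk L h θ (pS j) ω)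
    (om : Om) (hfT : ∀ j, FedCS.risk L h θ pT (omS j) = FedCS.risk L h θ pT om)
    -- nondegeneracy
    (hvar : ∀ j, Var[fun z => FedCS.ratio pT (pS j) z.1; FedCS.law (pS j)] ≠ 0)
    (hdiv : ∀ j, FedCS.diverg L h θ pT (pS j) (omS j)
      (FedCS.risk L h θ pT om) ≠ 0)
    -- the function space of uLSIF: it contains the density ratios
    {H : Type*} [NormedAddCommGroup H] [InnerProductSpace ℝ H] [CompleteSpace H]
    [TopologicalSpace.SeparableSpace H] [RKHS ℝ H 𝒳 ℝ]
    (hHmeas : ∀ u : H, Measurable fun x => u x)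
    (hker : ∃ κ : ℝ, ∀ x, ‖RKHS.kernel H x x‖ ≤ κ)
    (hrH : ∀ j, ∃ u : H, ∀ᵐ z ∂(FedCS.law (pS j)), u z.1 = FedCS.ratio pT (pS j) z.1)
    -- regularization of uLSIF
    (lam : Fin K → ℕ → ℕ → ℝ) (hlam0 : ∀ j n m, 0 < lam j n m)
    (hlam : ∀ j, Tendsto (fun s : ℕ × ℕ => lam j s.1 s.2) atTop (𝓝 0))
    (hlam' : ∀ j, Tendsto (fun s : ℕ × ℕ => (lam j s.1 s.2) ^ 2 * (min s.1 s.2 : ℕ)) atTop atTop)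
    -- the uLSIF estimates of the density ratios
    (rhat : Fin K → (n m : ℕ) → (Fin n → 𝒳) → (Fin m → 𝒳) → H)
    (hrhat : ∀ j n m, 0 < n → 0 < m → ∀ xs xt,
      IsMinOn (FedCS.ulsifObj (H := H) (lam j n m) xs xt) Set.univ (rhat j n m xs xt))
    (hrhatm : ∀ j n m, Measurable fun q : (Fin n → 𝒳) × (Fin m → 𝒳) × 𝒳 =>
      (rhat j n m q.1 q.2.1) q.2.2)
    -- the estimates of the model parameters
    (what : Fin K → (n : ℕ) → (Fin n → 𝒳 × 𝒴) → Om)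
    (hwhat : ∀ j n, 0 < n → ∀ D, IsMinOn (FedCS.empRisk L h θ D) Set.univ (what j n D))
    (hwhatm : ∀ j n, Measurable (what j n))
    -- the data: independent samples from the sources and the target
    {W : Type*} [MeasurableSpace W] (μ : Measure W) [IsProbabilityMeasure μ]
    (Z : Fin K → FedCS.Part → ℕ → W → 𝒳 × 𝒴) (XT : ℕ → W → 𝒳)
    (hZm : ∀ j s i, Measurable (Z j s i)) (hXTm : ∀ i, Measurable (XT i))
    (hZ : ∀ j s i, μ.map (Z j s i) = FedCS.law (pS j))
    (hXT : ∀ i, μ.map (XT i) = (FedCS.law pT).map Prod.fst)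
    (hZind : iIndepFun (fun (q : Fin K × FedCS.Part × ℕ) => Z q.1 q.2.1 q.2.2) μ)
    (hXTind : iIndepFun XT μ)
    (hZXT : IndepFun (fun w (q : Fin K × FedCS.Part × ℕ) => Z q.1 q.2.1 q.2.2 w)
      (fun w i => XT i w) μ)
    -- uniform boundedness of the estimated control variate coefficients, in fourth mean
    (heta : ∃ B : ℝ≥0, ∀ j, ∀ᶠ s : (Fin K → ℕ) × FedCS.TrainSizes K in atTop,
      eLpNorm (fun w => FedCS.etaHat (FedCS.lossVal L h θ rhat what Z XT s.1 s.2 w j)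
        (FedCS.ratioVal rhat Z XT s.1 s.2 w j)) 4 μ ≤ B) :
    -- both estimates have a finite variance as soon as all sample sizes are large
    (∀ᶠ s : (Fin K → ℕ) × FedCS.TrainSizes K in atTop,
      MemLp (FedCS.FedDAE L h θ rhat what Z XT s.1 s.2) 2 μ ∧
      MemLp (FedCS.FedIWE L h θ rhat what Z XT s.1 s.2) 2 μ) ∧
    -- the limits of the variances exist and are ordered
    (∃ vDA vIW : ℝ,
      Tendsto (fun s : (Fin K → ℕ) × FedCS.TrainSizes K =>
        Var[FedCS.FedDAE L h θ rhat what Z XT s.1 s.2; μ]) atTop (𝓝 vDA) ∧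
      Tendsto (fun s : (Fin K → ℕ) × FedCS.TrainSizes K =>
        Var[FedCS.FedIWE L h θ rhat what Z XT s.1 s.2; μ]) atTop (𝓝 vIW) ∧
      vDA ≤ vIW) ∧
    -- the variances are ordered to leading order
    (∀ c > (0 : ℝ), ∀ ε > (0 : ℝ), ∀ᶠ m : Fin K → ℕ in atTop,
      (∀ j, c * ∑ k, (m k : ℝ) ≤ m j) →
      ∀ᶠ t : FedCS.TrainSizes K in atTop,
        Var[FedCS.FedDAE L h θ rhat what Z XT m t; μ] ≤
          (1 + ε) * Var[FedCS.FedIWE L h θ rhat what Z XT m t; μ]) := by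
  -- Without sources both estimates are zero; otherwise the normalization of the weights makes
  -- sense.
  rcases isEmpty_or_nonempty (Fin K) with hK | hK
  · have h1 : ∀ m t, FedCS.FedDAE L h θ rhat what Z XT m t = fun _ => 0 := fun m t => by
      ext w; simp [FedCS.FedDAE, FedCS.fedDA]
    have h2 : ∀ m t, FedCS.FedIWE L h θ rhat what Z XT m t = fun _ => 0 := fun m t => by
      ext w; simp [FedCS.FedIWE, FedCS.fedIW]
    have h0 : Var[fun _ : W => (0 : ℝ); μ] = 0 := variance_zero μ
    simp only [h1, h2, h0]
    refine ⟨Eventually.of_forall fun _ => ⟨memLp_const 0, memLp_const 0⟩, ⟨0, 0, ?_, ?_, le_rfl⟩,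
      fun c _ ε _ => Eventually.of_forall fun m _ => Eventually.of_forall fun t => ?_⟩
    · exact tendsto_const_nhds
    · exact tendsto_const_nhds
    · simp
  have := FedCS.isFiniteMeasure_subtype h𝒳 h𝒳b
  have := FedCS.isFiniteMeasure_subtype_real h𝒴 h𝒴b
  obtain ⟨C, hC⟩ := hL
  obtain ⟨A, hA0, hA⟩ := FedCS.exists_abs_loss_le h𝒴b hC
  obtain ⟨κ, hκ⟩ := hker
  obtain ⟨B, hB⟩ := heta
  choose u hu using hrH
  -- measurability and continuity of the loss
  have cL : ∀ z : 𝒳 × 𝒴, Continuous fun ω => L (h z.1 ω θ) z.2 := fun z =>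
    hC.continuous.comp ((hcont z.1).prodMk continuous_const)
  have mLu : Measurable (Function.uncurry L) := hC.continuous.measurable
  have mL : ∀ ω, Measurable fun z : 𝒳 × 𝒴 => L (h z.1 ω θ) z.2 := fun ω =>
    mLu.comp (((hmeas ω).comp measurable_fst).prodMk measurable_snd)
  have mL' : Measurable fun q : Om × 𝒳 × 𝒴 => L (h q.2.1 q.1 θ) q.2.2 :=
    measurable_uncurry_of_continuous_of_measurable
      (u := fun ω (z : 𝒳 × 𝒴) => L (h z.1 ω θ) z.2) cL mL
  -- boundedness of the density ratios
  have hb : ∀ x, ‖FedCS.kfun H x‖ ≤ √κ := fun x => by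
    refine ((RKHS.kerFun H x).le_opNorm 1).trans ?_
    rw [norm_one, mul_one, RKHS.norm_kerFun_eq_sqrt_norm_kernel]
    exact Real.sqrt_le_sqrt (hκ x)
  obtain ⟨M, hM0, hM⟩ : ∃ M : ℝ, 0 ≤ M ∧ ∀ j x, |u j x| ≤ M :=
    ⟨∑ j, ‖u j‖ * √κ, by positivity, fun j x => (FedCS.abs_apply_le hb (u j) x).trans
      (Finset.single_le_sum (f := fun j => ‖u j‖ * √κ) (fun j _ => by positivity)
        (Finset.mem_univ j))⟩
  have hV := FedCS.valModel_of_sources hpS hpT hpS1 hpT1 hsupp hcond mL hA hfT hvar hdiv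
    (fun j => hHmeas (u j)) hM hu hZm hZ hZind
  -- the fitted values
  set R : FedCS.TrainSizes K → Fin K → ℕ → W → ℝ := fun t j i w =>
    rhat j (t.1 j) t.2.2 (fun k => (Z j .de k w).1) (fun k => XT k w) (Z j .val i w).1 with hR
  set ℓ : FedCS.TrainSizes K → Fin K → ℕ → W → ℝ := fun t j i w =>
    L (h (Z j .val i w).1 (what j (t.2.1 j) fun k => Z j .tr k w) θ) (Z j .val i w).2 with hℓ
  have mR : ∀ t j i, Measurable (R t j i) := fun t j i =>
    (hrhatm j (t.1 j) t.2.2).comp (f := fun w =>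
      ((fun k : Fin (t.1 j) => (Z j .de k w).1), (fun k : Fin t.2.2 => XT k w), (Z j .val i w).1))
      (by fun_prop)
  have mwh : ∀ (t : FedCS.TrainSizes K) j,
      Measurable fun w => what j (t.2.1 j) fun k => Z j .tr k w := fun t j =>
    (hwhatm j _).comp (by fun_prop)
  have mℓ : ∀ t j i, Measurable (ℓ t j i) := fun t j i => mL'.comp ((mwh t j).prodMk (hZm j _ i))
  -- Summing over sources gives one bound for all of them. The factors `A` and `M` come from the
  -- product of ratio and loss, the `1` from the ratio alone.
  set e : FedCS.TrainSizes K → ℝ≥0∞ := fun t => ∑ j, ((1 + ENNReal.ofReal A) *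
    FedCS.ratioErr pS rhat μ Z XT u j t +
    ENNReal.ofReal M * FedCS.lossErr pS L h θ what μ Z omS j t) with he
  have helim : Tendsto e atTop (𝓝 0) := by
    have h1 : ∀ j, Tendsto (fun t => (1 + ENNReal.ofReal A) *
        FedCS.ratioErr pS rhat μ Z XT u j t +
        ENNReal.ofReal M * FedCS.lossErr pS L h θ what μ Z omS j t) atTop (𝓝 0) := fun j => by
      have t1 := ENNReal.Tendsto.const_mul (a := 1 + ENNReal.ofReal A)
        (FedCS.tendsto_ratioErr hZm hXTm hZ hZind hpS hpT hpS1 hpT1 hsupp hcond hHmeas hb hu hlam0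
          hlam hlam' hrhat hXT hXTind j) (Or.inr (by simp))
      have t2 := ENNReal.Tendsto.const_mul (a := ENNReal.ofReal M)
        (FedCS.tendsto_lossErr hZm hZ hZind hpS1 mL cL hA homS hwhat hwhatm j) (Or.inr (by simp))
      simpa using t1.add t2
    simpa using tendsto_finsetSum Finset.univ fun j _ => h1 j
  have hele : ∀ t j, (1 + ENNReal.ofReal A) * FedCS.ratioErr pS rhat μ Z XT u j t +
      ENNReal.ofReal M * FedCS.lossErr pS L h θ what μ Z omS j t ≤ e t := fun t j =>
    Finset.single_le_sum (f := fun j => (1 + ENNReal.ofReal A) *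
      FedCS.ratioErr pS rhat μ Z XT u j t +
      ENNReal.ofReal M * FedCS.lossErr pS L h θ what μ Z omS j t) (fun _ _ => zero_le)
      (Finset.mem_univ j)
  have heR : ∀ t j i, eLpNorm (fun w => R t j i w - u j (Z j .val i w).1) 4 μ ≤ e t :=
    fun t j i => by
      refine (FedCS.eLpNorm_ratio_sub hZm hXTm hZ hZind hZXT (fun j => hHmeas (u j)) hrhatm
        t j i).le.trans (le_trans ?_ (hele t j))
      rw [add_mul, one_mul, add_assoc]
      exact le_self_add
  have heA : ∀ t j i, eLpNorm (fun w => R t j i w * ℓ t j i w - u j (Z j .val i w).1 *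
      L (h (Z j .val i w).1 (omS j) θ) (Z j .val i w).2) 4 μ ≤ e t := fun t j i => by
    refine (FedCS.eLpNorm_mul_sub_mul_le (mR t j i) ((hHmeas (u j)).comp (hZm j _ i).fst)
      (mℓ t j i) ((mL (omS j)).comp (hZm j _ i)) (fun w => hA _ _) (fun w => hM j _) hA0 hM0
      (FedCS.eLpNorm_ratio_sub hZm hXTm hZ hZind hZXT (fun j => hHmeas (u j)) hrhatm t j i).le
      (FedCS.eLpNorm_loss_sub hZm hXTm hZ hZind hZXT mL' hwhatm t j i).le).trans
      (le_trans ?_ (hele t j))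
    gcongr
    exact le_add_self
  have main := hV.variance_comparison (fun t j i => (mR t j i).mul (mℓ t j i)) mR helim heA heR
    (B := B) fun j => by rw [prod_atTop_atTop_eq]; exact hB j
  rw [prod_atTop_atTop_eq] at main
  obtain ⟨p1, ⟨p2, p3⟩, p4⟩ := main
  -- Both limits of the variances are zero.
  exact ⟨p1, ⟨0, 0, p2, p3, le_rfl⟩, p4⟩
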